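/- Let $P$ be a subfactor planar algebra of modulus $\delta>1$, i.e. a complex $*$-planar algebra with spaces $P_c$, $c\in\{0_+,0_-,1,2,\dots\}$ (put $P_0:=P_{0_+}$), that are finite-dimensional, with $\dim P_{0_\pm}=1$, that is spherical, in which a contractible closed loop may be removed at the cost of a factor $\delta$, and for which the normalised picture trace $\tau$ on each $P_n$ satisfies $\tau(x^*x)>0$ for $x\ne 0$. Let $Q$ be a $*$-planar subalgebra of $P$, i.e. subspaces $Q_c\subseteq P_c$ closed under $*$ and under the action of all planar tangles. For $k\ge 0$ let $F_k(P)=\bigoplus_{n\ge k}P_n$ be the graded algebra of the Guionnet--Jones--Shlyakhtenko construction: an element of $P_m\subseteq F_k(P)$ is drawn as a box with distinguished arc at its top left corner, with $k$ strings on the left, $k$ on the right and $2m-2k$ at the top. For $a\in P_m$, $b\in P_n$ the product is $a\#b=\sum_{t=|m-n|+k}^{m+n-k}(a\#b)_t$, where $(a\#b)_t\in P_t$ is obtained by placing $a$ to the left of $b$, joining the $k$ right strings of $a$ to the $k$ left strings of $b$ and joining the last $m+n-k-t$ top strings of $a$ to the first $m+n-k-t$ top strings of $b$; the involution is $a^\dagger=Z_{R^k}(a^*)$,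 with $R$ the rotation, i.e. the box of $a$ reflected in a vertical line; the unit is the unit of $P_k$ and the trace is $t_k(a)=\tau(a_k)$, where $a_k$ is the component of $a$ in $P_k$. The inclusion $F_0(P)\subseteq F_1(P)$ adds a string below the box, and $E_0:F_1(P)\to F_0(P)$ is $\delta^{-1}$ times the map that joins the left and the right string below the box. The same construction is applied to $Q$. A finite pre-von Neumann algebra is a complex unital $*$-algebra $A$ with a normalised trace $t$ such that $\langle a,b\rangle=t(b^*a)$ is an inner product for which all left multiplications are bounded. A quadruple $A_{00}\subseteq A_{01}\subseteq A_{11}$, $A_{00}\subseteq A_{10}\subseteq A_{11}$ of finite pre-von Neumann algebras is a commuting square if all inclusions are unital trace-preserving inclusions of $*$-algebras and there are $*$- and trace-preserving $A_{ij}$-$A_{ij}$ bimodule retractions $E_{A_{ij}}:A_{11}\to A_{ij}$ with $E_{A_{10}}E_{A_{01}}=E_{A_{00}}=E_{A_{01}}E_{A_{10}}$. Then $$\begin{matrix}F_0(P)&\subseteq&F_1(P)\\ \cup&&\cup\\ F_0(Q)&\subseteq&F_1(Q)\end{matrix}$$ is a commuting square of finite pre-von Neumann algebras. More precisely, there are linear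 maps $E_{Q_n}:P_n\to Q_n$ ($n\ge 0$) with $\tau(E_{Q_n}(x)y)=\tau(xy)$ for $x\in P_n$, $y\in Q_n$, and the retractions of $F_1(P)$ onto $F_0(P)$, $F_1(Q)$ and $F_0(Q)$ may be taken to be $E_0$, the componentwise map $E=\bigoplus_{n\ge 1}E_{Q_n}$, and $\big(\bigoplus_{n\ge 0}E_{Q_n}\big)\circ E_0$ respectively; in particular $E\circ E_0=E_0\circ E$. -/

import Mathlib

open scoped DirectSum ComplexConjugate

universe u v

noncomputable section

/-! ## Colours, planar tangles and their isotopies -/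

/-- The colours `0₊ = zero false`, `0₋ = zero true` and `n + 1 = pos n`. -/
inductive Col : Type
  | zero (shaded : Bool)
  | pos (n : ℕ)

namespace Col

/-- A disc of colour `c` has `2 * c.size` marked points on its boundary. -/
def size : Col → ℕ
  | zero _ => 0
  | pos n => n + 1

/-- Whether the region at the distinguished boundary arc of a disc of this colour is shaded. -/
def shaded : Col → Bool
  | zero s => s
  | pos _ => false

/-- The colour `n`, where the colour `0` is read as `0₊`. -/
def ofNat : ℕ → Col
  | 0 => zero false
  | n + 1 => pos n

@[simp] theorem size_zero (s : Bool) : (zero s).size = 0 := rfl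
@[simp] theorem shaded_zero (s : Bool) : (zero s).shaded = s := rfl
@[simp] theorem size_ofNat (n : ℕ) : (ofNat n).size = n := by cases n <;> rfl
@[simp] theorem shaded_ofNat (n : ℕ) : (ofNat n).shaded = false := by cases n <;> rfl

end Col

/-- What can be born at a given height of a labelled tangle: a local minimum of a string, or an
internal disc of colour `c` carrying the label `x`, drawn with all its marked points on top, in
clockwise order from left to right, so that its distinguished arc runs along its left, bottom and
right sides. -/
inductive Piece (V : Col → Type v) : Type v
  | arc
  | box (c : Col) (x : V c)

namespace Piece
variable {V : Col → Type v} {W : Col → Type u}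

/-- The number of strings that leave the piece upwards. -/
def legs : Piece V → ℕ
  | arc => 2
  | box c _ => 2 * c.size

/-- Whether the piece may be put into a region of the given shading. -/
def Fits : Piece V → Bool → Prop
  | arc, _ => True
  | box c _, s => c.shaded = s

/-- Change of labels. -/
def map (f : ∀ c, V c → W c) : Piece V → Piece W
  | arc => arc
  | box c x => box c (f c x)

end Piece

/-- One horizontal slice of a tangle diagram: `ins p g` creates the piece `g` between the `p`
leftmost strings and the remaining ones, and `cap p` joins the strings number `p` and `p + 1`
(counted from `0`, from left to right) by a local maximum. -/
inductive Step (V : Col → Type v) : Type v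
  | ins (p : ℕ) (g : Piece V)
  | cap (p : ℕ)

namespace Step
variable {V : Col → Type v} {W : Col → Type u}

/-- Change of labels. -/
def map (f : ∀ c, V c → W c) : Step V → Step W
  | ins p g => ins p (g.map f)
  | cap p => cap p

/-- Translation to the right by `r` strings. -/
def shift (r : ℕ) : Step V → Step V
  | ins p g => ins (p + r) g
  | cap p => cap (p + r)

end Step

open Step Piece

section Words
variable {V : Col → Type v} {W : Col → Type u}

/-- `Admissible s w l w'`: the slices `l`, read from bottom to top, can be stacked on `w` strings,
the region on the far left having shading `s`, and `w'` strings leave at the top. Regions are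
shaded in a checkerboard fashion, so that the region to the right of `p` strings has shading
`s` plus the parity of `p`. -/
def Admissible (s : Bool) : ℕ → List (Step V) → ℕ → Prop
  | w, [], w' => w = w'
  | w, ins p g :: l, w' => p ≤ w ∧ g.Fits (Bool.xor s p.bodd) ∧ Admissible s (w + g.legs) l w'
  | w, cap p :: l, w' => p + 2 ≤ w ∧ Admissible s (w - 2) l w'

/-- `N` nested minima, starting after the `p` leftmost strings. -/
def nestCups (V : Col → Type v) (p N : ℕ) : List (Step V) :=
  (List.range N).map fun i => ins (p + i) arc

/-- `N` nested maxima around the gap to the left of the string number `q`: the strings number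
`q - 1 - i` and `q + i` are joined for `0 ≤ i < N`. -/
def nestCaps (V : Col → Type v) (q N : ℕ) : List (Step V) :=
  (List.range N).map fun i => cap (q - 1 - i)

/-- The elementary planar isotopies of tangle diagrams. -/
inductive Move : List (Step V) → List (Step V) → Prop
  /- straightening of a string -/
  | zigzag_left (p : ℕ) : Move [ins p arc, cap (p + 1)] []
  | zigzag_right (p : ℕ) : Move [ins (p + 1) arc, cap p] []
  /- interchange of the heights of two disjoint events -/
  | ins_ins (p q : ℕ) (g h : Piece V) : q ≤ p →
      Move [ins p g, ins q h] [ins q h, ins (p + h.legs) g]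
  | ins_cap_left (p q : ℕ) (g : Piece V) : q ≤ p →
      Move [ins (p + 2) g, cap q] [cap q, ins p g]
  | ins_cap_right (p q : ℕ) (g : Piece V) : p ≤ q →
      Move [ins p g, cap (q + g.legs)] [cap q, ins p g]
  | cap_cap (p q : ℕ) : q ≤ p → Move [cap (p + 2), cap q] [cap q, cap p]
  /- rotation of an internal disc by a full turn -/
  | rotate (p : ℕ) (c : Col) (x : V c) :
      Move (nestCups V p (2 * c.size) ++ ins (p + 2 * c.size) (box c x) ::
        nestCaps V (p + 2 * c.size) (2 * c.size)) [ins p (box c x)]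

/-- The mirror image in a vertical line of the slices `l` stacked on `w` strings, with `st` applied
to the labels. -/
def mirror (st : ∀ c, V c → V c) : ℕ → List (Step V) → List (Step V)
  | _, [] => []
  | w, ins p g :: l => ins (w - p) (g.map st) :: mirror st (w + g.legs) l
  | w, cap p :: l => cap (w - 2 - p) :: mirror st (w - 2) l

theorem Piece.legs_map (f : ∀ c, V c → W c) (g : Piece V) : (g.map f).legs = g.legs := by
  cases g <;> rfl

theorem Piece.fits_map (f : ∀ c, V c → W c) (g : Piece V) (s : Bool) :
    (g.map f).Fits s ↔ g.Fits s := by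
  cases g <;> rfl

theorem Piece.legs_even (g : Piece V) : g.legs.bodd = false := by
  cases g <;> simp [legs]

theorem admissible_map (f : ∀ c, V c → W c) (s : Bool) (l : List (Step V)) (w w' : ℕ) :
    Admissible s w (l.map (Step.map f)) w' ↔ Admissible s w l w' := by
  induction l generalizing w with
  | nil => rfl
  | cons a l ih =>
    cases a <;> simp [Admissible, Step.map, Piece.legs_map, Piece.fits_map, ih]

theorem admissible_append (s : Bool) (l₁ l₂ : List (Step V)) {w w₁ w₂ : ℕ}
    (h₁ : Admissible s w l₁ w₁) (h₂ : Admissible s w₁ l₂ w₂) : Admissible s w (l₁ ++ l₂) w₂ := by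
  induction l₁ generalizing w with
  | nil => cases h₁; exact h₂
  | cons a l ih =>
    cases a with
    | ins p g => exact ⟨h₁.1, h₁.2.1, ih h₁.2.2⟩
    | cap p => exact ⟨h₁.1, ih h₁.2⟩

theorem admissible_mirror (st : ∀ c, V c → V c) (s : Bool) (l : List (Step V)) (w w' : ℕ)
    (hw : w.bodd = false) (h : Admissible s w l w') : Admissible s w (mirror st w l) w' := by
  induction l generalizing w with
  | nil => exact h
  | cons a l ih =>
    cases a with
    | ins p g =>
      obtain ⟨hp, hf, h⟩ := h
      refine ⟨Nat.sub_le _ _, ?_, ?_⟩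
      · rw [Piece.fits_map]
        have : (w - p).bodd = p.bodd := by
          have h1 : ((w - p) + p).bodd = false := by rw [Nat.sub_add_cancel hp, hw]
          rw [Nat.bodd_add] at h1
          revert h1
          cases (w - p).bodd <;> cases p.bodd <;> simp
        rwa [this]
      · rw [Piece.legs_map]
        exact ih _ (by simp [hw, Piece.legs_even]) h
    | cap p =>
      obtain ⟨hp, h⟩ := h
      refine ⟨by omega, ih _ ?_ h⟩
      obtain ⟨v, rfl⟩ : ∃ v, w = v + 2 := ⟨w - 2, by omega⟩
      simpa using hw

theorem admissible_nestCups (s : Bool) (w p N : ℕ) (h : p ≤ w) :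
    Admissible s w (nestCups V p N) (w + 2 * N) := by
  induction N with
  | zero => rfl
  | succ N ih =>
    have : nestCups V p (N + 1) = nestCups V p N ++ [ins (p + N) arc] := by
      simp [nestCups, List.range_succ]
    rw [this]
    refine admissible_append s _ _ ih ⟨by omega, trivial, ?_⟩
    simp [Admissible, legs]; ring

theorem admissible_nestCaps (s : Bool) (w q N : ℕ) (h : N ≤ q) (h' : q + N ≤ w) :
    Admissible s w (nestCaps V q N) (w - 2 * N) := by
  induction N with
  | zero => rfl
  | succ N ih =>
    have : nestCaps V q (N + 1) = nestCaps V q N ++ [cap (q - 1 - N)] := by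
      simp [nestCaps, List.range_succ]
    rw [this]
    refine admissible_append s _ _ (ih (by omega) (by omega)) ⟨by omega, ?_⟩
    simp [Admissible]; omega

theorem map_nestCups (f : ∀ c, V c → W c) (p N : ℕ) :
    (nestCups V p N).map (Step.map f) = nestCups W p N := by
  simp [nestCups, Step.map, Piece.map]

theorem map_nestCaps (f : ∀ c, V c → W c) (q N : ℕ) :
    (nestCaps V q N).map (Step.map f) = nestCaps W q N := by
  simp [nestCaps, Step.map]

theorem map_shift (f : ∀ c, V c → W c) (r : ℕ) (l : List (Step V)) :
    (l.map (Step.shift r)).map (Step.map f) = (l.map (Step.map f)).map (Step.shift r) := by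
  simp only [List.map_map]
  refine List.map_congr_left fun a _ => ?_
  cases a <;> rfl

theorem map_mirror (f : ∀ c, V c → W c) (st : ∀ c, V c → V c) (st' : ∀ c, W c → W c)
    (hf : ∀ c x, f c (st c x) = st' c (f c x)) (w : ℕ) (l : List (Step V)) :
    (mirror st w l).map (Step.map f) = mirror st' w (l.map (Step.map f)) := by
  induction l generalizing w with
  | nil => rfl
  | cons a l ih =>
    cases a with
    | ins p g => cases g <;> simp [mirror, Step.map, Piece.map, Piece.legs, ih, hf]
    | cap p => simp [mirror, Step.map, ih]

theorem Move.map (f : ∀ c, V c → W c) {l l' : List (Step V)} (h : Move l l') :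
    Move (l.map (Step.map f)) (l'.map (Step.map f)) := by
  cases h with
  | zigzag_left p => exact Move.zigzag_left p
  | zigzag_right p => exact Move.zigzag_right p
  | ins_ins p q g h hq =>
    have := Move.ins_ins p q (g.map f) (h.map f) hq
    rwa [Piece.legs_map] at this
  | ins_cap_left p q g hq => exact Move.ins_cap_left p q (g.map f) hq
  | ins_cap_right p q g hq =>
    have := Move.ins_cap_right p q (g.map f) hq
    rwa [Piece.legs_map] at this
  | cap_cap p q hq => exact Move.cap_cap p q hq
  | rotate p c x =>
    rw [List.map_append, List.map_cons, map_nestCups, map_nestCaps]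
    exact Move.rotate p c (f c x)

end Words

/-- A planar tangle diagram whose external disc has colour `c` and whose internal discs carry labels
in the spaces `V`. The diagram is in generic position with respect to the height: it is cut into
slices, read from bottom to top, and all marked points of the external disc are on top, in clockwise
order from left to right. -/
structure Tangle (V : Col → Type v) (c : Col) where
  word : List (Step V)
  admissible : Admissible c.shaded 0 word (2 * c.size)

namespace Tangle
variable {V : Col → Type v} {W : Col → Type u} {c : Col}

/-- Change of labels. -/
def map (f : ∀ c, V c → W c) (T : Tangle V c) : Tangle W c :=
  ⟨T.word.map (Step.map f), (admissible_map f _ _ _ _).2 T.admissible⟩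

/-- The adjoint tangle: the mirror image, with `st` applied to the labels. -/
def adjoint (st : ∀ c, V c → V c) (T : Tangle V c) : Tangle V c :=
  ⟨mirror st 0 T.word, admissible_mirror st _ _ _ _ rfl T.admissible⟩

/-- Two diagrams differ by one elementary isotopy. -/
def MoveRel (T T' : Tangle V c) : Prop :=
  ∃ l₁ l₂ m m' : List (Step V), Move m m' ∧ T.word = l₁ ++ m ++ l₂ ∧ T'.word = l₁ ++ m' ++ l₂

/-- Planar isotopy of tangle diagrams. -/
def Isotopic (T T' : Tangle V c) : Prop := Relation.EqvGen MoveRel T T'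

/-- The tangle without strings and internal discs, of colour `0₊` or `0₋`. -/
def empty (V : Col → Type v) (s : Bool) : Tangle V (Col.zero s) := ⟨[], rfl⟩

/-- The identity tangle with internal label `x`. -/
def ident (x : V c) : Tangle V c :=
  ⟨[ins 0 (box c x)], by simp [Admissible, Fits, legs]⟩

theorem Isotopic.map (f : ∀ c, V c → W c) {T T' : Tangle V c} (h : Isotopic T T') :
    Isotopic (T.map f) (T'.map f) := by
  induction h with
  | rel T T' h =>
    obtain ⟨l₁, l₂, m, m', hm, h, h'⟩ := h
    refine Relation.EqvGen.rel _ _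
      ⟨l₁.map (Step.map f), l₂.map (Step.map f), _, _, hm.map f, ?_, ?_⟩
    · simp [Tangle.map, h]
    · simp [Tangle.map, h']
  | refl T => exact Relation.EqvGen.refl _
  | symm T T' _ ih => exact Relation.EqvGen.symm _ _ ih
  | trans T T' T'' _ _ ih ih' => exact Relation.EqvGen.trans _ _ _ ih ih'

end Tangle

/-! ## Planar algebras -/

/-- A complex `*`-planar algebra: vector spaces `V c` on which the labelled planar tangles act,
multilinearly in the labels, invariantly under planar isotopy, compatibly with the substitution of
tangles into internal discs, and compatibly with the involutions `st`. (The value `Z T` is what is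
usually written `Z_T(x₁ ⊗ ⋯ ⊗ x_b)`, the `x_i` being the labels.) -/
structure StarPlanarAlgebra where
  V : Col → Type u
  [addCommGroup : ∀ c, AddCommGroup (V c)]
  [module : ∀ c, Module ℂ (V c)]
  Z : ∀ {c : Col}, Tangle V c → V c
  Z_ident : ∀ {c : Col} (x : V c), Z (Tangle.ident x) = x
  Z_add : ∀ {c d : Col} (l₁ l₂ : List (Step V)) (p : ℕ) (x y : V d) (T T₁ T₂ : Tangle V c),
    T.word = l₁ ++ ins p (box d (x + y)) :: l₂ → T₁.word = l₁ ++ ins p (box d x) :: l₂ →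
    T₂.word = l₁ ++ ins p (box d y) :: l₂ → Z T = Z T₁ + Z T₂
  Z_smul : ∀ {c d : Col} (l₁ l₂ : List (Step V)) (p : ℕ) (a : ℂ) (x : V d) (T T₁ : Tangle V c),
    T.word = l₁ ++ ins p (box d (a • x)) :: l₂ → T₁.word = l₁ ++ ins p (box d x) :: l₂ →
    Z T = a • Z T₁
  Z_isotopic : ∀ {c : Col} (T T' : Tangle V c), T.Isotopic T' → Z T = Z T'
  Z_subst : ∀ {c d : Col} (l₁ l₂ : List (Step V)) (p : ℕ) (S : Tangle V d) (T T' : Tangle V c),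
    T.word = l₁ ++ ins p (box d (Z S)) :: l₂ →
    T'.word = l₁ ++ S.word.map (Step.shift p) ++ l₂ → Z T = Z T'
  st : ∀ c, V c →ₗ⋆[ℂ] V c
  st_st : ∀ (c : Col) (x : V c), st c (st c x) = x
  Z_adjoint : ∀ {c : Col} (T : Tangle V c), Z (T.adjoint fun d x => st d x) = st c (Z T)

attribute [instance] StarPlanarAlgebra.addCommGroup StarPlanarAlgebra.module

namespace StarPlanarAlgebra

variable (P : StarPlanarAlgebra.{u})

/-- The unit of `P_{0₊}` or `P_{0₋}`. -/
def one (s : Bool) : P.V (Col.zero s) := P.Z (Tangle.empty P.V s)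

/-- The functional on `P_{0₊}` or `P_{0₋}` with value `1` at the unit; it is unique, and the
identification with `ℂ`, if the space is one-dimensional. -/
def scalar (s : Bool) : P.V (Col.zero s) →ₗ[ℂ] ℂ :=
  Classical.epsilon fun φ => φ (P.one s) = 1

/-- The multiplication tangle of colour `n`: the last `n` points of `x` are joined to the first `n`
points of `y`. -/
def mulTangle {n : ℕ} (x y : P.V (Col.ofNat n)) : Tangle P.V (Col.ofNat n) :=
  ⟨[ins 0 (box _ x), ins (2 * n) (box _ y)] ++ nestCaps P.V (2 * n) n, by
    have h := admissible_nestCaps (V := P.V) false (2 * n + 2 * n) (2 * n) n (by omega) (by omega)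
    have e : 2 * n + 2 * n - 2 * n = 2 * n := by omega
    rw [e] at h
    simpa [Admissible, Fits, legs] using h⟩

/-- The product of `P_n`. -/
def mul {n : ℕ} (x y : P.V (Col.ofNat n)) : P.V (Col.ofNat n) := P.Z (P.mulTangle x y)

/-- The trace tangle of colour `n`: the points number `i` and `2n + 1 - i` are joined. -/
def traceTangle {n : ℕ} (x : P.V (Col.ofNat n)) : Tangle P.V (Col.zero false) :=
  ⟨ins 0 (box _ x) :: nestCaps P.V n n, by
    have h := admissible_nestCaps (V := P.V) false (2 * n) n n le_rfl (by omega)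
    simpa [Admissible, Fits, legs] using h⟩

/-- The normalised trace `τ` of `P_n`, for modulus `δ`. -/
def tau (δ : ℝ) {n : ℕ} (x : P.V (Col.ofNat n)) : ℂ :=
  ((δ : ℂ) ^ n)⁻¹ * P.scalar false (P.Z (P.traceTangle x))

/-- The closure of a `1`-box to the right. -/
def rightClosure (x : P.V (Col.pos 0)) : Tangle P.V (Col.zero false) :=
  ⟨[ins 0 (box _ x), cap 0], by simp [Admissible, Fits, legs, Col.size, Col.shaded]⟩

/-- The closure of a `1`-box to the left; the outer region is shaded. -/
def leftClosure (x : P.V (Col.pos 0)) : Tangle P.V (Col.zero true) :=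
  ⟨[ins 0 arc, ins 1 (box _ x), cap 0, cap 0], by
    simp [Admissible, Fits, legs, Col.size, Col.shaded]⟩

/-- Subfactor planar algebras of modulus `δ`. (The operation `mul` and the involution `st` then make
each `P_n` a finite-dimensional `C^*`-algebra, since `τ` is a faithful positive trace.) -/
structure IsSubfactor (δ : ℝ) : Prop where
  finite_dimensional : ∀ c, FiniteDimensional ℂ (P.V c)
  connected : ∀ s, Module.finrank ℂ (P.V (Col.zero s)) = 1
  modulus : ∀ {c : Col} (l₁ l₂ : List (Step P.V)) (p : ℕ) (T T' : Tangle P.V c),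
    T.word = l₁ ++ [ins p arc, cap p] ++ l₂ → T'.word = l₁ ++ l₂ → P.Z T = (δ : ℂ) • P.Z T'
  spherical : ∀ x : P.V (Col.pos 0),
    P.scalar false (P.Z (P.rightClosure x)) = P.scalar true (P.Z (P.leftClosure x))
  positive : ∀ (n : ℕ) (x : P.V (Col.ofNat n)), x ≠ 0 → 0 < (P.tau δ (P.mul (P.st _ x) x)).re

/-- A `*`-planar subalgebra: subspaces that are closed under the action of all planar tangles and
under the involution. -/
structure StarPlanarSubalgebra where
  carrier : ∀ c, Submodule ℂ (P.V c)
  Z_mem : ∀ {c : Col} (T : Tangle P.V c),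
    (∀ (p : ℕ) (d : Col) (x : P.V d), ins p (box d x) ∈ T.word → x ∈ carrier d) →
    P.Z T ∈ carrier c
  st_mem : ∀ (c : Col) (x : P.V c), x ∈ carrier c → P.st c x ∈ carrier c

namespace StarPlanarSubalgebra

variable {P} (Q : P.StarPlanarSubalgebra)

/-- The inclusion of `Q_c` into `P_c`. -/
def incl (c : Col) : Q.carrier c → P.V c := Subtype.val

theorem Z_map_mem {c : Col} (T : Tangle (fun c => Q.carrier c) c) :
    P.Z (T.map Q.incl) ∈ Q.carrier c := by
  refine Q.Z_mem _ fun p d x hx => ?_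
  obtain ⟨a, -, ha⟩ := List.mem_map.1 hx
  cases a with
  | cap q => simp [Step.map] at ha
  | ins q g =>
    cases g with
    | arc => simp [Step.map, Piece.map] at ha
    | box d' y =>
      simp only [Step.map, Piece.map, Step.ins.injEq, Piece.box.injEq] at ha
      obtain ⟨-, rfl, h⟩ := ha
      rw [← eq_of_heq h]
      exact y.2

/-- A `*`-planar subalgebra as a `*`-planar algebra. -/
def toStarPlanarAlgebra : StarPlanarAlgebra.{u} where
  V c := Q.carrier c
  Z T := ⟨P.Z (T.map Q.incl), Q.Z_map_mem T⟩
  Z_ident {c} x := Subtype.ext (P.Z_ident (Q.incl c x))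
  Z_add {c d} l₁ l₂ p x y T T₁ T₂ h h₁ h₂ := Subtype.ext <|
    P.Z_add (l₁.map (Step.map Q.incl)) (l₂.map (Step.map Q.incl)) p
      (Q.incl d x) (Q.incl d y) _ _ _
      (by simp [Tangle.map, h, Step.map, Piece.map, incl])
      (by simp [Tangle.map, h₁, Step.map, Piece.map, incl])
      (by simp [Tangle.map, h₂, Step.map, Piece.map, incl])
  Z_smul {c d} l₁ l₂ p a x T T₁ h h₁ := Subtype.ext <|
    P.Z_smul (l₁.map (Step.map Q.incl)) (l₂.map (Step.map Q.incl)) p a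
      (Q.incl d x) _ _
      (by simp [Tangle.map, h, Step.map, Piece.map, incl])
      (by simp [Tangle.map, h₁, Step.map, Piece.map, incl])
  Z_isotopic T T' h := Subtype.ext (P.Z_isotopic _ _ (h.map Q.incl))
  Z_subst l₁ l₂ p S T T' h h' := Subtype.ext <|
    P.Z_subst (l₁.map (Step.map Q.incl)) (l₂.map (Step.map Q.incl)) p (S.map Q.incl) _ _
      (by simp [Tangle.map, h, Step.map, Piece.map, incl])
      (by
        simp only [Tangle.map, h', List.map_append]
        rw [map_shift])
  st c :=
    { toFun := fun x => ⟨P.st c x, Q.st_mem c x x.2⟩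
      map_add' := fun x y => Subtype.ext (map_add (P.st c) (x : P.V c) y)
      map_smul' := fun a x => Subtype.ext ((P.st c).map_smulₛₗ a (x : P.V c)) }
  st_st c x := Subtype.ext (P.st_st c x)
  Z_adjoint T := Subtype.ext <| by
    refine Eq.trans (congrArg P.Z ?_) (P.Z_adjoint (T.map Q.incl))
    simp only [Tangle.map, Tangle.adjoint, Tangle.mk.injEq]
    exact map_mirror Q.incl _ (fun d x => P.st d x) (fun _ _ => rfl) _ _

end StarPlanarSubalgebra

/-! ## The graded algebras `F_k(P)` -/

/-- The vector space `F_k(P) = ⨁_{n ≥ k} P_n`; the summand of index `d` is `P_{k + d}`. An element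
of `P_{k + d}` is drawn as a box with its distinguished arc at the top left corner: clockwise from
there, it has `2d` strings at the top, `k` strings on the right and `k` strings on the left. -/
def GJS (k : ℕ) : Type u := ⨁ d : ℕ, P.V (Col.ofNat (k + d))

namespace GJS
variable (k : ℕ)

instance : AddCommGroup (P.GJS k) :=
  inferInstanceAs (AddCommGroup (⨁ d : ℕ, P.V (Col.ofNat (k + d))))

instance : Module ℂ (P.GJS k) :=
  inferInstanceAs (Module ℂ (⨁ d : ℕ, P.V (Col.ofNat (k + d))))

/-- The inclusion of the summand `P_{k + d}`. -/
def of (d : ℕ) : P.V (Col.ofNat (k + d)) →ₗ[ℂ] P.GJS k :=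
  DirectSum.lof ℂ ℕ (fun d => P.V (Col.ofNat (k + d))) d

/-- The component in `P_{k + d}`. -/
def component (d : ℕ) : P.GJS k →ₗ[ℂ] P.V (Col.ofNat (k + d)) :=
  DirectSum.component ℂ ℕ (fun d => P.V (Col.ofNat (k + d))) d

/-- The tangle of the component of colour `k + (d + e - j)` of a product `x # y`: `x` stands to the
left of `y`, the `k` strings on the right of `x` are joined to the `k` strings on the left of `y`,
and the last `j` strings at the top of `x` are joined to the first `j` strings at the top of `y`. -/
def mulTangle (d e j : ℕ) (hj : j ≤ 2 * min d e) (x : P.V (Col.ofNat (k + d)))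
    (y : P.V (Col.ofNat (k + e))) : Tangle P.V (Col.ofNat (k + (d + e - j))) :=
  ⟨[ins 0 (box _ x), ins (2 * d) (box _ y)] ++ nestCaps P.V (2 * d) j ++
      nestCaps P.V (2 * d + 2 * e + 2 * k - 2 * j) k, by
    have h₁ := admissible_nestCaps (V := P.V) false (2 * (k + d) + 2 * (k + e)) (2 * d) j
      (by omega) (by omega)
    have h₂ := admissible_nestCaps (V := P.V) false (2 * (k + d) + 2 * (k + e) - 2 * j)
      (2 * d + 2 * e + 2 * k - 2 * j) k (by omega) (by omega)
    have e₁ : 2 * (k + d) + 2 * (k + e) - 2 * j - 2 * k = 2 * (k + (d + e - j)) := by omega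
    rw [e₁] at h₂
    have h := admissible_append false _ _ h₁ h₂
    simpa [Admissible, Fits, legs] using h⟩

/-- The product `x # y` of homogeneous elements, with summands of colours
`k + d + e - j` for `0 ≤ j ≤ 2 min(d, e)`. -/
def mulHom (d e : ℕ) : P.V (Col.ofNat (k + d)) →ₗ[ℂ] P.V (Col.ofNat (k + e)) →ₗ[ℂ] P.GJS k :=
  ∑ j : Fin (2 * min d e + 1),
    LinearMap.mk₂ ℂ
      (fun x y => of P k (d + e - j) (P.Z (mulTangle P k d e j (Nat.le_of_lt_succ j.2) x y)))
      (fun x x' y => by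
        rw [← map_add]
        exact congrArg _ (P.Z_add [] _ 0 x x' _ _ _ rfl rfl rfl))
      (fun a x y => by
        rw [← map_smul]
        exact congrArg _ (P.Z_smul [] _ 0 a x _ _ rfl rfl))
      (fun x y y' => by
        rw [← map_add]
        exact congrArg _ (P.Z_add [ins 0 (box _ x)] _ _ y y' _ _ _ rfl rfl rfl))
      (fun a x y => by
        rw [← map_smul]
        exact congrArg _ (P.Z_smul [ins 0 (box _ x)] _ _ a y _ _ rfl rfl))

/-- The product `#` of `F_k(P)`. -/
def mulMap : P.GJS k →ₗ[ℂ] P.GJS k →ₗ[ℂ] P.GJS k :=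
  DirectSum.toModule ℂ ℕ (P.GJS k →ₗ[ℂ] P.GJS k) fun d =>
    (DirectSum.toModule ℂ ℕ (P.V (Col.ofNat (k + d)) →ₗ[ℂ] P.GJS k) fun e =>
      (mulHom P k d e).flip).flip

instance : Mul (P.GJS k) := ⟨fun a b => mulMap P k a b⟩

/-- The tangle of the identity of `P_k`, consisting of `k` strings. -/
def oneTangle : Tangle P.V (Col.ofNat (k + 0)) :=
  ⟨nestCups P.V 0 k, by
    simpa using admissible_nestCups (V := P.V) false 0 0 k le_rfl⟩

instance : One (P.GJS k) := ⟨of P k 0 (P.Z (oneTangle P k))⟩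

/-- The rotation by `2k` marked points: point `i` of the external disc is joined to point `i + 2k`
(modulo `2k + 2d`) of the internal disc. It is the `k`-th power of the rotation tangle. -/
def rotTangle (d : ℕ) (x : P.V (Col.ofNat (k + d))) : Tangle P.V (Col.ofNat (k + d)) :=
  ⟨nestCups P.V 0 (2 * k) ++ (ins (2 * k) (box _ x) :: nestCaps P.V (2 * k) (2 * k)), by
    have h₁ := admissible_nestCups (V := P.V) false 0 0 (2 * k) le_rfl
    have h₂ := admissible_nestCaps (V := P.V) false (0 + 2 * (2 * k) + 2 * (k + d)) (2 * k) (2 * k)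
      le_rfl (by omega)
    have e : 0 + 2 * (2 * k) + 2 * (k + d) - 2 * (2 * k) = 2 * (k + d) := by omega
    rw [e] at h₂
    rw [Col.shaded_ofNat, Col.size_ofNat]
    refine admissible_append false _ _ h₁ ⟨by omega, by simp [Fits], ?_⟩
    simpa [legs] using h₂⟩

theorem Z_rotTangle_zero (d : ℕ) : P.Z (rotTangle P k d 0) = 0 := by
  have := P.Z_smul (nestCups P.V 0 (2 * k)) (nestCaps P.V (2 * k) (2 * k)) (2 * k) 0 0
    (rotTangle P k d 0) (rotTangle P k d 0) (by rw [smul_zero]; rfl) rfl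
  rwa [zero_smul] at this

/-- The involution `†` of `F_k(P)`: on `P_n` it is the involution of `P_n` followed by the rotation
by `2k` marked points. -/
instance : Star (P.GJS k) :=
  ⟨DFinsupp.mapRange (fun d x => P.Z (rotTangle P k d (P.st _ x)))
    fun d => by rw [map_zero]; exact Z_rotTangle_zero P k d⟩

theorem scalar_trace_add {n : ℕ} (x y : P.V (Col.ofNat n)) :
    P.Z (P.traceTangle (x + y)) = P.Z (P.traceTangle x) + P.Z (P.traceTangle y) :=
  P.Z_add [] _ 0 x y _ _ _ rfl rfl rfl

theorem scalar_trace_smul {n : ℕ} (a : ℂ) (x : P.V (Col.ofNat n)) :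
    P.Z (P.traceTangle (a • x)) = a • P.Z (P.traceTangle x) :=
  P.Z_smul [] _ 0 a x _ _ rfl rfl

/-- The trace `t_k` of `F_k(P)`: the normalised trace of the component in `P_k`. -/
def trace (δ : ℝ) : P.GJS k →ₗ[ℂ] ℂ where
  toFun a := P.tau δ (component P k 0 a)
  map_add' a b := by
    rw [map_add]; unfold tau
    rw [scalar_trace_add, map_add, mul_add]
  map_smul' z a := by
    rw [map_smul]; unfold tau
    rw [scalar_trace_smul, map_smul, smul_eq_mul, RingHom.id_apply, smul_eq_mul, mul_left_comm]

/-- The inclusion tangle from `P_{k + d} ⊆ F_k(P)` to `P_{k + 1 + d} ⊆ F_{k + 1}(P)`: a string is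
added below the box. -/
def inclTangle (d : ℕ) (x : P.V (Col.ofNat (k + d))) : Tangle P.V (Col.ofNat (k + 1 + d)) :=
  ⟨[ins 0 (box _ x), ins (2 * d + k) arc], by
    simp [Admissible, Fits, legs]; omega⟩

/-- The inclusion of `F_k(P)` into `F_{k + 1}(P)`. -/
def incl : P.GJS k →ₗ[ℂ] P.GJS (k + 1) :=
  DirectSum.toModule ℂ ℕ (P.GJS (k + 1)) fun d =>
    (of P (k + 1) d).comp
      ({ toFun := fun x => P.Z (inclTangle P k d x)
         map_add' := fun x y => P.Z_add [] _ 0 x y _ _ _ rfl rfl rfl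
         map_smul' := fun a x => P.Z_smul [] _ 0 a x _ _ rfl rfl } :
        P.V (Col.ofNat (k + d)) →ₗ[ℂ] P.V (Col.ofNat (k + 1 + d)))

/-- The tangle of `δ E_k` from `P_{k + 1 + d} ⊆ F_{k + 1}(P)` to `P_{k + d} ⊆ F_k(P)`: the lowest
strings on the left and on the right are joined below the box. -/
def expTangle (d : ℕ) (x : P.V (Col.ofNat (k + 1 + d))) : Tangle P.V (Col.ofNat (k + d)) :=
  ⟨[ins 0 (box _ x), cap (2 * d + k)], by
    simp [Admissible, Fits, legs]; omega⟩

/-- The conditional expectation-like map `E_k` from `F_{k + 1}(P)` to `F_k(P)`. -/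
def exp (δ : ℝ) : P.GJS (k + 1) →ₗ[ℂ] P.GJS k :=
  DirectSum.toModule ℂ ℕ (P.GJS k) fun d =>
    (δ : ℂ)⁻¹ • (of P k d).comp
      ({ toFun := fun x => P.Z (expTangle P k d x)
         map_add' := fun x y => P.Z_add [] _ 0 x y _ _ _ rfl rfl rfl
         map_smul' := fun a x => P.Z_smul [] _ 0 a x _ _ rfl rfl } :
        P.V (Col.ofNat (k + 1 + d)) →ₗ[ℂ] P.V (Col.ofNat (k + d)))

end GJS

namespace StarPlanarSubalgebra

variable {P} (Q : P.StarPlanarSubalgebra) (k : ℕ)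

/-- The inclusion of `F_k(Q)` into `F_k(P)`, component by component. -/
def gjsIncl : Q.toStarPlanarAlgebra.GJS k →ₗ[ℂ] P.GJS k :=
  DirectSum.toModule ℂ ℕ (P.GJS k) fun d =>
    (GJS.of P k d).comp (Q.carrier (Col.ofNat (k + d))).subtype

/-- The map from `F_k(P)` to `F_k(Q)` given component by component by maps `E_n : P_n → Q_n`. -/
def gjsComponentwise (E : ∀ n, P.V (Col.ofNat n) →ₗ[ℂ] Q.carrier (Col.ofNat n)) :
    P.GJS k →ₗ[ℂ] Q.toStarPlanarAlgebra.GJS k :=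
  DirectSum.toModule ℂ ℕ (Q.toStarPlanarAlgebra.GJS k) fun d =>
    (GJS.of Q.toStarPlanarAlgebra k d).comp (E (k + d))

/-- The maps `E_n` are trace-preserving expectations of `P_n` onto `Q_n`:
`τ(E_n(x) y) = τ(x y)` for `y ∈ Q_n`. -/
def IsTraceExpectation (δ : ℝ) (E : ∀ n, P.V (Col.ofNat n) →ₗ[ℂ] Q.carrier (Col.ofNat n)) : Prop :=
  ∀ (n : ℕ) (x : P.V (Col.ofNat n)) (y : Q.carrier (Col.ofNat n)),
    P.tau δ (P.mul (E n x : P.V (Col.ofNat n)) y) = P.tau δ (P.mul x y)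

end StarPlanarSubalgebra

end StarPlanarAlgebra

/-! ## Finite pre-von Neumann algebras and commuting squares -/

/-- `A`, with its operations and with `t`, is a finite pre-von Neumann algebra: a complex unital
`*`-algebra with a normalised trace `t` for which `⟨a, b⟩ = t (b^* a)` is an inner product and all
left multiplications are bounded. -/
structure IsFinitePreVN (A : Type u) [AddCommGroup A] [Module ℂ A] [Mul A] [One A] [Star A]
    (t : A →ₗ[ℂ] ℂ) : Prop where
  mul_assoc : ∀ a b c : A, a * b * c = a * (b * c)
  one_mul : ∀ a : A, 1 * a = a
  mul_one : ∀ a : A, a * 1 = a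
  mul_add : ∀ a b c : A, a * (b + c) = a * b + a * c
  add_mul : ∀ a b c : A, (a + b) * c = a * c + b * c
  smul_mul : ∀ (z : ℂ) (a b : A), (z • a) * b = z • (a * b)
  mul_smul : ∀ (z : ℂ) (a b : A), a * (z • b) = z • (a * b)
  star_star : ∀ a : A, star (star a) = a
  star_add : ∀ a b : A, star (a + b) = star a + star b
  star_smul : ∀ (z : ℂ) (a : A), star (z • a) = conj z • star a
  star_mul : ∀ a b : A, star (a * b) = star b * star a
  trace_one : t 1 = 1
  trace_mul_comm : ∀ a b : A, t (a * b) = t (b * a)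
  inner_conj : ∀ a b : A, t (star b * a) = conj (t (star a * b))
  inner_pos : ∀ a : A, a ≠ 0 → 0 < (t (star a * a)).re
  bounded : ∀ a : A, ∃ C : ℝ, ∀ b : A,
    (t (star (a * b) * (a * b))).re ≤ C * (t (star b * b)).re

section Squares

variable {A : Type u} [AddCommGroup A] [Module ℂ A] [Mul A] [One A] [Star A]
variable {B : Type u} [AddCommGroup B] [Module ℂ B] [Mul B] [One B] [Star B]

/-- A compatible pair of finite pre-von Neumann algebras, with inclusion `i`. -/
structure IsCompatiblePair (tA : A →ₗ[ℂ] ℂ) (tB : B →ₗ[ℂ] ℂ) (i : A →ₗ[ℂ] B) : Prop where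
  preVN_left : IsFinitePreVN A tA
  preVN_right : IsFinitePreVN B tB
  injective : Function.Injective i
  map_one : i 1 = 1
  map_mul : ∀ a b : A, i (a * b) = i a * i b
  map_star : ∀ a : A, i (star a) = star (i a)
  trace : ∀ a : A, tB (i a) = tA a

/-- `E` is a `*`- and trace-preserving `A`-`A` bimodule retraction for the inclusion `i`. -/
structure IsBimoduleRetraction (tA : A →ₗ[ℂ] ℂ) (tB : B →ₗ[ℂ] ℂ) (i : A →ₗ[ℂ] B)
    (E : B →ₗ[ℂ] A) : Prop where
  retraction : ∀ a : A, E (i a) = a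
  map_star : ∀ b : B, E (star b) = star (E b)
  trace : ∀ b : B, tA (E b) = tB b
  left_mul : ∀ (a : A) (b : B), E (i a * b) = a * E b
  right_mul : ∀ (a : A) (b : B), E (b * i a) = E b * a

variable {A00 : Type u} [AddCommGroup A00] [Module ℂ A00] [Mul A00] [One A00] [Star A00]
variable {A01 : Type u} [AddCommGroup A01] [Module ℂ A01] [Mul A01] [One A01] [Star A01]
variable {A10 : Type u} [AddCommGroup A10] [Module ℂ A10] [Mul A10] [One A10] [Star A10]
variable {A11 : Type u} [AddCommGroup A11] [Module ℂ A11] [Mul A11] [One A11] [Star A11]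

/-- The quadruple `A00 ⊆ A01`, `A00 ⊆ A10`, `A01 ⊆ A11`, `A10 ⊆ A11` (with inclusions `i`, `j`,
`i'`, `j'`) is a commuting square of finite pre-von Neumann algebras, the retractions of `A11` onto
`A00`, `A01` and `A10` being `E00`, `E01` and `E10`. -/
structure IsCommutingSquare (t00 : A00 →ₗ[ℂ] ℂ) (t01 : A01 →ₗ[ℂ] ℂ) (t10 : A10 →ₗ[ℂ] ℂ)
    (t11 : A11 →ₗ[ℂ] ℂ) (i : A00 →ₗ[ℂ] A01) (j : A00 →ₗ[ℂ] A10) (i' : A01 →ₗ[ℂ] A11)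
    (j' : A10 →ₗ[ℂ] A11) (E00 : A11 →ₗ[ℂ] A00) (E01 : A11 →ₗ[ℂ] A01) (E10 : A11 →ₗ[ℂ] A10) :
    Prop where
  comm : ∀ a : A00, i' (i a) = j' (j a)
  pair_00_01 : IsCompatiblePair t00 t01 i
  pair_00_10 : IsCompatiblePair t00 t10 j
  pair_01_11 : IsCompatiblePair t01 t11 i'
  pair_10_11 : IsCompatiblePair t10 t11 j'
  retraction_00 : IsBimoduleRetraction t00 t11 (i' ∘ₗ i) E00
  retraction_01 : IsBimoduleRetraction t01 t11 i' E01
  retraction_10 : IsBimoduleRetraction t10 t11 j' E10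
  exp_10_01 : ∀ a : A11, j' (E10 (i' (E01 a))) = i' (i (E00 a))
  exp_01_10 : ∀ a : A11, i' (E01 (j' (E10 a))) = i' (i (E00 a))

end Squares

end

/-!
The idea is to reduce everything to one identity between closed diagrams for each inclusion, namely
that the proposed retraction is adjoint to the inclusion for the trace forms.

*Diagrams.* `StarPlanarAlgebra.Eqv` is equality of two sequences of slices in every context. It is
implied by isotopy and by substitution; nested strings are straightened by `Eqv.zigzag_left` and
`Eqv.zigzag_right`, and diagrams beside each other slide past each other by `Eqv.disjoint`. A box
`x` in `P_{k + d}` is turned to `bx k x`, whose strings start with the `k` strings on its left. For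
turned boxes all components of the product `#` are the same operation `con`: the last `k + j`
strings of `x` are joined to the first `k + j` strings of `y` (`bx_mulTangle`), and `†` is the
mirror image (`GJS.bx_star`). This makes associativity and the rule for `(x # y)†` evident. The
inner product of `F_1` is computed in the original picture; the string that has to be led around
the diagram is moved by sphericality (`closedVal_con_rotR_bx`).

*Finite pre-von Neumann algebras.* `ContractionSystem` collects the resulting algebraic laws. Left
multiplication by `a` is a finite sum of maps `b ↦ a ·ⱼ b`, joining `j` strings, and
`‖a ·ⱼ b‖² = ⟨c ·ⱼ b, b⟩`, where `c` joins all other strings of `a†` and `a`. The operator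
`b ↦ c ·ⱼ b` is symmetric, and its powers are given by the powers of `c` in the finite-dimensional
algebra formed by the boxes with `2j` strings at the top, half of which are joined. So it is
annihilated by a polynomial, and a symmetric operator annihilated by a polynomial is bounded
(`LinearMap.IsSymmetric.exists_bound_of_aeval_eq_zero`).

*The square.* The adjoint of a trace-preserving inclusion for the trace forms is automatically a
bimodule retraction, because the forms are nondegenerate
(`IsCompatiblePair.isBimoduleRetraction`). The map `E_0` is adjoint to `F_0 ⊆ F_1`
(`GJS.trace_mul_exp`), and the componentwise map is adjoint to `F_k(Q) ⊆ F_k(P)`, since the inner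
product of `F_k` is on each component a multiple of `τ(x^* y)`. As `E_0` of `P` restricts to `E_0`
of `Q`, the retractions commute, again by nondegeneracy (`isCommutingSquare_of_adjoint`).
-/

noncomputable section

open Step Piece

/-! ### Boundedness of symmetric operators annihilated by a polynomial -/

/-- A symmetric operator on an inner product space, of whatever dimension and not assumed
continuous, is bounded as soon as it is annihilated by a monic polynomial: its norms along an orbit
are logarithmically convex, so that they would outgrow the recursion given by the polynomial. -/
theorem LinearMap.IsSymmetric.exists_bound_of_aeval_eq_zero {E : Type*} [NormedAddCommGroup E]
    [InnerProductSpace ℂ E] (T : E →ₗ[ℂ] E) (hT : T.IsSymmetric) (p : Polynomial ℂ)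
    (hp : p.Monic) (h : Polynomial.aeval T p = 0) : ∃ C : ℝ, 0 ≤ C ∧ ∀ x, ‖T x‖ ≤ C * ‖x‖ := by
  set D := p.natDegree with hD
  set K : ℝ := ∑ i ∈ Finset.range D, ‖p.coeff i‖ with hK
  have hK0 : 0 ≤ K := Finset.sum_nonneg fun i _ => norm_nonneg _
  refine ⟨1 + K, by positivity, fun x => ?_⟩
  by_contra! hx
  set s : ℕ → ℝ := fun m => ‖(T ^ m) x‖ with hs
  have hconv : ∀ m, s (m + 1) ^ 2 ≤ s m * s (m + 2) := fun m => by
    have h1 : (T ^ (m + 1)) x = T ((T ^ m) x) := by rw [pow_succ']; rfl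
    have h2 : (T ^ (m + 2)) x = T (T ((T ^ m) x)) := by rw [pow_succ', pow_succ']; rfl
    simp only [hs, h1, h2]
    rw [← inner_self_eq_norm_sq (𝕜 := ℂ), hT]
    exact (RCLike.re_le_norm _).trans (norm_inner_le_norm _ _)
  have hpos : ∀ m, 0 < s (m + 1) ∧ (1 + K) * s m < s (m + 1) := fun m => by
    induction m with
    | zero =>
      have h0 : (1 + K) * s 0 < s 1 := by simpa [hs] using hx
      exact ⟨lt_of_le_of_lt (mul_nonneg (by positivity) (norm_nonneg _)) h0, h0⟩
    | succ m ih =>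
      have h1 : (1 + K) * s (m + 1) < s (m + 2) := by
        have h3 := hconv m
        have h4 : 0 < s m := by
          refine lt_of_le_of_ne (norm_nonneg _) fun h0 => ?_
          have h5 := pow_pos ih.1 2
          rw [← h0, zero_mul] at h3
          linarith
        have h5 : s m * ((1 + K) * s (m + 1)) < s m * s (m + 2) := by
          refine lt_of_lt_of_le ?_ h3
          nlinarith [mul_lt_mul_of_pos_right ih.2 ih.1]
        exact lt_of_mul_lt_mul_left h5 h4.le
      exact ⟨lt_of_le_of_lt (mul_nonneg (by positivity) (norm_nonneg _)) h1, h1⟩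
  have hmono : Monotone s := monotone_nat_of_le_succ fun m => by
    nlinarith [(hpos m).2, mul_nonneg hK0 (norm_nonneg ((T ^ m) x))]
  have hlt : ∀ i ∈ Finset.range D, (1 + K) * s i ≤ s D := fun i hi =>
    (hpos i).2.le.trans (hmono (Finset.mem_range.1 hi))
  have hrec : (T ^ D) x = -∑ i ∈ Finset.range D, p.coeff i • (T ^ i) x := by
    have h1 := congrArg (fun S : E →ₗ[ℂ] E => S x) h
    simp only [Polynomial.aeval_eq_sum_range, Finset.sum_range_succ, ← hD,
      LinearMap.add_apply, LinearMap.sum_apply, LinearMap.smul_apply, LinearMap.zero_apply] at h1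
    have h2 : p.coeff D = 1 := hp
    rw [h2, one_smul] at h1
    exact eq_neg_of_add_eq_zero_right h1
  have hDle : (1 + K) * s D ≤ K * s D := by
    have h1 : s D ≤ ∑ i ∈ Finset.range D, ‖p.coeff i‖ * s i := by
      simp only [hs]
      rw [hrec, norm_neg]
      exact (norm_sum_le _ _).trans (Finset.sum_le_sum fun i _ => (norm_smul_le _ _))
    calc (1 + K) * s D ≤ (1 + K) * ∑ i ∈ Finset.range D, ‖p.coeff i‖ * s i := by gcongr
      _ = ∑ i ∈ Finset.range D, ‖p.coeff i‖ * ((1 + K) * s i) := by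
        rw [Finset.mul_sum]; exact Finset.sum_congr rfl fun i _ => by ring
      _ ≤ ∑ i ∈ Finset.range D, ‖p.coeff i‖ * s D :=
        Finset.sum_le_sum fun i hi => mul_le_mul_of_nonneg_left (hlt i hi) (norm_nonneg _)
      _ = K * s D := by rw [hK, Finset.sum_mul]
  have hD0 : s D ≤ 0 := by linarith
  have : (1 + K) * s D < s (D + 1) := (hpos D).2
  -- `s 1 > 0`, hence `x ≠ 0`, whereas `s 0 ≤ s D ≤ 0`
  have h0 : s 0 ≤ 0 := (hmono (Nat.zero_le D)).trans hD0
  have hx0 : x = 0 := by simpa [hs] using h0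
  have := (hpos 0).1
  simp [hs, hx0] at this

/-! ### Algebras with partial contractions -/

/-- The algebraic content of the product of the algebras `F_k`: a complex vector space spanned by
finite-dimensional homogeneous parts `deg d` (boxes with `2d` strings at the top), with bilinear
operations `op j` (the last `j` strings of the first factor are joined to the first `j` strings of
the second one) whose sum is the product. The laws `assoc_of_le` and `assoc_of_eq` are the
associativity of the operations, according to whether the middle factor `y` keeps strings of its
own between its neighbours or is consumed by them, `g` further strings joining the outer factors. -/
structure ContractionSystem (A : Type u) [AddCommGroup A] [Module ℂ A] [Mul A] [One A] [Star A]
    (t : A →ₗ[ℂ] ℂ) where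
  deg : ℕ → Submodule ℂ A
  op : ℕ → A →ₗ[ℂ] A →ₗ[ℂ] A
  mulL : A →ₗ[ℂ] A →ₗ[ℂ] A
  starL : A →ₗ⋆[ℂ] A
  iSup_deg : ⨆ d, deg d = ⊤
  finite : ∀ d, FiniteDimensional ℂ (deg d)
  mul_def : ∀ a b, a * b = mulL a b
  star_def : ∀ a, star a = starL a
  op_mem : ∀ {d e} j {x y}, x ∈ deg d → y ∈ deg e → op j x y ∈ deg (d + e - j)
  op_eq_zero : ∀ {d e j x y}, x ∈ deg d → y ∈ deg e → 2 * d < j ∨ 2 * e < j → op j x y = 0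
  mul_eq_sum : ∀ {d e x y}, x ∈ deg d → y ∈ deg e →
    x * y = ∑ j ∈ Finset.range (2 * min d e + 1), op j x y
  assoc_of_le : ∀ {d e f i j x y z}, x ∈ deg d → y ∈ deg e → z ∈ deg f → i ≤ 2 * d → j ≤ 2 * f →
    i + j ≤ 2 * e → op j (op i x y) z = op i x (op j y z)
  assoc_of_eq : ∀ {d e f i j g x y z}, x ∈ deg d → y ∈ deg e → z ∈ deg f → i + g ≤ 2 * d →
    j + g ≤ 2 * f → i + j = 2 * e → op (j + g) (op i x y) z = op (i + g) x (op j y z)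
  one_mem : 1 ∈ deg 0
  one_op : ∀ {d x}, x ∈ deg d → op 0 1 x = x
  op_one : ∀ {d x}, x ∈ deg d → op 0 x 1 = x
  star_mem : ∀ {d x}, x ∈ deg d → star x ∈ deg d
  star_star : ∀ {d x}, x ∈ deg d → star (star x) = x
  star_op : ∀ {d e j x y}, x ∈ deg d → y ∈ deg e → j ≤ 2 * d → j ≤ 2 * e →
    star (op j x y) = op j (star y) (star x)
  trace_one : t 1 = 1
  trace_deg : ∀ {d x}, x ∈ deg d → d ≠ 0 → t x = 0
  trace_star : ∀ {x}, x ∈ deg 0 → t (star x) = conj (t x)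
  trace_op_comm : ∀ {d x y}, x ∈ deg d → y ∈ deg d → t (op (2 * d) x y) = t (op (2 * d) y x)
  trace_op_pos : ∀ {d x}, x ∈ deg d → x ≠ 0 → 0 < (t (op (2 * d) (star x) x)).re

namespace ContractionSystem

variable {A : Type u} [AddCommGroup A] [Module ℂ A] [Mul A] [One A] [Star A] {t : A →ₗ[ℂ] ℂ}
variable (S : ContractionSystem A t)
include S

theorem induction {p : A → Prop} (h : ∀ d, ∀ x ∈ S.deg d, p x)
    (hadd : ∀ x y, p x → p y → p (x + y)) (a : A) : p a :=
  Submodule.iSup_induction S.deg (motive := p) (x := a) (by rw [S.iSup_deg]; trivial) h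
    (h 0 0 (zero_mem _)) hadd

theorem mul_eq_sum_range {d e N : ℕ} {x y : A} (hx : x ∈ S.deg d) (hy : y ∈ S.deg e)
    (hN : 2 * min d e < N) : x * y = ∑ j ∈ Finset.range N, S.op j x y := by
  rw [S.mul_eq_sum hx hy]
  refine Finset.sum_subset (fun j hj => ?_) fun j _ hj => S.op_eq_zero hx hy ?_
  · simp only [Finset.mem_range] at hj ⊢; omega
  · simp only [Finset.mem_range] at hj; omega

theorem mul_add (a b c : A) : a * (b + c) = a * b + a * c := by simp [S.mul_def]

theorem add_mul (a b c : A) : (a + b) * c = a * c + b * c := by simp [S.mul_def]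

theorem mul_sum {ι : Type*} (s : Finset ι) (a : A) (f : ι → A) :
    a * ∑ i ∈ s, f i = ∑ i ∈ s, a * f i := by simp [S.mul_def]

theorem sum_mul {ι : Type*} (s : Finset ι) (a : A) (f : ι → A) :
    (∑ i ∈ s, f i) * a = ∑ i ∈ s, f i * a := by simp [S.mul_def]

theorem op_op_of_le {d e f i j : ℕ} {x y z : A} (hx : x ∈ S.deg d) (hy : y ∈ S.deg e)
    (hz : z ∈ S.deg f) (h : i + j ≤ 2 * e) :
    S.op j (S.op i x y) z = S.op i x (S.op j y z) := by
  by_cases hi : i ≤ 2 * d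
  · by_cases hj : j ≤ 2 * f
    · exact S.assoc_of_le hx hy hz hi hj h
    · rw [S.op_eq_zero (S.op_mem i hx hy) hz (by omega), S.op_eq_zero hy hz (by omega), map_zero]
  · rw [S.op_eq_zero hx hy (by omega), S.op_eq_zero hx (S.op_mem j hy hz) (by omega), map_zero,
      LinearMap.zero_apply]

theorem op_op_of_eq {d e f i j g : ℕ} {x y z : A} (hx : x ∈ S.deg d) (hy : y ∈ S.deg e)
    (hz : z ∈ S.deg f) (h : i + j = 2 * e) :
    S.op (j + g) (S.op i x y) z = S.op (i + g) x (S.op j y z) := by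
  by_cases hi : i + g ≤ 2 * d
  · by_cases hj : j + g ≤ 2 * f
    · exact S.assoc_of_eq hx hy hz hi hj h
    · rw [S.op_eq_zero (S.op_mem i hx hy) hz (by omega)]
      by_cases hj' : j ≤ 2 * f
      · rw [S.op_eq_zero hx (S.op_mem j hy hz) (by omega)]
      · rw [S.op_eq_zero hy hz (by omega), map_zero]
  · rw [S.op_eq_zero hx (S.op_mem j hy hz) (by omega)]
    by_cases hi' : i ≤ 2 * d
    · rw [S.op_eq_zero (S.op_mem i hx hy) hz (by omega)]
    · rw [S.op_eq_zero hx hy (by omega), map_zero, LinearMap.zero_apply]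

/-- Associativity on homogeneous elements. A triple product is on either side a sum over the
patterns in which the factors can be joined. If `i + j ≤ 2e`, the outer factors are not joined and
the summands are the same; the patterns with outer factors joined are matched by
`(i, j) ↦ (2i + j - 2e, 2e - i)`. -/
theorem mul_assoc_of_mem {d e f : ℕ} {x y z : A} (hx : x ∈ S.deg d) (hy : y ∈ S.deg e)
    (hz : z ∈ S.deg f) : x * y * z = x * (y * z) := by
  set N := 2 * (d + e + f) + 1 with hN
  have hl : x * y * z = ∑ p ∈ Finset.range N ×ˢ Finset.range N, S.op p.2 (S.op p.1 x y) z := by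
    rw [Finset.sum_product, S.mul_eq_sum_range hx hy (N := N) (by omega), S.sum_mul]
    exact Finset.sum_congr rfl fun i _ => S.mul_eq_sum_range (S.op_mem i hx hy) hz (by omega)
  have hr : x * (y * z) = ∑ p ∈ Finset.range N ×ˢ Finset.range N, S.op p.1 x (S.op p.2 y z) := by
    rw [Finset.sum_product_right, S.mul_eq_sum_range hy hz (N := N) (by omega), S.mul_sum]
    exact Finset.sum_congr rfl fun i _ => S.mul_eq_sum_range hx (S.op_mem i hy hz) (by omega)
  rw [hl, hr, ← Finset.sum_filter_add_sum_filter_not _ (fun p : ℕ × ℕ => p.1 + p.2 ≤ 2 * e),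
    ← Finset.sum_filter_add_sum_filter_not (Finset.range N ×ˢ Finset.range N)
      (fun p : ℕ × ℕ => p.1 + p.2 ≤ 2 * e) (fun p => S.op p.1 x (S.op p.2 y z))]
  congr 1
  · exact Finset.sum_congr rfl fun p hp => S.op_op_of_le hx hy hz (Finset.mem_filter.1 hp).2
  have hl0 : ∀ p : ℕ × ℕ, S.op p.2 (S.op p.1 x y) z ≠ 0 →
      p.1 ≤ 2 * d ∧ p.1 ≤ 2 * e ∧ p.2 ≤ 2 * f ∧ p.2 ≤ 2 * (d + e - p.1) := fun p hp => by
    refine ⟨?_, ?_, ?_, ?_⟩ <;> by_contra hc <;> apply hp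
    · rw [S.op_eq_zero hx hy (by omega), map_zero, LinearMap.zero_apply]
    · rw [S.op_eq_zero hx hy (by omega), map_zero, LinearMap.zero_apply]
    · rw [S.op_eq_zero (S.op_mem _ hx hy) hz (by omega)]
    · rw [S.op_eq_zero (S.op_mem _ hx hy) hz (by omega)]
  have hr0 : ∀ p : ℕ × ℕ, S.op p.1 x (S.op p.2 y z) ≠ 0 →
      p.2 ≤ 2 * e ∧ p.2 ≤ 2 * f ∧ p.1 ≤ 2 * d ∧ p.1 ≤ 2 * (e + f - p.2) := fun p hp => by
    refine ⟨?_, ?_, ?_, ?_⟩ <;> by_contra hc <;> apply hp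
    · rw [S.op_eq_zero hy hz (by omega), map_zero]
    · rw [S.op_eq_zero hy hz (by omega), map_zero]
    · rw [S.op_eq_zero hx (S.op_mem _ hy hz) (by omega)]
    · rw [S.op_eq_zero hx (S.op_mem _ hy hz) (by omega)]
  have heq : ∀ i j : ℕ, i ≤ 2 * e → 2 * e < i + j → S.op j (S.op i x y) z =
      S.op (2 * i + j - 2 * e) x (S.op (2 * e - i) y z) := fun i j hi hj => by
    have := S.op_op_of_eq (i := i) (j := 2 * e - i) (g := i + j - 2 * e) hx hy hz (by omega)
    rwa [show 2 * e - i + (i + j - 2 * e) = j by omega,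
      show i + (i + j - 2 * e) = 2 * i + j - 2 * e by omega] at this
  refine Finset.sum_bij_ne_zero (fun p _ _ => (2 * p.1 + p.2 - 2 * e, 2 * e - p.1)) ?_ ?_ ?_ ?_
  · rintro ⟨i, j⟩ hp h0
    obtain ⟨h1, h2, h3, h4⟩ := hl0 _ h0
    simp only [Finset.mem_filter, Finset.mem_product, Finset.mem_range] at hp h1 h2 h3 h4 ⊢
    omega
  · rintro ⟨i, j⟩ hp h0 ⟨i', j'⟩ hp' h0' h
    obtain ⟨h1, h2, h3, h4⟩ := hl0 _ h0
    obtain ⟨h1', h2', h3', h4'⟩ := hl0 _ h0'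
    simp only [Finset.mem_filter, Finset.mem_product, Finset.mem_range, Prod.mk.injEq] at *
    omega
  · rintro ⟨i, j⟩ hp h0
    obtain ⟨h1, h2, h3, h4⟩ := hr0 _ h0
    simp only [Finset.mem_filter, Finset.mem_product, Finset.mem_range] at hp h1 h2 h3 h4
    refine ⟨(2 * e - j, i + 2 * j - 2 * e), ?_, ?_, ?_⟩
    · simp only [Finset.mem_filter, Finset.mem_product, Finset.mem_range]; omega
    · rw [heq _ _ (by omega) (by omega)]
      convert h0 using 3 <;> grind
    · simp only [Prod.mk.injEq]; omega
  · rintro ⟨i, j⟩ hp h0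
    obtain ⟨h1, h2, h3, h4⟩ := hl0 _ h0
    simp only [Finset.mem_filter] at hp h2
    exact heq i j h2 (by omega)

theorem mul_assoc (a b c : A) : a * b * c = a * (b * c) := by
  induction a using S.induction with
  | hadd a a' h h' => simp only [S.add_mul, h, h']
  | h d x hx =>
    induction b using S.induction with
    | hadd b b' h h' => simp only [S.add_mul, S.mul_add, h, h']
    | h e y hy =>
      induction c using S.induction with
      | hadd c c' h h' => simp only [S.mul_add, h, h']
      | h f z hz => exact S.mul_assoc_of_mem hx hy hz

theorem one_mul (a : A) : 1 * a = a := by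
  induction a using S.induction with
  | hadd a a' h h' => rw [S.mul_add, h, h']
  | h d x hx => rw [S.mul_eq_sum S.one_mem hx]; simpa using S.one_op hx

theorem mul_one (a : A) : a * 1 = a := by
  induction a using S.induction with
  | hadd a a' h h' => rw [S.add_mul, h, h']
  | h d x hx => rw [S.mul_eq_sum hx S.one_mem]; simpa using S.op_one hx

theorem star_add (a b : A) : star (a + b) = star a + star b := by simp [S.star_def]

theorem star_smul (z : ℂ) (a : A) : star (z • a) = conj z • star a := by
  simp [S.star_def, map_smulₛₗ]

theorem star_sum {ι : Type*} (s : Finset ι) (f : ι → A) :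
    star (∑ i ∈ s, f i) = ∑ i ∈ s, star (f i) := by simp [S.star_def]

theorem star_star_apply (a : A) : star (star a) = a := by
  induction a using S.induction with
  | hadd a a' h h' => rw [S.star_add, S.star_add, h, h']
  | h d x hx => exact S.star_star hx

theorem star_mul (a b : A) : star (a * b) = star b * star a := by
  induction a using S.induction with
  | hadd a a' h h' => rw [S.add_mul, S.star_add, S.star_add, S.mul_add, h, h']
  | h d x hx =>
    induction b using S.induction with
    | hadd b b' h h' => rw [S.mul_add, S.star_add, S.star_add, S.add_mul, h, h']
    | h e y hy =>
      rw [S.mul_eq_sum hx hy, S.mul_eq_sum (S.star_mem hy) (S.star_mem hx), S.star_sum,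
        min_comm e d]
      refine Finset.sum_congr rfl fun j hj => S.star_op hx hy ?_ ?_ <;>
      · simp only [Finset.mem_range] at hj; omega

theorem trace_mul_of_ne {d e : ℕ} {x y : A} (hx : x ∈ S.deg d) (hy : y ∈ S.deg e) (h : d ≠ e) :
    t (x * y) = 0 := by
  rw [S.mul_eq_sum hx hy, map_sum]
  refine Finset.sum_eq_zero fun j hj => S.trace_deg (S.op_mem j hx hy) ?_
  simp only [Finset.mem_range] at hj
  omega

theorem trace_mul {d : ℕ} {x y : A} (hx : x ∈ S.deg d) (hy : y ∈ S.deg d) :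
    t (x * y) = t (S.op (2 * d) x y) := by
  rw [S.mul_eq_sum hx hy, map_sum, min_self, Finset.sum_range_succ, add_eq_right]
  refine Finset.sum_eq_zero fun j hj => S.trace_deg (S.op_mem j hx hy) ?_
  simp only [Finset.mem_range] at hj
  omega

theorem trace_mul_comm (a b : A) : t (a * b) = t (b * a) := by
  induction a using S.induction with
  | hadd a a' h h' => rw [S.add_mul, S.mul_add, map_add, map_add, h, h']
  | h d x hx =>
    induction b using S.induction with
    | hadd b b' h h' => rw [S.add_mul, S.mul_add, map_add, map_add, h, h']
    | h e y hy =>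
      by_cases hde : d = e
      · subst hde
        rw [S.trace_mul hx hy, S.trace_mul hy hx, S.trace_op_comm hx hy]
      · rw [S.trace_mul_of_ne hx hy hde, S.trace_mul_of_ne hy hx (Ne.symm hde)]

theorem trace_star_apply (a : A) : t (star a) = conj (t a) := by
  induction a using S.induction with
  | hadd a a' h h' => rw [S.star_add, map_add, map_add, map_add, h, h']
  | h d x hx =>
    by_cases hd : d = 0
    · subst hd; exact S.trace_star hx
    · rw [S.trace_deg (S.star_mem hx) hd, S.trace_deg hx hd, map_zero]

theorem inner_conj (a b : A) : t (star b * a) = conj (t (star a * b)) := by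
  rw [← S.trace_star_apply, S.star_mul, S.star_star_apply]

theorem inner_pos (a : A) (ha : a ≠ 0) : 0 < (t (star a * a)).re := by
  have ha' : a ∈ ⨆ d, S.deg d := by rw [S.iSup_deg]; trivial
  obtain ⟨f, hf, rfl⟩ := (Submodule.mem_iSup_iff_exists_finsupp S.deg a).1 ha'
  have h1 : t (star (f.sum fun _ x => x) * f.sum fun _ x => x) =
      ∑ d ∈ f.support, t (star (f d) * f d) := by
    simp only [Finsupp.sum]
    rw [S.star_sum, S.sum_mul, map_sum]
    refine Finset.sum_congr rfl fun d hd => ?_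
    rw [S.mul_sum, map_sum, Finset.sum_eq_single d]
    · exact fun e _ hed => S.trace_mul_of_ne (S.star_mem (hf d)) (hf e) (Ne.symm hed)
    · exact fun h => absurd hd h
  rw [h1, Complex.re_sum]
  refine Finset.sum_pos (fun d hd => ?_) ?_
  · rw [S.trace_mul (S.star_mem (hf d)) (hf d)]
    exact S.trace_op_pos (hf d) (Finsupp.mem_support_iff.1 hd)
  · rw [Finset.nonempty_iff_ne_empty]
    exact fun h => ha (by simp [Finsupp.sum, h])

theorem smul_mul (z : ℂ) (a b : A) : (z • a) * b = z • (a * b) := by simp [S.mul_def]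

theorem mul_smul (z : ℂ) (a b : A) : a * (z • b) = z • (a * b) := by simp [S.mul_def]

/-- The inner product `⟨a, b⟩ = t (a^* b)`. -/
abbrev innerCore : InnerProductSpace.Core ℂ A where
  inner a b := t (star a * b)
  conj_inner_symm a b := (S.inner_conj b a).symm
  re_inner_nonneg a := by
    by_cases ha : a = 0
    · subst ha
      have : (0 : A) = (0 : ℂ) • (0 : A) := by simp
      rw [this, S.mul_smul]; simp
    · exact (S.inner_pos a ha).le
  add_left a b c := by rw [S.star_add, S.add_mul, map_add]
  smul_left a b z := by rw [S.star_smul, S.smul_mul, map_smul, smul_eq_mul]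
  definite a h := by
    by_contra ha
    have := S.inner_pos a ha
    rw [h] at this
    simp at this

/-- The adjoint of `op j a` composed with `op j a` is `op j c`, where `c = a^* ∘ a` is obtained by
joining all strings that do not take part in `op j`. -/
theorem trace_star_op_mul_op {d j : ℕ} {a : A} (ha : a ∈ S.deg d) (hj : j ≤ 2 * d) (b b' : A) :
    t (star (S.op j a b) * S.op j a b') =
      t (star b * S.op j (S.op (2 * d - j) (star a) a) b') := by
  induction b using S.induction with
  | hadd b c h h' => simp only [map_add, S.star_add, S.add_mul, h, h']
  | h e b hb =>
    induction b' using S.induction with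
    | hadd b c h h' => simp only [map_add, S.mul_add, h, h']
    | h e' b' hb' =>
      have hc := S.op_mem (2 * d - j) (S.star_mem ha) ha
      rw [show d + d - (2 * d - j) = j by omega] at hc
      by_cases hje : j ≤ 2 * e ∧ j ≤ 2 * e'
      · by_cases hee : e = e'
        · subst hee
          have hcb := S.op_mem j hc hb'
          rw [show j + e - j = e by omega] at hcb
          rw [S.trace_mul (S.star_mem (S.op_mem j ha hb)) (S.op_mem j ha hb'),
            S.star_op ha hb hj hje.1, S.trace_mul (S.star_mem hb) hcb]
          have h1 := S.op_op_of_eq (i := j) (j := 2 * d - j) (g := 2 * e - j)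
            (S.star_mem hb) (S.star_mem ha) (S.op_mem j ha hb') (by omega)
          rw [show 2 * d - j + (2 * e - j) = 2 * (d + e - j) by omega,
            show j + (2 * e - j) = 2 * e by omega] at h1
          rw [h1, S.op_op_of_le (S.star_mem ha) ha hb' (by omega)]
        · have hcb := S.op_mem j hc hb'
          rw [show j + e' - j = e' by omega] at hcb
          rw [S.trace_mul_of_ne (S.star_mem hb) hcb hee,
            S.trace_mul_of_ne (S.star_mem (S.op_mem j ha hb)) (S.op_mem j ha hb') (by omega)]
      · have h0 : ∀ x : A, star (0 : A) * x = 0 := fun x => by simp [S.star_def, S.mul_def]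
        have h0' : ∀ x : A, x * (0 : A) = 0 := fun x => by simp [S.mul_def]
        by_cases h1 : j ≤ 2 * e'
        · rw [S.op_eq_zero ha hb (by omega), h0]
          have hcb := S.op_mem j hc hb'
          rw [show j + e' - j = e' by omega] at hcb
          rw [S.trace_mul_of_ne (S.star_mem hb) hcb (by omega), map_zero]
        · rw [S.op_eq_zero ha hb' (by omega), S.op_eq_zero hc hb' (by omega), h0', h0']

/-- For `c` of degree `j` the operator `op j c` is annihilated by a monic polynomial, since `op j`
is an associative product on the finite-dimensional space `deg j`, acting on all of `A`. -/
theorem exists_monic_aeval_op_eq_zero {j : ℕ} {c : A} (hc : c ∈ S.deg j) :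
    ∃ p : Polynomial ℂ, p.Monic ∧ Polynomial.aeval (S.op j c) p = 0 := by
  have := S.finite j
  let L : S.deg j →ₗ[ℂ] S.deg j := (S.op j c).restrict fun x hx => by
    have := S.op_mem j hc hx
    rwa [show j + j - j = j by omega] at this
  have hL : ∀ (q : Polynomial ℂ) (x : S.deg j) (b : A),
      Polynomial.aeval (S.op j c) q (S.op j x b) = S.op j (Polynomial.aeval L q x : S.deg j) b := by
    intro q x b
    induction q using Polynomial.induction_on generalizing x with
    | C z => simp
    | add p q hp hq => simp [hp, hq]
    | monomial n z h =>
      rw [pow_succ, ← _root_.mul_assoc, map_mul _ _ Polynomial.X, map_mul _ _ Polynomial.X,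
        Polynomial.aeval_X, Polynomial.aeval_X, Module.End.mul_apply, Module.End.mul_apply, ← h]
      congr 1
      clear h
      induction b using S.induction with
      | hadd b b' h h' => simp only [map_add, h, h']
      | h e b hb => exact (S.op_op_of_le hc x.2 hb (by omega)).symm
  -- the factor `X` is needed because the characteristic polynomial annihilates `op j c` only on
  -- elements of the form `op j x b`
  refine ⟨L.charpoly * Polynomial.X, L.charpoly_monic.mul Polynomial.monic_X, ?_⟩
  ext b
  rw [map_mul, Polynomial.aeval_X, Module.End.mul_apply]
  have := hL L.charpoly ⟨c, hc⟩ b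
  rwa [LinearMap.aeval_self_charpoly, LinearMap.zero_apply, Submodule.coe_zero, map_zero] at this

/-- The maps `b ↦ op j a b` are bounded, since `op j c` is, with `c` as in `trace_star_op_mul_op`. -/
theorem op_bounded {d j : ℕ} {a : A} (ha : a ∈ S.deg d) (hj : j ≤ 2 * d) :
    ∃ C : ℝ, 0 ≤ C ∧ ∀ b : A,
      (t (star (S.op j a b) * S.op j a b)).re ≤ C * (t (star b * b)).re := by
  let _ : NormedAddCommGroup A := @InnerProductSpace.Core.toNormedAddCommGroup ℂ A _ _ _ S.innerCore
  let _ : InnerProductSpace ℂ A := InnerProductSpace.ofCore S.innerCore.toCore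
  have hc := S.op_mem (2 * d - j) (S.star_mem ha) ha
  rw [show d + d - (2 * d - j) = j by omega] at hc
  have hinner : ∀ x y : A, inner ℂ x y = t (star x * y) := fun x y => rfl
  have hsymm : (S.op j (S.op (2 * d - j) (star a) a)).IsSymmetric := fun x y => by
    rw [hinner, hinner, S.inner_conj y, ← S.trace_star_op_mul_op ha hj, ← S.inner_conj,
      ← S.trace_star_op_mul_op ha hj]
  obtain ⟨p, hp, hp0⟩ := S.exists_monic_aeval_op_eq_zero hc
  obtain ⟨C, hC0, hC⟩ := hsymm.exists_bound_of_aeval_eq_zero _ p hp hp0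
  refine ⟨C, hC0, fun b => ?_⟩
  rw [S.trace_star_op_mul_op ha hj]
  have h1 : (t (star b * S.op j (S.op (2 * d - j) (star a) a) b)).re ≤ ‖b‖ * (C * ‖b‖) := by
    rw [← hinner]
    exact (Complex.re_le_norm _).trans ((norm_inner_le_norm _ _).trans
      (mul_le_mul_of_nonneg_left (hC b) (norm_nonneg _)))
  have h2 : (t (star b * b)).re = ‖b‖ * ‖b‖ := by
    rw [← hinner, ← sq]; exact inner_self_eq_norm_sq (𝕜 := ℂ) b
  rw [h2]; linarith

theorem re_trace_add_le (x y : A) : (t (star (x + y) * (x + y))).re ≤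
    2 * (t (star x * x)).re + 2 * (t (star y * y)).re := by
  let _ : NormedAddCommGroup A := @InnerProductSpace.Core.toNormedAddCommGroup ℂ A _ _ _ S.innerCore
  let _ : InnerProductSpace ℂ A := InnerProductSpace.ofCore S.innerCore.toCore
  have hN : ∀ x : A, (t (star x * x)).re = ‖x‖ ^ 2 := fun x => inner_self_eq_norm_sq (𝕜 := ℂ) x
  rw [hN, hN, hN]
  nlinarith [norm_add_le x y, norm_nonneg (x + y), sq_nonneg (‖x‖ - ‖y‖)]

theorem bounded (a : A) : ∃ C : ℝ, 0 ≤ C ∧ ∀ b : A,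
    (t (star (a * b) * (a * b))).re ≤ C * (t (star b * b)).re := by
  have hadd : ∀ (f g : A → A), (∃ C : ℝ, 0 ≤ C ∧ ∀ b : A,
      (t (star (f b) * f b)).re ≤ C * (t (star b * b)).re) → (∃ C : ℝ, 0 ≤ C ∧ ∀ b : A,
      (t (star (g b) * g b)).re ≤ C * (t (star b * b)).re) → ∃ C : ℝ, 0 ≤ C ∧ ∀ b : A,
      (t (star (f b + g b) * (f b + g b))).re ≤ C * (t (star b * b)).re := by
    rintro f g ⟨C, hC0, hC⟩ ⟨C', hC0', hC'⟩
    refine ⟨2 * C + 2 * C', by positivity, fun b => (S.re_trace_add_le _ _).trans ?_⟩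
    linarith [hC b, hC' b]
  induction a using S.induction with
  | hadd a a' h h' => simpa only [S.add_mul] using hadd (a * ·) (a' * ·) h h'
  | h d a ha =>
    have h1 : ∀ b, a * b = ∑ j ∈ Finset.range (2 * d + 1), S.op j a b := fun b => by
      induction b using S.induction with
      | hadd b b' h h' => simp only [S.mul_add, map_add, Finset.sum_add_distrib, h, h']
      | h e b hb => exact S.mul_eq_sum_range ha hb (by omega)
    have h2 : ∀ N ≤ 2 * d + 1, ∃ C : ℝ, 0 ≤ C ∧ ∀ b : A,
        (t (star (∑ j ∈ Finset.range N, S.op j a b) *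
          ∑ j ∈ Finset.range N, S.op j a b)).re ≤ C * (t (star b * b)).re := by
      intro N
      induction N with
      | zero => exact fun _ => ⟨0, le_rfl, fun b => by simp [S.mul_def]⟩
      | succ N ih =>
        intro hN
        simp only [Finset.sum_range_succ]
        exact hadd _ _ (ih (by omega)) (S.op_bounded ha (by omega))
    simp only [h1]
    exact h2 _ le_rfl

theorem isFinitePreVN : IsFinitePreVN A t where
  mul_assoc := S.mul_assoc
  one_mul := S.one_mul
  mul_one := S.mul_one
  mul_add := S.mul_add
  add_mul := S.add_mul
  smul_mul := S.smul_mul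
  mul_smul := S.mul_smul
  star_star := S.star_star_apply
  star_add := S.star_add
  star_smul := S.star_smul
  star_mul := S.star_mul
  trace_one := S.trace_one
  trace_mul_comm := S.trace_mul_comm
  inner_conj := S.inner_conj
  inner_pos := S.inner_pos
  bounded a := (S.bounded a).imp fun _ h => h.2

end ContractionSystem

/-! ### Slices of tangle diagrams up to planar equivalence -/

section Words
variable {V : Col → Type v}

theorem admissible_append_iff (s : Bool) (l₁ l₂ : List (Step V)) {w w₂ : ℕ} :
    Admissible s w (l₁ ++ l₂) w₂ ↔ ∃ w₁, Admissible s w l₁ w₁ ∧ Admissible s w₁ l₂ w₂ := by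
  refine ⟨fun h => ?_, fun ⟨w₁, h₁, h₂⟩ => admissible_append s l₁ l₂ h₁ h₂⟩
  induction l₁ generalizing w with
  | nil => exact ⟨w, rfl, h⟩
  | cons a l ih =>
    cases a with
    | ins p g =>
      obtain ⟨w₁, h₁, h₂⟩ := ih h.2.2
      exact ⟨w₁, ⟨h.1, h.2.1, h₁⟩, h₂⟩
    | cap p =>
      obtain ⟨w₁, h₁, h₂⟩ := ih h.2
      exact ⟨w₁, ⟨h.1, h₁⟩, h₂⟩

theorem Admissible.bodd_eq {s : Bool} {l : List (Step V)} {w w' : ℕ} (h : Admissible s w l w') :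
    w'.bodd = w.bodd := by
  induction l generalizing w with
  | nil => rw [show w = w' from h]
  | cons a l ih =>
    cases a with
    | ins p g => rw [ih h.2.2, Nat.bodd_add, Piece.legs_even, Bool.xor_false]
    | cap p =>
      obtain ⟨u, rfl⟩ : ∃ u, w = u + 2 := ⟨w - 2, by have := h.1; omega⟩
      rw [ih h.2]; simp

/-- Slices stay admissible between `r` further strings on the left and `u` on the right. -/
theorem Admissible.shift {s₀ s : Bool} {l : List (Step V)} {w w' : ℕ} (h : Admissible s w l w')
    (r u : ℕ) (hs : Bool.xor s₀ r.bodd = s) :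
    Admissible s₀ (r + w + u) (l.map (Step.shift r)) (r + w' + u) := by
  induction l generalizing w with
  | nil => rw [show w = w' from h]; rfl
  | cons a l ih =>
    cases a with
    | ins p g =>
      refine ⟨by have := h.1; omega, ?_, ?_⟩
      · rw [Nat.bodd_add, Bool.xor_comm p.bodd, ← Bool.xor_assoc, hs]; exact h.2.1
      · have := ih h.2.2
        rwa [show r + w + u + g.legs = r + (w + g.legs) + u by omega]
    | cap p =>
      refine ⟨by have := h.1; omega, ?_⟩
      have := ih h.2
      rwa [show r + w + u - 2 = r + (w - 2) + u by have := h.1; omega]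

@[simp] theorem map_shift_zero (l : List (Step V)) : l.map (Step.shift 0) = l := by
  refine (List.map_congr_left fun a _ => ?_).trans l.map_id
  cases a <;> rfl

@[simp] theorem map_shift_shift (p q : ℕ) (l : List (Step V)) :
    (l.map (Step.shift p)).map (Step.shift q) = l.map (Step.shift (p + q)) := by
  rw [List.map_map]
  refine List.map_congr_left fun a _ => ?_
  cases a <;> simp [Step.shift, Nat.add_assoc]

theorem Admissible.add {s : Bool} {l : List (Step V)} {w w' : ℕ} (h : Admissible s w l w')
    (u : ℕ) : Admissible s (w + u) l (w' + u) := by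
  simpa using h.shift 0 u (s₀ := s) (by simp)

theorem shift_nestCups (p N r : ℕ) :
    (nestCups V p N).map (Step.shift r) = nestCups V (p + r) N := by
  simp only [nestCups, List.map_map]
  refine List.map_congr_left fun i _ => ?_
  simp only [Function.comp, Step.shift]
  congr 1; omega

theorem shift_nestCaps (q N r : ℕ) (h : N ≤ q) :
    (nestCaps V q N).map (Step.shift r) = nestCaps V (q + r) N := by
  simp only [nestCaps, List.map_map]
  refine List.map_congr_left fun i hi => ?_
  simp only [List.mem_range] at hi
  simp only [Function.comp, Step.shift]
  congr 1; omega

theorem nestCaps_add (q M N : ℕ) :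
    nestCaps V q (M + N) = nestCaps V q M ++ nestCaps V (q - M) N := by
  simp only [nestCaps, List.range_add, List.map_append, List.map_map]
  congr 1
  refine List.map_congr_left fun i _ => ?_
  simp only [Function.comp]
  congr 1; omega

theorem nestCups_add (p M N : ℕ) :
    nestCups V p (M + N) = nestCups V p M ++ nestCups V (p + M) N := by
  simp only [nestCups, List.range_add, List.map_append, List.map_map]
  congr 1
  refine List.map_congr_left fun i _ => ?_
  simp only [Function.comp]
  congr 1; omega

@[simp] theorem nestCups_zero (p : ℕ) : nestCups V p 0 = [] := rfl
@[simp] theorem nestCaps_zero (p : ℕ) : nestCaps V p 0 = [] := rfl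
@[simp] theorem nestCups_one (p : ℕ) : nestCups V p 1 = [ins p arc] := rfl
@[simp] theorem nestCaps_one (p : ℕ) : nestCaps V p 1 = [cap (p - 1)] := rfl

theorem mirror_append (st : ∀ c, V c → V c) (s : Bool) {l₁ l₂ : List (Step V)} {w w' : ℕ}
    (h : Admissible s w l₁ w') :
    mirror st w (l₁ ++ l₂) = mirror st w l₁ ++ mirror st w' l₂ := by
  induction l₁ generalizing w with
  | nil => rw [show w = w' from h]; rfl
  | cons a l ih =>
    cases a with
    | ins p g => simp only [List.cons_append, mirror, ih h.2.2]
    | cap p => simp only [List.cons_append, mirror, ih h.2]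

theorem mirror_shift (st : ∀ c, V c → V c) (s : Bool) {l : List (Step V)} {w w' r : ℕ}
    (h : Admissible s w l w') : mirror st (w + r) (l.map (Step.shift r)) = mirror st w l := by
  induction l generalizing w with
  | nil => rfl
  | cons a l ih =>
    cases a with
    | ins p g =>
      have := h.1
      simp only [List.map_cons, Step.shift, mirror]
      rw [show w + r + g.legs = w + g.legs + r by omega, ih h.2.2]
      congr 2; omega
    | cap p =>
      have := h.1
      simp only [List.map_cons, Step.shift, mirror]
      rw [show w + r - 2 = w - 2 + r by omega, ih h.2]
      congr 2; omega

theorem mirror_nestCups (st : ∀ c, V c → V c) (w N : ℕ) :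
    mirror st w (nestCups V 0 N) = nestCups V w N := by
  induction N with
  | zero => rfl
  | succ N ih =>
    rw [nestCups_add, nestCups_add, mirror_append st false
      (admissible_nestCups false w 0 N (Nat.zero_le _)), ih]
    simp only [nestCups_one, mirror, Piece.map]
    congr 2; congr 1; omega

theorem mirror_nestCaps (st : ∀ c, V c → V c) {w q N : ℕ} (h : N ≤ q) (h' : q + N ≤ w) :
    mirror st w (nestCaps V q N) = nestCaps V (w - q) N := by
  induction N with
  | zero => rfl
  | succ N ih =>
    rw [nestCaps_add, nestCaps_add, mirror_append st false
      (admissible_nestCaps false w q N (by omega) (by omega)), ih (by omega) (by omega)]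
    simp only [nestCaps_one, mirror]
    congr 2; congr 1; omega

theorem Move.shift {m m' : List (Step V)} (h : Move m m') (r : ℕ) :
    Move (m.map (Step.shift r)) (m'.map (Step.shift r)) := by
  cases h with
  | zigzag_left p =>
    have := Move.zigzag_left (V := V) (p + r)
    simpa [Step.shift, show p + r + 1 = p + 1 + r by omega] using this
  | zigzag_right p =>
    have := Move.zigzag_right (V := V) (p + r)
    simpa [Step.shift, show p + r + 1 = p + 1 + r by omega] using this
  | ins_ins p q g h hq =>
    have := Move.ins_ins (p + r) (q + r) g h (by omega)
    simpa [Step.shift, show p + r + h.legs = p + h.legs + r by omega] using this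
  | ins_cap_left p q g hq =>
    have := Move.ins_cap_left (p + r) (q + r) g (by omega)
    simpa [Step.shift, show p + r + 2 = p + 2 + r by omega] using this
  | ins_cap_right p q g hq =>
    have := Move.ins_cap_right (p + r) (q + r) g (by omega)
    simpa [Step.shift, show q + r + g.legs = q + g.legs + r by omega] using this
  | cap_cap p q hq =>
    have := Move.cap_cap (V := V) (p + r) (q + r) (by omega)
    simpa [Step.shift, show p + r + 2 = p + 2 + r by omega] using this
  | rotate p c x =>
    have := Move.rotate (p + r) c x
    simpa [Step.shift, shift_nestCups, shift_nestCaps, show p + r + 2 * c.size =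
      p + 2 * c.size + r by omega] using this

end Words

namespace StarPlanarAlgebra
variable (P : StarPlanarAlgebra.{u})

/-- The value of the diagram with slices `l`, and `0` if `l` is not a diagram of colour `c`. -/
def val (c : Col) (l : List (Step P.V)) : P.V c := by
  classical exact if h : Admissible c.shaded 0 l (2 * c.size) then P.Z ⟨l, h⟩ else 0

theorem val_eq {c : Col} (T : Tangle P.V c) : P.val c T.word = P.Z T := by
  rw [val, dif_pos T.admissible]

theorem val_of_admissible {c : Col} {l : List (Step P.V)}
    (h : Admissible c.shaded 0 l (2 * c.size)) : P.val c l = P.Z ⟨l, h⟩ := dif_pos h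

/-- Slices `l` and `l'` on `w` strings, with `w'` strings leaving at the top and a region of shading
`s` on the left, are equivalent if every diagram containing `l`, possibly between further strings,
keeps its value if `l` is replaced by `l'`. -/
structure Eqv (s : Bool) (w w' : ℕ) (l l' : List (Step P.V)) : Prop where
  left : Admissible s w l w'
  right : Admissible s w l' w'
  val_eq : ∀ (c : Col) (l₁ l₂ : List (Step P.V)) (r u : ℕ), Bool.xor c.shaded r.bodd = s →
    Admissible c.shaded 0 l₁ (r + w + u) → Admissible c.shaded (r + w' + u) l₂ (2 * c.size) →
    P.val c (l₁ ++ l.map (Step.shift r) ++ l₂) = P.val c (l₁ ++ l'.map (Step.shift r) ++ l₂)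

namespace Eqv
variable {P} {s s₀ : Bool} {w w' w₀ w₀' : ℕ} {l l' l'' m m' l₁ l₂ : List (Step P.V)}

theorem refl (h : Admissible s w l w') : P.Eqv s w w' l l := ⟨h, h, fun _ _ _ _ _ _ _ _ => rfl⟩

theorem symm (h : P.Eqv s w w' l l') : P.Eqv s w w' l' l :=
  ⟨h.right, h.left, fun c l₁ l₂ r u hs h₁ h₂ => (h.val_eq c l₁ l₂ r u hs h₁ h₂).symm⟩

theorem trans (h : P.Eqv s w w' l l') (h' : P.Eqv s w w' l' l'') : P.Eqv s w w' l l'' :=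
  ⟨h.left, h'.right, fun c l₁ l₂ r u hs h₁ h₂ =>
    (h.val_eq c l₁ l₂ r u hs h₁ h₂).trans (h'.val_eq c l₁ l₂ r u hs h₁ h₂)⟩

theorem cast (h : P.Eqv s w w' l l') (e : w' = w₀) : P.Eqv s w w₀ l l' := e ▸ h

/-- Replacement of equivalent slices inside a diagram. -/
theorem ctx (h : P.Eqv s w w' m m') (r u : ℕ) (hs : Bool.xor s₀ r.bodd = s)
    (h₁ : Admissible s₀ w₀ l₁ (r + w + u)) (h₂ : Admissible s₀ (r + w' + u) l₂ w₀') :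
    P.Eqv s₀ w₀ w₀' (l₁ ++ m.map (Step.shift r) ++ l₂) (l₁ ++ m'.map (Step.shift r) ++ l₂) where
  left := admissible_append _ _ _ (admissible_append _ _ _ h₁ (h.left.shift r u hs)) h₂
  right := admissible_append _ _ _ (admissible_append _ _ _ h₁ (h.right.shift r u hs)) h₂
  val_eq c k₁ k₂ r' u' hs' hk₁ hk₂ := by
    have h3 := h.val_eq c (k₁ ++ l₁.map (Step.shift r')) (l₂.map (Step.shift r') ++ k₂) (r + r')
      (u + u') (by rw [Nat.bodd_add, Bool.xor_comm r.bodd, ← Bool.xor_assoc, hs', hs])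
      (by
        refine admissible_append _ _ _ hk₁ ?_
        have := h₁.shift r' u' hs'
        rwa [show r + r' + w + (u + u') = r' + (r + w + u) + u' by omega])
      (by
        refine admissible_append _ _ _ ?_ hk₂
        have := h₂.shift r' u' hs'
        rwa [show r + r' + w' + (u + u') = r' + (r + w' + u) + u' by omega])
    simpa [-List.map_map] using h3

/-- A version of `ctx` in which the diagrams are recognised afterwards. -/
theorem step (h : P.Eqv s w w' m m') (r u : ℕ) (l₁ l₂ : List (Step P.V))
    (e : l = l₁ ++ m.map (Step.shift r) ++ l₂) (e' : l' = l₁ ++ m'.map (Step.shift r) ++ l₂)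
    (hs : Bool.xor s₀ r.bodd = s) (h₁ : Admissible s₀ w₀ l₁ (r + w + u))
    (h₂ : Admissible s₀ (r + w' + u) l₂ w₀') : P.Eqv s₀ w₀ w₀' l l' := by
  rw [e, e']; exact h.ctx r u hs h₁ h₂

theorem append (h : P.Eqv s w w' l l') (h' : P.Eqv s w' w₀ m m') :
    P.Eqv s w w₀ (l ++ m) (l' ++ m') := by
  refine (h.step 0 0 [] m (by simp) (l' := l' ++ m) (by simp) (by simp) (by simp [Admissible])
    (by simpa using h'.left)).trans ?_
  exact h'.step 0 0 l' [] (by simp) (by simp) (by simp) (by simpa using h.right)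
    (by simp [Admissible])

theorem append_right (h : P.Eqv s w w' l l') (hm : Admissible s w' m w₀) :
    P.Eqv s w w₀ (l ++ m) (l' ++ m) := h.append (refl hm)

theorem append_left (hl : Admissible s w l w') (h : P.Eqv s w' w₀ m m') :
    P.Eqv s w w₀ (l ++ m) (l ++ m') := (refl hl).append h

theorem shift (h : P.Eqv s w w' l l') (r u : ℕ) (hs : Bool.xor s₀ r.bodd = s) :
    P.Eqv s₀ (r + w + u) (r + w' + u) (l.map (Step.shift r)) (l'.map (Step.shift r)) :=
  h.step r u [] [] (by simp) (by simp) hs rfl rfl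

theorem add (h : P.Eqv s w w' l l') (u : ℕ) : P.Eqv s (w + u) (w' + u) l l' := by
  simpa using h.shift 0 u (s₀ := s) (by simp)

theorem of_move (h : Move m m') (hm : Admissible s w m w') (hm' : Admissible s w m' w') :
    P.Eqv s w w' m m' where
  left := hm
  right := hm'
  val_eq c l₁ l₂ r u hs h₁ h₂ := by
    have a := admissible_append _ _ _ (admissible_append _ _ _ h₁ (hm.shift r u hs)) h₂
    have a' := admissible_append _ _ _ (admissible_append _ _ _ h₁ (hm'.shift r u hs)) h₂
    rw [P.val_of_admissible a, P.val_of_admissible a']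
    exact P.Z_isotopic _ _ (Relation.EqvGen.rel _ _ ⟨l₁, l₂, _, _, h.shift r, rfl, rfl⟩)

/-- A diagram may be put into a single box. -/
theorem box_Z {d : Col} (T : Tangle P.V d) :
    P.Eqv d.shaded 0 (2 * d.size) [ins 0 (box d (P.Z T))] T.word where
  left := by simp [Admissible, Fits, legs]
  right := T.admissible
  val_eq c l₁ l₂ r u hs h₁ h₂ := by
    have hb : Admissible d.shaded 0 [ins 0 (box d (P.Z T))] (2 * d.size) := by
      simp [Admissible, Fits, legs]
    have a := admissible_append _ _ _ (admissible_append _ _ _ h₁ (hb.shift r u hs)) h₂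
    have a' := admissible_append _ _ _ (admissible_append _ _ _ h₁ (T.admissible.shift r u hs)) h₂
    rw [P.val_of_admissible a, P.val_of_admissible a']
    exact P.Z_subst l₁ l₂ r T _ _ (by simp [Step.shift]) rfl

theorem val_eq_val {c : Col} (h : P.Eqv c.shaded 0 (2 * c.size) l l') : P.val c l = P.val c l' := by
  simpa using h.val_eq c [] [] 0 0 (by simp) rfl (by simp [Admissible])

/-- Two single slices that stand beside each other may be interchanged in height. -/
theorem interchange_step_step (a b : Step P.V) {u u' : ℕ} (ha : Admissible s w [a] w')
    (hb : Admissible (Bool.xor s w.bodd) u [b] u') :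
    P.Eqv s (w + u) (w' + u') [a, b.shift w'] [b.shift w, a] := by
  have hodd := ha.bodd_eq
  have hl : Admissible s (w + u) ([a] ++ [b].map (Step.shift w')) (w' + u') := by
    refine admissible_append _ _ _ (ha.add u) ?_
    have := hb.shift w' 0 (s₀ := s) (by rw [hodd])
    simpa using this
  have hr : Admissible s (w + u) ([b].map (Step.shift w) ++ [a]) (w' + u') := by
    have := hb.shift w 0 (s₀ := s) rfl
    exact admissible_append _ _ _ (by simpa using this) (ha.add u')
  cases a with
  | ins p g =>
    obtain rfl : w + g.legs = w' := ha.2.2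
    cases b with
    | ins q h =>
      refine (of_move ?_ hr hl).symm
      have := Move.ins_ins (q + w) p h g (by have := ha.1; omega)
      simpa [Step.shift, Nat.add_assoc] using this
    | cap q =>
      refine of_move ?_ hl hr
      have := Move.ins_cap_right p (q + w) g (by have := ha.1; omega)
      simpa [Step.shift, Nat.add_assoc] using this
  | cap p =>
    obtain ⟨hp, h⟩ := ha
    obtain rfl : w - 2 = w' := h
    obtain ⟨v, rfl⟩ : ∃ v, w = v + 2 := ⟨w - 2, by omega⟩
    cases b with
    | ins q h =>
      refine (of_move ?_ hr hl).symm
      have := Move.ins_cap_left (q + v) p h (by omega)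
      simpa [Step.shift, Nat.add_assoc] using this
    | cap q =>
      refine (of_move ?_ hr hl).symm
      have := Move.cap_cap (V := P.V) (q + v) p (by omega)
      simpa [Step.shift, Nat.add_assoc] using this

/-- Slices that stand beside each other may be interchanged in height. -/
theorem interchange {u u' : ℕ} (hl : Admissible s w l w')
    (hm : Admissible (Bool.xor s w.bodd) u m u') :
    P.Eqv s (w + u) (w' + u') (l ++ m.map (Step.shift w')) (m.map (Step.shift w) ++ l) := by
  have hstep : ∀ (a : Step P.V) {w w' u : ℕ} {m : List (Step P.V)}, Admissible s w [a] w' →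
      Admissible (Bool.xor s w.bodd) u m u' →
      P.Eqv s (w + u) (w' + u') ([a] ++ m.map (Step.shift w')) (m.map (Step.shift w) ++ [a]) := by
    intro a w w' u m ha hm
    induction m generalizing u with
    | nil => obtain rfl : u = u' := hm; simpa using refl (ha.add u)
    | cons b m ih =>
      obtain ⟨u₁, hb, hm'⟩ := (admissible_append_iff _ [b] m).1 hm
      have h1 := (interchange_step_step a b ha hb).append_right (by
        have := hm'.shift w' 0 (s₀ := s) (by rw [ha.bodd_eq])
        simpa using this)
      have h2 := append_left (l := [b.shift w]) (w := w + u) (s := s) (by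
        have := hb.shift w 0 (s₀ := s) rfl
        simpa using this) (ih hm')
      simpa using h1.trans (by simpa using h2)
  induction l generalizing w with
  | nil =>
    obtain rfl : w = w' := hl
    have := hm.shift w 0 (s₀ := s) rfl
    simpa using refl (P := P) (by simpa using this)
  | cons a l ih =>
    obtain ⟨w₁, ha, hl'⟩ := (admissible_append_iff _ [a] l).1 hl
    have h1 := append_left (l := [a]) (ha.add u) (ih hl' (by rwa [ha.bodd_eq]))
    have h2 := (hstep a ha hm).append_right (hl'.add u')
    simpa using h1.trans (by simpa using h2)

/-- Slices `l` at position `p` and slices `m` to the right of them may be interchanged. -/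
theorem disjoint {p q q' a a' b b' : ℕ} (hl : Admissible (Bool.xor s p.bodd) a l a')
    (hm : Admissible (Bool.xor s q.bodd) b m b') (h : p + a ≤ q) (hq : q' + a = q + a')
    (hw : q + b ≤ w) (hw' : w' + a + b = w + a' + b') :
    P.Eqv s w w' (l.map (Step.shift p) ++ m.map (Step.shift q'))
      (m.map (Step.shift q) ++ l.map (Step.shift p)) := by
  obtain ⟨v, rfl⟩ := Nat.exists_eq_add_of_le h
  obtain ⟨z, rfl⟩ := Nat.exists_eq_add_of_le hw
  obtain rfl : q' = p + a' + v := by omega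
  obtain rfl : w' = p + a' + (v + b' + z) := by omega
  have hl' : Admissible s (p + a) (l.map (Step.shift p)) (p + a') := by
    simpa using hl.shift p 0 (s₀ := s) rfl
  have hm' : Admissible (Bool.xor s (p + a).bodd) (v + b + z) (m.map (Step.shift v))
      (v + b' + z) := hm.shift v z (by rw [Bool.xor_assoc, ← Nat.bodd_add])
  have := interchange (P := P) hl' hm'
  rw [map_shift_shift, map_shift_shift, Nat.add_comm v (p + a'), Nat.add_comm v (p + a),
    show p + a + (v + b + z) = p + a + v + b + z by omega] at this
  exact this

/-- Replacement of equivalent slices inside a diagram, without a change of position. -/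
theorem inside (h : P.Eqv s w w' m m') (l₁ l₂ : List (Step P.V)) (h₁ : Admissible s w₀ l₁ w)
    (h₂ : Admissible s w' l₂ w₀') (e : l = l₁ ++ (m ++ l₂)) (e' : l' = l₁ ++ (m' ++ l₂)) :
    P.Eqv s w₀ w₀' l l' := by
  rw [e, e']; exact append_left h₁ (h.append_right h₂)

end Eqv
end StarPlanarAlgebra

section Words
variable {V : Col → Type v} {s : Bool} {w w' w₁ : ℕ} {l m : List (Step V)}

theorem Admissible.cast (h : Admissible s w l w₁) (e : w₁ = w') : Admissible s w l w' := e ▸ h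

theorem Admissible.cups (h : Admissible s w l w₁) (p N : ℕ) (hp : p ≤ w₁) :
    Admissible s w (l ++ nestCups V p N) (w₁ + 2 * N) :=
  admissible_append _ _ _ h (admissible_nestCups _ _ _ _ hp)

theorem Admissible.caps (h : Admissible s w l w₁) (q N : ℕ) (hq : N ≤ q) (hq' : q + N ≤ w₁) :
    Admissible s w (l ++ nestCaps V q N) (w₁ - 2 * N) :=
  admissible_append _ _ _ h (admissible_nestCaps _ _ _ _ hq hq')

/-- The slices `m`, starting without strings, may be put at any position of the right shading. -/
theorem Admissible.at {n : ℕ} (h : Admissible (Bool.xor s w'.bodd) 0 m n) (hr : w' ≤ w) :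
    Admissible s w (m.map (Step.shift w')) (w + n) := by
  obtain ⟨v, rfl⟩ := Nat.exists_eq_add_of_le hr
  exact (h.shift w' v rfl).cast (by omega)

theorem Admissible.word (h : Admissible s w l w₁) {n : ℕ} (r : ℕ)
    (hm : Admissible (Bool.xor s r.bodd) 0 m n) (hr : r ≤ w₁) :
    Admissible s w (l ++ m.map (Step.shift r)) (w₁ + n) :=
  admissible_append _ _ _ h (hm.at hr)

theorem admissible_nestCaps_self (s : Bool) (N : ℕ) :
    Admissible s (2 * N) (nestCaps V N N) 0 :=
  (admissible_nestCaps s (2 * N) N N le_rfl (by omega)).cast (by omega)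

theorem admissible_nestCups_self (s : Bool) (N : ℕ) :
    Admissible s 0 (nestCups V 0 N) (2 * N) :=
  (admissible_nestCups s 0 0 N le_rfl).cast (by omega)

theorem nestCaps_eq_shift {q N : ℕ} (h : N ≤ q) :
    nestCaps V q N = (nestCaps V N N).map (Step.shift (q - N)) := by
  rw [shift_nestCaps _ _ _ le_rfl]; congr 1; omega

theorem nestCups_eq_shift (p N : ℕ) :
    nestCups V p N = (nestCups V 0 N).map (Step.shift p) := by
  rw [shift_nestCups, Nat.zero_add]

end Words

namespace StarPlanarAlgebra.Eqv
variable {P : StarPlanarAlgebra.{u}} {s : Bool} {w w' : ℕ} {l m : List (Step P.V)}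

/-! The following lemmas interchange nested maxima, and diagrams `m` without strings at the bottom,
that stand beside each other. -/

theorem caps_caps {q q' M N : ℕ} (h : N ≤ q) (hq : q + N + M ≤ q') (hw : q' + M ≤ w)
    {q'' : ℕ} (e : q'' + 2 * N = q') (hw' : w' + 2 * M + 2 * N = w) :
    P.Eqv s w w' (nestCaps P.V q N ++ nestCaps P.V q'' M)
      (nestCaps P.V q' M ++ nestCaps P.V q N) := by
  rw [nestCaps_eq_shift h, nestCaps_eq_shift (show M ≤ q' by omega),
    nestCaps_eq_shift (show M ≤ q'' by omega)]
  exact disjoint (admissible_nestCaps_self _ N) (admissible_nestCaps_self _ M) (by omega)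
    (by omega) (by omega) (by omega)

theorem caps_word {q r r' N n : ℕ} (hm : Admissible (Bool.xor s r.bodd) 0 m n) (h : N ≤ q)
    (hr : q + N ≤ r) (hrw : r ≤ w) (e : r' + 2 * N = r) (hw' : w' + 2 * N = w + n) :
    P.Eqv s w w' (nestCaps P.V q N ++ m.map (Step.shift r'))
      (m.map (Step.shift r) ++ nestCaps P.V q N) := by
  rw [nestCaps_eq_shift h]
  exact disjoint (admissible_nestCaps_self _ N) hm (by omega) (by omega) (by omega) (by omega)

theorem word_caps {q q' r N n : ℕ} (hm : Admissible (Bool.xor s r.bodd) 0 m n)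
    (hr : r + N ≤ q) (hq : q + N ≤ w) (e : q' = q + n) (hw' : w' + 2 * N = w + n) :
    P.Eqv s w w' (m.map (Step.shift r) ++ nestCaps P.V q' N)
      (nestCaps P.V q N ++ m.map (Step.shift r)) := by
  rw [nestCaps_eq_shift (show N ≤ q by omega), nestCaps_eq_shift (show N ≤ q' by omega)]
  exact disjoint hm (admissible_nestCaps_self _ N) (by omega) (by omega) (by omega) (by omega)

theorem word_word {m' : List (Step P.V)} {r r' r'' n n' : ℕ}
    (hm : Admissible (Bool.xor s r.bodd) 0 m n) (hm' : Admissible (Bool.xor s r'.bodd) 0 m' n')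
    (hr : r ≤ r') (hrw : r' ≤ w) (e : r'' = r' + n) (hw' : w' = w + n + n') :
    P.Eqv s w w' (m.map (Step.shift r) ++ m'.map (Step.shift r''))
      (m'.map (Step.shift r') ++ m.map (Step.shift r)) :=
  disjoint hm hm' (by omega) (by omega) (by omega) (by omega)

/-! ### Straightening of nested strings and rotation of diagrams -/

/-- `N` parallel strings with a minimum on the left and a maximum on the right are straightened,
from the innermost string outwards. -/
theorem zigzag_left {p q N : ℕ} (hq : q = p + 2 * N) (hw : p + N ≤ w) :
    P.Eqv s w w (nestCups P.V p N ++ nestCaps P.V q N) [] := by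
  subst hq
  induction N with
  | zero => exact refl rfl
  | succ N ih =>
    have h1 := word_caps (P := P) (s := s) (w := w + 2 * N) (w' := w + 2) (r := p + N)
      (q := p + 2 * N) (N := N) (admissible_nestCups_self _ 1) (by omega) (by omega) rfl (by omega)
    rw [← nestCups_eq_shift, show p + 2 * N + 2 * 1 = p + 2 * (N + 1) by omega] at h1
    have h2 : P.Eqv s w w [ins (p + N) arc, cap (p + N + 1)] [] :=
      of_move (Move.zigzag_left _) ⟨by omega, trivial, by simp only [legs]; omega, by
        simp [Admissible, legs]⟩ rfl
    refine (h1.inside (nestCups P.V p N) [cap (p + N + 1)]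
      (admissible_nestCups _ _ _ _ (by omega)) ⟨by omega, by simp [Admissible]⟩ ?_ rfl).trans
      ((ih (by omega)).inside [] [ins (p + N) arc, cap (p + N + 1)] rfl h2.left
        (by simp) rfl |>.trans (by simpa using h2))
    rw [nestCups_add, nestCaps_add, nestCaps_one]
    simp only [List.append_assoc]
    congr 5; omega

theorem zigzag_right {p N : ℕ} (h : N ≤ p) (hw : p ≤ w) :
    P.Eqv s w w (nestCups P.V p N ++ nestCaps P.V p N) [] := by
  induction N with
  | zero => exact refl rfl
  | succ N ih =>
    have h1 := caps_word (P := P) (s := s) (w := w + 2 * N) (w' := w + 2) (r := p + N)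
      (r' := p - N) (q := p) (N := N) (admissible_nestCups_self _ 1) (by omega) (by omega)
      (by omega) (by omega) (by omega)
    rw [← nestCups_eq_shift, ← nestCups_eq_shift] at h1
    have h2 : P.Eqv s w w [ins (p - N) arc, cap (p - N - 1)] [] := by
      obtain ⟨v, hv⟩ : ∃ v, p - N = v + 1 := ⟨p - N - 1, by omega⟩
      rw [hv]
      exact of_move (Move.zigzag_right _) ⟨by omega, trivial, by simp only [legs]; omega, by
        simp [Admissible, legs]⟩ rfl
    refine (h1.symm.inside (nestCups P.V p N) [cap (p - N - 1)]
      (admissible_nestCups _ _ _ _ (by omega)) ⟨by omega, by simp [Admissible]⟩ ?_ rfl).trans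
      ((ih (by omega)).inside [] [ins (p - N) arc, cap (p - N - 1)] rfl h2.left
        (by simp) rfl |>.trans (by simpa using h2))
    rw [nestCups_add, nestCaps_add, nestCaps_one]
    simp only [List.append_assoc, nestCups_one]

end StarPlanarAlgebra.Eqv

namespace StarPlanarAlgebra
variable (P : StarPlanarAlgebra.{u}) {s : Bool} {w w' : ℕ} {l m : List (Step P.V)}

/-- The strings of a box may be led below the box to the other side: after a full turn, which is
an elementary isotopy, the nested strings are straightened. -/
theorem eqv_box_rotate (c : Col) (x : P.V c) :
    P.Eqv c.shaded (2 * c.size) 0 ([ins 0 (box c x)] ++ nestCaps P.V (2 * c.size) (2 * c.size))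
      ([ins 0 (box c x)].map (Step.shift (2 * c.size)) ++
        nestCaps P.V (2 * c.size) (2 * c.size)) := by
  set N := 2 * c.size with hN
  have hb : Admissible c.shaded 0 [ins 0 (box c x)] N := by simp [Admissible, Fits, legs, hN]
  have hodd : Bool.xor c.shaded N.bodd = c.shaded := by simp [hN]
  have hb' : Admissible (Bool.xor c.shaded N.bodd) 0 [ins 0 (box c x)] N := by rwa [hodd]
  have hW : Admissible c.shaded 0 (nestCups P.V 0 N ++ [ins 0 (box c x)].map (Step.shift N) ++
      nestCaps P.V N N) N := (((admissible_nestCups_self c.shaded N).word N hb' (by omega)).caps N N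
    (by omega) (by omega)).cast (by omega)
  have h1 : P.Eqv c.shaded 0 N [ins 0 (box c x)]
      (nestCups P.V 0 N ++ [ins 0 (box c x)].map (Step.shift N) ++ nestCaps P.V N N) :=
    (Eqv.of_move (by simpa [Step.shift] using Move.rotate 0 c x) hW hb).symm
  have h2 := ((h1.add N).append_right (m := nestCaps P.V N N) (w₀ := 0)
    ((admissible_nestCaps_self c.shaded N).cast rfl |> fun h => by simpa [two_mul] using h))
  rw [Nat.zero_add] at h2
  refine h2.trans ?_
  have h3 : P.Eqv c.shaded (2 * N + N + N) 0 (nestCaps P.V N N ++ nestCaps P.V N N)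
      (nestCaps P.V (3 * N) N ++ nestCaps P.V N N) :=
    Eqv.caps_caps (by omega) (by omega) (by omega) (by omega) (by omega)
  have h4 : P.Eqv c.shaded (2 * N + N) (2 * N)
      ([ins 0 (box c x)].map (Step.shift N) ++ nestCaps P.V (3 * N) N)
      (nestCaps P.V (2 * N) N ++ [ins 0 (box c x)].map (Step.shift N)) :=
    Eqv.word_caps hb' (by omega) (by omega) (by omega) (by omega)
  have h5 : P.Eqv c.shaded N N (nestCups P.V 0 N ++ nestCaps P.V (2 * N) N) [] :=
    Eqv.zigzag_left (by omega) (by omega)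
  have hc : Admissible c.shaded N (nestCups P.V 0 N) (2 * N + N) :=
    (admissible_nestCups _ _ _ _ (by omega)).cast (by omega)
  have hc' : Admissible c.shaded (2 * N) (nestCaps P.V N N) 0 := admissible_nestCaps_self _ _
  refine (h3.inside (nestCups P.V 0 N ++ [ins 0 (box c x)].map (Step.shift N)) []
    (hc.word N hb' (by omega)) rfl (by simp) rfl).trans ?_
  refine (h4.inside (nestCups P.V 0 N) (nestCaps P.V N N) hc hc' (by simp) rfl).trans ?_
  exact h5.inside [] ([ins 0 (box c x)].map (Step.shift N) ++ nestCaps P.V N N) rfl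
    (admissible_append _ _ _ ((hb'.at le_rfl).cast (by omega)) hc') (by simp) (by simp)

end StarPlanarAlgebra

/-! ### Rotations, contractions and mirror images of diagrams -/

section Words
variable {V : Col → Type v} {s : Bool} {w w' : ℕ} {l m n : List (Step V)}

/-- The diagram `l` with `N` strings, turned so that its last `k` strings become the first ones:
they are led below `l` to the left. -/
def rotL (k N : ℕ) (l : List (Step V)) : List (Step V) :=
  nestCups V 0 k ++ l.map (Step.shift k) ++ nestCaps V (k + N) k

/-- The diagram `l` turned so that its first `k` strings become the last ones: they are led below
`l` to the right. -/
def rotR (k : ℕ) (l : List (Step V)) : List (Step V) :=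
  nestCups V 0 k ++ l.map (Step.shift k) ++ nestCaps V k k

/-- The diagram `l`, with `N` strings, to the left of `m`, the last `J` strings of `l` being joined
to the first `J` strings of `m`. -/
def con (N J : ℕ) (l m : List (Step V)) : List (Step V) :=
  l ++ m.map (Step.shift N) ++ nestCaps V N J

theorem admissible_rotL {k N : ℕ} (h : Admissible (Bool.xor s k.bodd) 0 l N) (hk : k ≤ N) :
    Admissible s 0 (rotL k N l) N :=
  (((admissible_nestCups_self s k).word k h (by omega)).caps (k + N) k (by omega)
    (by omega)).cast (by omega)

theorem admissible_rotR {k N : ℕ} (h : Admissible (Bool.xor s k.bodd) 0 l N) (hk : k ≤ N) :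
    Admissible s 0 (rotR k l) N :=
  (((admissible_nestCups_self s k).word k h (by omega)).caps k k (by omega)
    (by omega)).cast (by omega)

theorem Admissible.at_even (hl : Admissible s 0 l w) (hm : Admissible s 0 m w') :
    Admissible (Bool.xor s w.bodd) 0 m w' := by
  rw [hl.bodd_eq]; simpa using hm

theorem admissible_con {N M J K : ℕ} (hl : Admissible s 0 l N) (hm : Admissible s 0 m M)
    (hN : J ≤ N) (hM : J ≤ M) (hK : K + 2 * J = N + M) : Admissible s 0 (con N J l m) K :=
  ((hl.word N (hl.at_even hm) le_rfl).caps N J hN (by omega)).cast (by omega)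

theorem mirror_mirror (st : ∀ c, V c → V c) (hst : ∀ c x, st c (st c x) = x)
    (h : Admissible s w l w') : mirror st w (mirror st w l) = l := by
  induction l generalizing w with
  | nil => rfl
  | cons a l ih =>
    cases a with
    | ins p g =>
      have := h.1
      have e : (g.map st).map st = g := by cases g <;> simp [Piece.map, hst]
      simp only [mirror, Piece.legs_map, ih h.2.2, e]
      congr 2; omega
    | cap p =>
      have := h.1
      simp only [mirror, ih h.2]
      congr 2; omega

theorem mirror_add (st : ∀ c, V c → V c) (h : Admissible s w l w') (u : ℕ) :
    mirror st (w + u) l = (mirror st w l).map (Step.shift u) := by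
  induction l generalizing w with
  | nil => rfl
  | cons a l ih =>
    cases a with
    | ins p g =>
      have := h.1
      simp only [mirror, List.map_cons, Step.shift]
      rw [show w + u + g.legs = w + g.legs + u by omega, ih h.2.2]
      congr 2; omega
    | cap p =>
      have := h.1
      simp only [mirror, List.map_cons, Step.shift]
      rw [show w + u - 2 = w - 2 + u by omega, ih h.2]
      congr 2; omega

theorem mirror_at (st : ∀ c, V c → V c) (h : Admissible s 0 l w) (r u : ℕ) :
    mirror st (r + u) (l.map (Step.shift r)) = (mirror st 0 l).map (Step.shift u) := by
  have := mirror_shift st s (h.add u) (r := r)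
  rw [Nat.zero_add, Nat.add_comm] at this
  rw [this, ← mirror_add st h, Nat.zero_add]

theorem mirror_rotL (st : ∀ c, V c → V c) {k N : ℕ} (h : Admissible (Bool.xor s k.bodd) 0 l N) :
    mirror st 0 (rotL k N l) = rotR k (mirror st 0 l) := by
  have h1 := admissible_nestCups_self (V := V) s k
  rw [rotL, mirror_append st s (h1.word k h (by omega)), mirror_append st s h1, mirror_nestCups,
    mirror_nestCaps st (by omega) (by omega), rotR, two_mul, mirror_at st h]
  congr 2; omega

theorem mirror_rotR (st : ∀ c, V c → V c) {k N : ℕ} (h : Admissible (Bool.xor s k.bodd) 0 l N) :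
    mirror st 0 (rotR k l) = rotL k N (mirror st 0 l) := by
  have h1 := admissible_nestCups_self (V := V) s k
  rw [rotR, mirror_append st s (h1.word k h (by omega)), mirror_append st s h1, mirror_nestCups,
    mirror_nestCaps st (by omega) (by omega), rotL, two_mul, mirror_at st h]
  congr 2; omega

theorem mirror_con (st : ∀ c, V c → V c) {N M J : ℕ} (hl : Admissible s 0 l N)
    (hm : Admissible s 0 m M) (hN : J ≤ N) (hM : J ≤ M) :
    mirror st 0 (con N J l m) = mirror st 0 l ++ mirror st 0 m ++ nestCaps V M J := by
  rw [con, mirror_append st s (hl.word N (hl.at_even hm) le_rfl), mirror_append st s hl,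
    mirror_nestCaps st (by omega) (by omega)]
  have := mirror_at st hm N 0
  rw [Nat.add_zero, map_shift_zero] at this
  rw [this, Nat.add_sub_cancel_left]

end Words

namespace StarPlanarAlgebra
variable {P : StarPlanarAlgebra.{u}} {s : Bool} {w w' : ℕ} {l l' m m' n : List (Step P.V)}

theorem Eqv.rotL {k N : ℕ} (h : P.Eqv (Bool.xor s k.bodd) 0 N l l') (hk : k ≤ N) :
    P.Eqv s 0 N (rotL k N l) (rotL k N l') := by
  refine h.step k k (nestCups P.V 0 k) (nestCaps P.V (k + N) k) rfl rfl rfl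
    ((admissible_nestCups_self s k).cast (by omega)) ?_
  exact (admissible_nestCaps s (k + N + k) (k + N) k (by omega) (by omega)).cast (by omega)

theorem Eqv.rotR {k N : ℕ} (h : P.Eqv (Bool.xor s k.bodd) 0 N l l') (hk : k ≤ N) :
    P.Eqv s 0 N (rotR k l) (rotR k l') := by
  refine h.step k k (nestCups P.V 0 k) (nestCaps P.V k k) rfl rfl rfl
    ((admissible_nestCups_self s k).cast (by omega)) ?_
  exact (admissible_nestCaps s (k + N + k) k k (by omega) (by omega)).cast (by omega)

theorem Eqv.con {N M J K : ℕ} (h : P.Eqv s 0 N l l') (h' : P.Eqv s 0 M m m') (hN : J ≤ N)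
    (hM : J ≤ M) (hK : K + 2 * J = N + M) : P.Eqv s 0 K (con N J l m) (con N J l' m') := by
  refine ((h.append ?_).append_right (w₀ := K) ((admissible_nestCaps s (N + M) N J hN
    (by omega)).cast (by omega)))
  have := h'.shift N 0 (s₀ := s) (by rw [h.left.bodd_eq]; simp)
  simpa using this

/-- If the first `k` strings of the turned diagram `rotL k N l` are joined to `k` strings on its
left, then the last `k` strings of `l` are joined to these strings. -/
theorem rotL_caps {k N p q r : ℕ} (h : Admissible (Bool.xor s p.bodd) 0 l N) (hk : k ≤ N)
    (hq : q = p + k) (hr : r = p + N) (hw : p + k ≤ w) (hw' : w' + 2 * k = w + N) :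
    P.Eqv s w w' ((rotL k N l).map (Step.shift q) ++ nestCaps P.V q k)
      (l.map (Step.shift p) ++ nestCaps P.V r k) := by
  subst hq hr
  have h2 : Admissible (Bool.xor s (p + 2 * k).bodd) 0 l N := by simpa using h
  have hcups := admissible_nestCups (V := P.V) s w (p + k) k hw
  have e1 : P.Eqv s (w + 2 * k + N) (w + N - 2 * k)
      (nestCaps P.V (p + k) k ++ nestCaps P.V (p + N) k)
      (nestCaps P.V (p + 2 * k + N) k ++ nestCaps P.V (p + k) k) :=
    Eqv.caps_caps (by omega) (by omega) (by omega) (by omega) (by omega)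
  have e2 : P.Eqv s (w + 2 * k) (w + N) (nestCaps P.V (p + k) k ++ l.map (Step.shift p))
      (l.map (Step.shift (p + 2 * k)) ++ nestCaps P.V (p + k) k) :=
    Eqv.caps_word h2 (by omega) (by omega) (by omega) (by omega) (by omega)
  have e3 : P.Eqv s w w (nestCups P.V (p + k) k ++ nestCaps P.V (p + k) k) [] :=
    Eqv.zigzag_right (by omega) (by omega)
  have hl := h.at (w := w) (by omega)
  have ha : Admissible s (w + N) (nestCaps P.V (p + N) k) w' :=
    (admissible_nestCaps s (w + N) (p + N) k (by omega) (by omega)).cast (by omega)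
  refine (e1.symm.inside (nestCups P.V (p + k) k ++ l.map (Step.shift (p + 2 * k))) []
    (hcups.word _ h2 (by omega)) (show w + N - 2 * k = w' by omega) ?_ rfl).trans
    ((e2.symm.inside (nestCups P.V (p + k) k) (nestCaps P.V (p + N) k) hcups ha (by simp)
      rfl).trans (e3.inside [] (l.map (Step.shift p) ++ nestCaps P.V (p + N) k) rfl
      (admissible_append _ _ _ hl ha) (by simp) (by simp)))
  simp only [rotL, List.map_append, shift_nestCups, map_shift_shift,
    List.append_assoc, List.append_nil]
  rw [shift_nestCaps _ _ _ (by omega)]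
  simp only [show k + (p + k) = p + 2 * k by omega, show k + N + (p + k) = p + 2 * k + N by omega,
    Nat.zero_add]

/-- `k` parallel strings are a left unit for the contraction of `k` strings. -/
theorem cups_con {k N : ℕ} (h : Admissible s 0 l N) (hk : k ≤ N) :
    P.Eqv s 0 N (con (2 * k) k (nestCups P.V 0 k) l) l := by
  have e1 : P.Eqv s 0 (N + 2 * k) (nestCups P.V 0 k ++ l.map (Step.shift (2 * k)))
      (l ++ nestCups P.V 0 k) := by
    have := Eqv.word_word (P := P) (s := s) (w := 0) (w' := N + 2 * k) (r := 0) (r' := 0)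
      (r'' := 2 * k) (m := nestCups P.V 0 k) (m' := l) (n := 2 * k) (n' := N)
      (admissible_nestCups_self _ k) (by simpa using h) le_rfl le_rfl (by omega) (by omega)
    simpa only [map_shift_zero] using this
  have e2 : P.Eqv s N N (nestCups P.V 0 k ++ nestCaps P.V (2 * k) k) [] :=
    Eqv.zigzag_left (by omega) (by omega)
  exact (e1.inside [] (nestCaps P.V (2 * k) k) rfl
    ((admissible_nestCaps s _ (2 * k) k (by omega) (by omega)).cast (by omega))
    (by simp [con]) rfl).trans (e2.inside l [] h rfl (by simp) (by simp))

/-- `k` parallel strings are a right unit for the contraction of `k` strings. -/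
theorem con_cups {k N : ℕ} (h : Admissible s 0 l N) (hk : k ≤ N) :
    P.Eqv s 0 N (con N k l (nestCups P.V 0 k)) l := by
  have e2 : P.Eqv s N N (nestCups P.V N k ++ nestCaps P.V N k) [] := Eqv.zigzag_right hk le_rfl
  exact e2.inside l [] h rfl (by simp [con, shift_nestCups]) (by simp)

theorem rotR_rotL {k N : ℕ} (h : Admissible s 0 l N) (hk : k ≤ N) :
    P.Eqv s 0 N (rotR k (rotL k N l)) l := by
  have e1 : P.Eqv s (2 * k) N ((rotL k N l).map (Step.shift k) ++ nestCaps P.V k k)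
      (l.map (Step.shift 0) ++ nestCaps P.V N k) :=
    rotL_caps (by simpa using h) hk (by omega) (by omega) (by omega) (by omega)
  have e2 : P.Eqv s 0 (N + 2 * k) (l.map (Step.shift 0) ++ (nestCups P.V 0 k).map (Step.shift N))
      ((nestCups P.V 0 k).map (Step.shift 0) ++ l.map (Step.shift 0)) :=
    Eqv.word_word (by simpa using h) (admissible_nestCups_self _ k) le_rfl le_rfl (by omega)
      (by omega)
  refine (e1.inside (nestCups P.V 0 k) [] (admissible_nestCups_self s k) rfl
    (by simp [rotR]) rfl).trans ((e2.symm.inside [] (nestCaps P.V N k) rfl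
      ((admissible_nestCaps s _ N k (by omega) (by omega)).cast (by omega)) (by simp) rfl).trans ?_)
  simpa [con] using con_cups h hk

theorem rotL_rotR {k N : ℕ} (h : Admissible s 0 l N) (hk : k ≤ N) :
    P.Eqv s 0 N (rotL k N (rotR k l)) l := by
  have h2 : Admissible (Bool.xor s (2 * k).bodd) 0 l N := by simpa using h
  have hc : Admissible s 0 (nestCups P.V 0 k ++ nestCups P.V k k) (4 * k) :=
    ((admissible_nestCups_self s k).cups k k (by omega)).cast (by omega)
  have e1 : P.Eqv s (4 * k + N) N (nestCaps P.V (2 * k) k ++ nestCaps P.V (k + N) k)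
      (nestCaps P.V (3 * k + N) k ++ nestCaps P.V (2 * k) k) :=
    Eqv.caps_caps (by omega) (by omega) (by omega) (by omega) (by omega)
  have e2 : P.Eqv s (4 * k) (2 * k + N)
      (l.map (Step.shift (2 * k)) ++ nestCaps P.V (3 * k + N) k)
      (nestCaps P.V (3 * k) k ++ l.map (Step.shift (2 * k))) :=
    Eqv.word_caps h2 (by omega) (by omega) (by omega) (by omega)
  have e3 : P.Eqv s (2 * k) (2 * k) (nestCups P.V k k ++ nestCaps P.V (3 * k) k) [] :=
    Eqv.zigzag_left (by omega) (by omega)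
  have ha : Admissible s (2 * k + N) (nestCaps P.V (2 * k) k) N :=
    (admissible_nestCaps s _ (2 * k) k (by omega) (by omega)).cast (by omega)
  refine (e1.inside (nestCups P.V 0 k ++ nestCups P.V k k ++ l.map (Step.shift (2 * k))) []
    (hc.word (2 * k) h2 (by omega)) rfl ?_ rfl).trans ?_
  · simp only [rotL, rotR, List.map_append, shift_nestCups, map_shift_shift, List.append_assoc,
      List.append_nil]
    rw [shift_nestCaps _ _ _ le_rfl]
    simp only [show k + k = 2 * k by omega, Nat.zero_add]
  refine (e2.inside (nestCups P.V 0 k ++ nestCups P.V k k) (nestCaps P.V (2 * k) k) hc ha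
    (by simp) rfl).trans ?_
  refine (e3.inside (nestCups P.V 0 k) (l.map (Step.shift (2 * k)) ++ nestCaps P.V (2 * k) k)
    (admissible_nestCups_self s k) (admissible_append _ _ _ (h2.at le_rfl) ha)
    (by simp) (l' := con (2 * k) k (nestCups P.V 0 k) l) (by simp [con])).trans ?_
  exact cups_con h hk

/-- Associativity of contractions whose outer factors are not joined. -/
theorem con_con_of_le {N M K I J A B : ℕ} (hl : Admissible s 0 l N) (hm : Admissible s 0 m M)
    (hn : Admissible s 0 n K) (hI : I ≤ N) (hJ : J ≤ K) (hIJ : I + J ≤ M)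
    (hA : A + 2 * I = N + M) (hB : B + 2 * J = A + K) :
    P.Eqv s 0 B (con A J (con N I l m) n) (con N I l (con M J m n)) := by
  have hlm : Admissible s 0 (l ++ m.map (Step.shift N)) (N + M) :=
    hl.word N (hl.at_even hm) le_rfl
  have e1 : P.Eqv s (N + M) (A + K) (nestCaps P.V N I ++ n.map (Step.shift A))
      (n.map (Step.shift (N + M)) ++ nestCaps P.V N I) :=
    Eqv.caps_word (hlm.at_even hn) (by omega) (by omega) (by omega) (by omega) (by omega)
  have e2 : P.Eqv s (N + M + K) B (nestCaps P.V N I ++ nestCaps P.V A J)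
      (nestCaps P.V (N + M) J ++ nestCaps P.V N I) :=
    Eqv.caps_caps (by omega) (by omega) (by omega) (by omega) (by omega)
  refine (e1.inside (l ++ m.map (Step.shift N)) (nestCaps P.V A J) hlm
    ((admissible_nestCaps s _ A J (by omega) (by omega)).cast (by omega))
    (by simp [con]) rfl).trans (e2.inside (l ++ m.map (Step.shift N) ++ n.map (Step.shift (N + M)))
      [] (hlm.word _ (hlm.at_even hn) le_rfl) rfl (by simp) ?_)
  simp only [con, List.map_append, map_shift_shift, List.append_assoc, List.append_nil]
  rw [shift_nestCaps _ _ _ (by omega), Nat.add_comm M N]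

/-- Associativity of contractions when the middle factor is used up and the `g` next strings of the
outer factors are joined around it. -/
theorem con_con_of_eq {N M K I J g A B : ℕ} (hl : Admissible s 0 l N) (hm : Admissible s 0 m M)
    (hn : Admissible s 0 n K) (hI : I + g ≤ N) (hJ : J + g ≤ K) (hIJ : I + J = M)
    (hA : A + 2 * I = N + M) (hB : B + 2 * (J + g) = A + K) :
    P.Eqv s 0 B (con A (J + g) (con N I l m) n) (con N (I + g) l (con M J m n)) := by
  have h1 := con_con_of_le (P := P) (B := B + 2 * g) hl hm hn (show I ≤ N by omega)
    (show J ≤ K by omega) hIJ.le hA (by omega)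
  have h2 : Admissible s (B + 2 * g) (nestCaps P.V (A - J) g) B :=
    (admissible_nestCaps s _ (A - J) g (by omega) (by omega)).cast (by omega)
  have h3 := h1.append_right h2
  have e1 : con A (J + g) (con N I l m) n = con A J (con N I l m) n ++ nestCaps P.V (A - J) g := by
    simp only [con, nestCaps_add, List.append_assoc]
  have e2 : con N (I + g) l (con M J m n) =
      con N I l (con M J m n) ++ nestCaps P.V (A - J) g := by
    simp only [con, nestCaps_add, List.append_assoc, show A - J = N - I by omega]
  rwa [e1, e2]

theorem mirror_con_eqv {st : ∀ c, P.V c → P.V c} {N M J K : ℕ} (hl : Admissible s 0 l N)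
    (hm : Admissible s 0 m M) (hN : J ≤ N) (hM : J ≤ M) (hK : K + 2 * J = N + M) :
    P.Eqv s 0 K (mirror st 0 (con N J l m)) (con M J (mirror st 0 m) (mirror st 0 l)) := by
  have hl' := admissible_mirror st s l 0 N rfl hl
  have hm' := admissible_mirror st s m 0 M rfl hm
  have e1 : P.Eqv s 0 (N + M) ((mirror st 0 m).map (Step.shift 0) ++
      (mirror st 0 l).map (Step.shift M))
      ((mirror st 0 l).map (Step.shift 0) ++ (mirror st 0 m).map (Step.shift 0)) :=
    Eqv.word_word (by simpa using hm') (by simpa using hl') le_rfl le_rfl (by omega) (by omega)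
  rw [mirror_con st hl hm hN hM]
  exact e1.symm.inside [] (nestCaps P.V M J) rfl
    ((admissible_nestCaps s _ M J hM (by omega)).cast (by omega)) (by simp) (by simp [con])

/-- The box of `x`, turned so that its last `k` strings become the first ones. -/
def bx (k : ℕ) {n : ℕ} (x : P.V (Col.ofNat n)) : List (Step P.V) :=
  rotL k (2 * n) [ins 0 (box _ x)]

theorem admissible_box {n : ℕ} (x : P.V (Col.ofNat n)) :
    Admissible false 0 [ins 0 (box _ x)] (2 * n) := by simp [Admissible, Fits, legs]

theorem admissible_bx {k n : ℕ} (x : P.V (Col.ofNat n)) (hk : k ≤ n) :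
    Admissible k.bodd 0 (bx k x) (2 * n) :=
  admissible_rotL (by simpa using admissible_box x) (by omega)

theorem box_eqv {n : ℕ} (h : Admissible false 0 l (2 * n)) :
    P.Eqv false 0 (2 * n) [ins 0 (box _ (P.val (Col.ofNat n) l))] l := by
  have h' : Admissible (Col.ofNat n).shaded 0 l (2 * (Col.ofNat n).size) := by simpa using h
  have := Eqv.box_Z (P := P) ⟨l, h'⟩
  rw [P.val_of_admissible h']
  simpa using this

theorem val_box {n : ℕ} (x : P.V (Col.ofNat n)) : P.val (Col.ofNat n) [ins 0 (box _ x)] = x :=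
  (P.val_eq (Tangle.ident x)).trans (P.Z_ident x)

theorem Eqv.val_ofNat {n : ℕ} (h : P.Eqv false 0 (2 * n) l l') :
    P.val (Col.ofNat n) l = P.val (Col.ofNat n) l' := by
  refine Eqv.val_eq_val ?_
  simpa using h

/-- Every diagram with an even number of strings is equivalent to a turned box. -/
theorem bx_val_rotR {k n : ℕ} (h : Admissible k.bodd 0 l (2 * n)) (hk : k ≤ n) :
    P.Eqv k.bodd 0 (2 * n) (bx k (P.val (Col.ofNat n) (rotR k l))) l := by
  have h1 : Admissible false 0 (rotR k l) (2 * n) :=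
    admissible_rotR (by simpa using h) (by omega)
  refine (Eqv.rotL ?_ (by omega)).trans (rotL_rotR h (by omega))
  simpa using box_eqv h1

theorem val_rotR_bx {k n : ℕ} (x : P.V (Col.ofNat n)) (hk : k ≤ n) :
    P.val (Col.ofNat n) (rotR k (bx k x)) = x :=
  (rotR_rotL (admissible_box x) (by omega)).val_ofNat.trans (val_box x)

theorem bx_injective {k n : ℕ} {x y : P.V (Col.ofNat n)} (hk : k ≤ n)
    (h : P.Eqv k.bodd 0 (2 * n) (bx k x) (bx k y)) : x = y := by
  rw [← val_rotR_bx x hk, ← val_rotR_bx y hk]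
  exact (Eqv.rotR (s := false) (by simpa using h) (by omega)).val_ofNat

theorem val_mirror {c : Col} (h : Admissible c.shaded 0 l (2 * c.size)) :
    P.val c (mirror (fun d x => P.st d x) 0 l) = P.st c (P.val c l) := by
  rw [P.val_of_admissible h, ← P.Z_adjoint ⟨l, h⟩]
  exact P.val_eq (Tangle.adjoint (fun d x => P.st d x) ⟨l, h⟩)

/-- Equivalence passes to mirror images, since the value of the mirror image of a diagram is given by
the involution. -/
theorem Eqv.mirror {k n : ℕ} (h : P.Eqv k.bodd 0 (2 * n) l l') (hk : k ≤ n) :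
    P.Eqv k.bodd 0 (2 * n) (mirror (fun d x => P.st d x) 0 l)
      (mirror (fun d x => P.st d x) 0 l') := by
  have key : ∀ l : List (Step P.V), Admissible k.bodd 0 l (2 * n) →
      P.Eqv k.bodd 0 (2 * n) (_root_.mirror (fun d x => P.st d x) 0 l) (_root_.rotR k
        [ins 0 (box _ (P.st (Col.ofNat n) (P.val (Col.ofNat n) (_root_.rotR k l))))]) := by
    intro l hl
    have h1 : Admissible false 0 (_root_.rotR k l) (2 * n) :=
      admissible_rotR (by simpa using hl) (by omega)
    rw [← val_mirror (by simpa using h1), mirror_rotR _ (s := false) (N := 2 * n) (by simpa using hl)]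
    have hm := admissible_mirror (fun d x => P.st d x) _ l 0 _ rfl hl
    refine ((Eqv.rotR (k := k) (s := k.bodd) ?_ (by omega)).trans (rotR_rotL hm (by omega))).symm
    rw [Bool.xor_self]
    exact box_eqv (admissible_rotL (by simpa using hm) (by omega))
  refine (key l h.left).trans ?_
  rw [(Eqv.rotR (s := false) (by simpa using h) (by omega)).val_ofNat]
  exact (key l' h.right).symm

end StarPlanarAlgebra

/-! ### Leading strings around a diagram -/

namespace StarPlanarAlgebra
variable {P : StarPlanarAlgebra.{u}} {s : Bool} {w w' : ℕ} {l l' m m' n : List (Step P.V)}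

/-- If the strings of `l` may be led around `l`, the same holds for the strings of `rotL k N l`. -/
theorem dual_rotL {k N : ℕ} (h : Admissible (Bool.xor s k.bodd) 0 l N) (hk : k ≤ N)
    (hd : P.Eqv (Bool.xor s k.bodd) N 0 (l ++ nestCaps P.V N N)
      (l.map (Step.shift N) ++ nestCaps P.V N N)) :
    P.Eqv s N 0 (rotL k N l ++ nestCaps P.V N N)
      ((rotL k N l).map (Step.shift N) ++ nestCaps P.V N N) := by
  have hN : N.bodd = false := h.bodd_eq
  obtain ⟨j, rfl⟩ := Nat.exists_eq_add_of_le hk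
  have hj : j.bodd = k.bodd := by
    rw [Nat.bodd_add] at hN; revert hN; cases j.bodd <;> cases k.bodd <;> simp
  have hpj : Admissible (Bool.xor s j.bodd) 0 l (k + j) := by rwa [hj]
  have hpj' : Admissible (Bool.xor s (j + 2 * k).bodd) 0 l (k + j) := by simpa using hpj
  have e0 : nestCaps P.V (k + j) (k + j) = nestCaps P.V (k + j) j ++ nestCaps P.V k k := by
    have := nestCaps_add (V := P.V) (k + j) j k
    rwa [Nat.add_sub_cancel, Nat.add_comm j k] at this
  -- the relation for `l`, between the `k` strings led to the left and the last `k` strings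
  have e1 : P.Eqv s (k + j) 0 (rotL k (k + j) l ++ nestCaps P.V (k + j) (k + j))
      (nestCups P.V 0 k ++ l.map (Step.shift (j + 2 * k)) ++ nestCaps P.V (j + 2 * k) j ++
        nestCaps P.V (2 * k) k ++ nestCaps P.V k k) := by
    refine hd.step k k (nestCups P.V 0 k) (nestCaps P.V k k) ?_ ?_ rfl
      ((admissible_nestCups s _ 0 k (by omega)).cast (by omega))
      ((admissible_nestCaps s _ k k (by omega) (by omega)).cast (by omega))
    · simp only [rotL, List.map_append, List.append_assoc]
      rw [shift_nestCaps _ _ _ le_rfl, show k + j + k = k + (k + j) by omega,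
        nestCaps_add (k + (k + j)) k j, e0]
      simp only [List.append_assoc, Nat.add_sub_cancel_left]
    · simp only [List.map_append, List.append_assoc, map_shift_shift]
      rw [shift_nestCaps _ _ _ le_rfl, show k + j + k = j + 2 * k by omega, Nat.add_comm k j,
        nestCaps_add (j + 2 * k) j k]
      simp only [List.append_assoc, Nat.add_sub_cancel_left]
  have e2 : P.Eqv s (k + j) (2 * (k + j) + 2 * k)
      (nestCups P.V 0 k ++ l.map (Step.shift (j + 2 * k)))
      (l.map (Step.shift j) ++ nestCups P.V 0 k) := by
    have := Eqv.word_word (P := P) (s := s) (w := k + j) (w' := 2 * (k + j) + 2 * k) (r := 0)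
      (r' := j) (r'' := j + 2 * k) (m := nestCups P.V 0 k) (m' := l) (n := 2 * k) (n' := k + j)
      (admissible_nestCups_self _ k) hpj (by omega) (by omega) (by omega) (by omega)
    simpa only [map_shift_zero] using this
  have e3 : P.Eqv s (2 * (k + j)) (4 * k) (nestCups P.V 0 k ++ nestCaps P.V (j + 2 * k) j)
      (nestCaps P.V j j ++ nestCups P.V 0 k) := by
    have := Eqv.word_caps (P := P) (s := s) (w := 2 * (k + j)) (w' := 4 * k) (r := 0) (q := j)
      (q' := j + 2 * k) (N := j) (m := nestCups P.V 0 k) (n := 2 * k)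
      (admissible_nestCups_self _ k) (by omega) (by omega) (by omega) (by omega)
    simpa only [map_shift_zero] using this
  have e4 : P.Eqv s (2 * k) (2 * k) (nestCups P.V 0 k ++ nestCaps P.V (2 * k) k) [] :=
    Eqv.zigzag_left (by omega) (by omega)
  have e5 : P.Eqv s (2 * (k + j)) 0 (nestCaps P.V j j ++ nestCaps P.V k k)
      (nestCaps P.V (2 * j + k) k ++ nestCaps P.V j j) :=
    Eqv.caps_caps (by omega) (by omega) (by omega) (by omega) (by omega)
  have e6 : P.Eqv s (k + j) (2 * j)
      ((rotL k (k + j) l).map (Step.shift (k + j)) ++ nestCaps P.V (k + j) k)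
      (l.map (Step.shift j) ++ nestCaps P.V (2 * j + k) k) :=
    rotL_caps hpj (by omega) (by omega) (by omega) (by omega) (by omega)
  have hk2 : Admissible s (4 * k) (nestCaps P.V (2 * k) k ++ nestCaps P.V k k) 0 :=
    ((admissible_nestCaps s (4 * k) (2 * k) k (by omega) (by omega)).caps k k (by omega)
      (by omega)).cast (by omega)
  have hlj : Admissible s (k + j) (l.map (Step.shift j)) (2 * (k + j)) :=
    (hpj.at (by omega)).cast (by omega)
  refine e1.trans ?_
  refine (e2.inside [] (nestCaps P.V (j + 2 * k) j ++ (nestCaps P.V (2 * k) k ++ nestCaps P.V k k))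
    rfl (admissible_append _ _ _ ((admissible_nestCaps s _ _ j (by omega) (by omega)).cast
      (by omega)) hk2) (by simp) rfl).trans ?_
  refine (e3.inside (l.map (Step.shift j)) (nestCaps P.V (2 * k) k ++ nestCaps P.V k k) hlj hk2
    (by simp) rfl).trans ?_
  refine (e4.inside (l.map (Step.shift j) ++ nestCaps P.V j j) (nestCaps P.V k k)
    ((hlj.caps j j (by omega) (by omega)).cast (by omega)) (admissible_nestCaps_self s k)
    (by simp) rfl).trans ?_
  refine (e5.inside (l.map (Step.shift j)) [] hlj rfl (by simp) rfl).trans ?_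
  refine (e6.inside [] (nestCaps P.V j j) rfl (admissible_nestCaps_self s j) ?_ (by simp)).symm
  rw [nestCaps_add (k + j) k j, Nat.add_sub_cancel_left]
  simp

theorem dual_bx {k n : ℕ} (x : P.V (Col.ofNat n)) (hk : k ≤ n) :
    P.Eqv k.bodd (2 * n) 0 (bx k x ++ nestCaps P.V (2 * n) (2 * n))
      ((bx k x).map (Step.shift (2 * n)) ++ nestCaps P.V (2 * n) (2 * n)) := by
  have := P.eqv_box_rotate (Col.ofNat n) x
  rw [Col.size_ofNat, Col.shaded_ofNat] at this
  exact dual_rotL (by simpa using admissible_box x) (by omega) (by simpa using this)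

/-- A pairing of all strings is symmetric, provided that the strings of one factor may be led
around it. -/
theorem con_comm {N : ℕ} (hl : Admissible s 0 l N) (hm : Admissible s 0 m N)
    (hd : P.Eqv s N 0 (m ++ nestCaps P.V N N) (m.map (Step.shift N) ++ nestCaps P.V N N)) :
    P.Eqv s 0 0 (con N N l m) (con N N m l) := by
  have e1 : P.Eqv s 0 (2 * N) (m.map (Step.shift 0) ++ l.map (Step.shift N))
      (l.map (Step.shift 0) ++ m.map (Step.shift 0)) :=
    Eqv.word_word (by simpa using hm) (by simpa using hl) le_rfl le_rfl (by omega) (by omega)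
  exact (hd.symm.inside l [] hl rfl (by simp [con]) rfl).trans (e1.symm.inside [] (nestCaps P.V N N)
    rfl (admissible_nestCaps_self s N) (by simp) (by simp [con]))

/-! ### The product of the algebras `F_k` -/

/-- In terms of boxes turned so that the `k` strings on the left come first, each component of the
product of `F_k` is a plain contraction of adjacent strings. -/
theorem bx_mulTangle {k d e j : ℕ} (hj : j ≤ 2 * min d e) (x : P.V (Col.ofNat (k + d)))
    (y : P.V (Col.ofNat (k + e))) :
    P.Eqv k.bodd 0 (2 * (k + (d + e - j))) (bx k (P.Z (GJS.mulTangle P k d e j hj x y)))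
      (con (2 * (k + d)) (k + j) (bx k x) (bx k y)) := by
  set X : List (Step P.V) := [ins 0 (box _ x)] with hX
  set Y : List (Step P.V) := [ins 0 (box _ y)] with hY
  have hx : Admissible (Bool.xor k.bodd k.bodd) 0 X (2 * (k + d)) := by simpa using admissible_box x
  have hy : Admissible (Bool.xor k.bodd (k + 2 * d).bodd) 0 Y (2 * (k + e)) := by
    simpa using admissible_box y
  have hc : Admissible k.bodd 0 (nestCups P.V 0 k ++ X.map (Step.shift k)) (4 * k + 2 * d) :=
    ((admissible_nestCups_self _ k).word k hx (by omega)).cast (by omega)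
  have hcy : Admissible k.bodd 0 (nestCups P.V 0 k ++ X.map (Step.shift k) ++
      Y.map (Step.shift (k + 2 * d))) (6 * k + 2 * d + 2 * e) :=
    (hc.word (k + 2 * d) hy (by omega)).cast (by omega)
  have h1 : P.Eqv k.bodd 0 (2 * (k + (d + e - j))) (bx k (P.Z (GJS.mulTangle P k d e j hj x y)))
      (nestCups P.V 0 k ++ X.map (Step.shift k) ++ Y.map (Step.shift (k + 2 * d)) ++
        nestCaps P.V (k + 2 * d) j ++ nestCaps P.V (3 * k + 2 * d + 2 * e - 2 * j) k ++
        nestCaps P.V (3 * k + 2 * d + 2 * e - 2 * j) k) := by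
    have h0 := Eqv.box_Z (GJS.mulTangle P k d e j hj x y)
    rw [Col.size_ofNat, Col.shaded_ofNat] at h0
    have h0' := Eqv.rotL (k := k) (s := k.bodd) (by simpa using h0) (by omega)
    refine h0'.trans ?_
    have e : rotL k (2 * (k + (d + e - j))) (GJS.mulTangle P k d e j hj x y).word =
        nestCups P.V 0 k ++ X.map (Step.shift k) ++ Y.map (Step.shift (k + 2 * d)) ++
        nestCaps P.V (k + 2 * d) j ++ nestCaps P.V (3 * k + 2 * d + 2 * e - 2 * j) k ++
        nestCaps P.V (3 * k + 2 * d + 2 * e - 2 * j) k := by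
      simp only [rotL, GJS.mulTangle, List.map_append, List.append_assoc]
      rw [shift_nestCaps _ _ _ (by omega), shift_nestCaps _ _ _ (by omega),
        show 2 * d + 2 * e + 2 * k - 2 * j + k = 3 * k + 2 * d + 2 * e - 2 * j by omega,
        show k + 2 * (k + (d + e - j)) = 3 * k + 2 * d + 2 * e - 2 * j by omega]
      simp [hX, hY, Step.shift, Nat.add_comm]
    rw [← e]
    exact Eqv.refl h0'.right
  refine h1.trans ?_
  -- the maxima `2d + 2e + ⋯` are moved below the `j` maxima between the upper strings
  have e1 : ∀ w : ℕ, 4 * k + 2 * d + 2 * e ≤ w → P.Eqv k.bodd w (w - 2 * j - 2 * k)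
      (nestCaps P.V (k + 2 * d) j ++ nestCaps P.V (3 * k + 2 * d + 2 * e - 2 * j) k)
      (nestCaps P.V (3 * k + 2 * d + 2 * e) k ++ nestCaps P.V (k + 2 * d) j) := fun w hw =>
    Eqv.caps_caps (by omega) (by omega) (by omega) (by omega) (by omega)
  have e2 : P.Eqv k.bodd (6 * k + 2 * d + 2 * e) (2 * k + 2 * d + 2 * e)
      (nestCaps P.V (3 * k + 2 * d + 2 * e) k ++ nestCaps P.V (3 * k + 2 * d + 2 * e) k)
      (nestCaps P.V (5 * k + 2 * d + 2 * e) k ++ nestCaps P.V (3 * k + 2 * d + 2 * e) k) :=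
    Eqv.caps_caps (by omega) (by omega) (by omega) (by omega) (by omega)
  have e3 : P.Eqv k.bodd (4 * k + 2 * d) (4 * k + 2 * d + 2 * e)
      (Y.map (Step.shift (k + 2 * d)) ++ nestCaps P.V (5 * k + 2 * d + 2 * e) k)
      (nestCaps P.V (3 * k + 2 * d) k ++ Y.map (Step.shift (k + 2 * d))) :=
    Eqv.word_caps hy (by omega) (by omega) (by omega) (by omega)
  have e4 : P.Eqv k.bodd (2 * (k + d)) (2 * k + 2 * d + 2 * e)
      ((bx k y).map (Step.shift (2 * (k + d))) ++ nestCaps P.V (2 * (k + d)) k)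
      (Y.map (Step.shift (k + 2 * d)) ++ nestCaps P.V (3 * k + 2 * d + 2 * e) k) :=
    rotL_caps hy (by omega) (by omega) (by omega) (by omega) (by omega)
  have hj' : Admissible k.bodd (2 * k + 2 * d + 2 * e) (nestCaps P.V (k + 2 * d) j)
      (2 * (k + (d + e - j))) :=
    (admissible_nestCaps _ _ _ j (by omega) (by omega)).cast (by omega)
  refine ((e1 _ (by omega)).inside _ (nestCaps P.V (3 * k + 2 * d + 2 * e - 2 * j) k) hcy
    ((admissible_nestCaps _ _ _ k (by omega) (by omega)).cast (by omega)) (by simp) rfl).trans ?_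
  refine ((e1 (4 * k + 2 * d + 2 * e) (by omega)).inside (nestCups P.V 0 k ++
    X.map (Step.shift k) ++ Y.map (Step.shift (k + 2 * d)) ++
    nestCaps P.V (3 * k + 2 * d + 2 * e) k) []
    ((hcy.caps _ k (by omega) (by omega)).cast (by omega))
    (show _ = _ by omega) (by simp) rfl).trans ?_
  refine (e2.inside _ (nestCaps P.V (k + 2 * d) j) hcy hj' (by simp) rfl).trans ?_
  refine (e3.inside _ (nestCaps P.V (3 * k + 2 * d + 2 * e) k ++ nestCaps P.V (k + 2 * d) j) hc
    (admissible_append _ _ _ ((admissible_nestCaps _ _ _ k (by omega) (by omega)).cast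
      (by omega)) hj') (by simp) rfl).trans ?_
  refine (e4.inside (bx k x) (nestCaps P.V (k + 2 * d) j) (admissible_bx x (by omega)) hj'
    ?_ ?_).symm
  · rw [con, nestCaps_add, show 2 * (k + d) - k = k + 2 * d by omega]
    simp
  · simp only [bx, rotL, ← hX, show k + 2 * (k + d) = 3 * k + 2 * d by omega, List.append_assoc]

theorem bx_rotTangle {k d : ℕ} (x : P.V (Col.ofNat (k + d))) :
    P.Eqv k.bodd 0 (2 * (k + d)) (bx k (P.Z (GJS.rotTangle P k d x)))
      (rotR k [ins 0 (box _ x)]) := by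
  have h : Admissible k.bodd 0 (rotR k [ins 0 (box (Col.ofNat (k + d)) x)]) (2 * (k + d)) :=
    admissible_rotR (by simpa using admissible_box x) (by omega)
  have h1 := bx_val_rotR h (by omega)
  rw [← P.val_eq (GJS.rotTangle P k d x)]
  have e : (GJS.rotTangle P k d x).word = rotR k (rotR k [ins 0 (box (Col.ofNat (k + d)) x)]) := by
    simp only [GJS.rotTangle, rotR, List.map_append, map_shift_shift, List.append_assoc]
    rw [shift_nestCaps _ _ _ le_rfl, shift_nestCups, two_mul, nestCups_add, nestCaps_add]
    simp [Step.shift]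
  rw [e]; exact h1

theorem mirror_bx {k n : ℕ} (x : P.V (Col.ofNat n)) :
    mirror (fun d x => P.st d x) 0 (bx k x) = rotR k [ins 0 (box _ (P.st _ x))] := by
  rw [bx, mirror_rotL _ (s := k.bodd) (by simpa using admissible_box x)]
  rfl

theorem bx_oneTangle (k : ℕ) :
    P.Eqv k.bodd 0 (2 * k) (bx k (P.Z (GJS.oneTangle P k))) (nestCups P.V 0 k) := by
  have h0 := Eqv.box_Z (GJS.oneTangle P k)
  rw [Col.size_ofNat, Col.shaded_ofNat] at h0
  refine (Eqv.rotL (k := k) (s := k.bodd) (by simpa using h0) (by omega)).trans ?_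
  have e : P.Eqv k.bodd (2 * k) (2 * k) (nestCups P.V k k ++ nestCaps P.V (3 * k) k) [] :=
    Eqv.zigzag_left (by omega) (by omega)
  refine e.inside (nestCups P.V 0 k) [] (admissible_nestCups_self _ k) rfl ?_ (by simp)
  simp only [rotL, GJS.oneTangle, shift_nestCups]
  rw [show k + 2 * k = 3 * k by omega]; simp

end StarPlanarAlgebra

/-! ### Closed diagrams and the traces -/

namespace StarPlanarAlgebra
variable {P : StarPlanarAlgebra.{u}} {s : Bool} {l l' m : List (Step P.V)}

/-- The number given by a closed diagram with outer region of shading `s`. -/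
def closedVal (P : StarPlanarAlgebra.{u}) (s : Bool) (l : List (Step P.V)) : ℂ :=
  P.scalar s (P.val (Col.zero s) l)

theorem Eqv.closedVal (h : P.Eqv s 0 0 l l') : P.closedVal s l = P.closedVal s l' :=
  congrArg (P.scalar s) (Eqv.val_eq_val (c := Col.zero s) h)

/-- The conditions under which the traces and the inner products of `F_k` may be computed from
turned boxes. For `k = 0` nothing is to be shown; for `k = 1` this is sphericality. -/
structure TurnInvariant (P : StarPlanarAlgebra.{u}) (k : ℕ) : Prop where
  trace : ∀ x : P.V (Col.ofNat k), P.closedVal false ([ins 0 (box _ x)] ++ nestCaps P.V k k) =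
    P.closedVal k.bodd (bx k x ++ nestCaps P.V k k)
  pairing : ∀ {n : ℕ}, k ≤ n → ∀ x y : P.V (Col.ofNat n),
    P.closedVal k.bodd (con (2 * n) (2 * n) (rotR k [ins 0 (box _ x)]) (bx k y)) =
      P.closedVal false (con (2 * n) (2 * n) [ins 0 (box _ x)] [ins 0 (box _ y)])

theorem turnInvariant_zero (P : StarPlanarAlgebra.{u}) : P.TurnInvariant 0 where
  trace x := by simp [bx, rotL, Step.shift]
  pairing _ x y := by simp [bx, rotL, rotR, Step.shift]

/-- The string that joins the first point of `x` to the last point of `y` may be led around the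
sphere: the two diagrams are the closures to the left and to the right of a `1`-box. -/
theorem closedVal_con_rotR_bx {δ : ℝ} (hP : P.IsSubfactor δ) {n : ℕ} (hn : 1 ≤ n)
    (x y : P.V (Col.ofNat n)) :
    P.closedVal true (con (2 * n) (2 * n) (rotR 1 [ins 0 (box _ x)]) (bx 1 y)) =
      P.closedVal false (con (2 * n) (2 * n) [ins 0 (box _ x)] [ins 0 (box _ y)]) := by
  set X : List (Step P.V) := [ins 0 (box _ x)] with hX
  set Y : List (Step P.V) := [ins 0 (box _ y)] with hY
  obtain ⟨a, ha⟩ : ∃ a, 2 * n = a + 1 := ⟨2 * n - 1, by omega⟩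
  have hodd : a.bodd = true := by
    have : (2 * n).bodd = false := by simp
    rw [ha] at this; simpa using this
  have hx : Admissible false 0 X (2 * n) := admissible_box x
  have hy : Admissible false 0 Y (2 * n) := admissible_box y
  have hW : Admissible false 0 (con (2 * n) a X Y) (2 * 1) :=
    admissible_con hx hy (by omega) (by omega) (by omega)
  have hbox := box_eqv hW
  set z := P.val (Col.ofNat 1) (con (2 * n) a X Y) with hz
  have hr : P.closedVal false (con (2 * n) (2 * n) X Y) =
      P.scalar false (P.Z (P.rightClosure z)) := by
    have h1 : P.Eqv false 0 0 ([ins 0 (box _ z)] ++ [cap 0]) (con (2 * n) a X Y ++ [cap 0]) :=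
      hbox.append_right (by simp [Admissible])
    have h2 : con (2 * n) a X Y ++ [cap 0] = con (2 * n) (2 * n) X Y := by
      rw [con, con, ha, nestCaps_add, nestCaps_one]; simp
    rw [← h2, ← h1.closedVal]
    exact congrArg _ (P.val_eq (P.rightClosure z))
  have hl : P.closedVal true (con (2 * n) (2 * n) (rotR 1 X) (bx 1 y)) =
      P.scalar true (P.Z (P.leftClosure z)) := by
    have h1 : P.Eqv true 0 0 [ins 0 arc, ins 1 (box _ z), cap 0, cap 0]
        (nestCups P.V 0 1 ++ X.map (Step.shift 1) ++ Y.map (Step.shift (2 * n + 1)) ++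
          nestCaps P.V (a + 2) a ++ nestCaps P.V 1 1 ++ nestCaps P.V 1 1) := by
      refine hbox.step 1 1 [ins 0 arc] [cap 0, cap 0] rfl ?_ rfl
        (by simp [Admissible, Fits, legs]) (by simp [Admissible])
      simp only [con, List.map_append, map_shift_shift]
      rw [shift_nestCaps _ _ _ (by omega), show 2 * n + 1 = a + 2 by omega]
      simp
    have hxs : Admissible true 0 (nestCups P.V 0 1 ++ X.map (Step.shift 1)) (a + 3) :=
      ((admissible_nestCups_self _ 1).word 1 (by simpa using hx) (by omega)).cast (by omega)
    have hys : Admissible (Bool.xor true (2 * n + 1).bodd) 0 Y (2 * n) := by simpa using hy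
    have e1 : P.Eqv true (2 * a + 4) 2 (nestCaps P.V 1 1 ++ nestCaps P.V a a)
        (nestCaps P.V (a + 2) a ++ nestCaps P.V 1 1) :=
      Eqv.caps_caps (by omega) (by omega) (by omega) (by omega) (by omega)
    have e2 : P.Eqv true (a + 3) (2 * a + 2) (nestCaps P.V 1 1 ++ Y.map (Step.shift a))
        (Y.map (Step.shift (2 * n + 1)) ++ nestCaps P.V 1 1) :=
      Eqv.caps_word hys (by omega) (by omega) (by omega) (by omega) (by omega)
    have e3 : P.Eqv true (2 * a + 2) 0 (nestCaps P.V a a ++ nestCaps P.V 1 1)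
        (nestCaps P.V (2 * a + 1) 1 ++ nestCaps P.V a a) :=
      Eqv.caps_caps (by omega) (by omega) (by omega) (by omega) (by omega)
    have e4 : P.Eqv true (a + 1) (2 * a)
        ((bx 1 y).map (Step.shift (2 * n)) ++ nestCaps P.V (2 * n) 1)
        (Y.map (Step.shift a) ++ nestCaps P.V (2 * a + 1) 1) :=
      rotL_caps (by rw [hodd]; simpa using hy) (by omega) (by omega) (by omega) (by omega)
        (by omega)
    have hc1 : Admissible true 2 (nestCaps P.V 1 1) 0 := admissible_nestCaps_self true 1
    have hr1 : Admissible true 0 (rotR 1 X) (a + 1) :=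
      (admissible_rotR (by simpa using hx) (by omega)).cast ha
    have hYa : Admissible true (a + 1) (Y.map (Step.shift a)) (2 * a + 2) :=
      (Admissible.at (by rw [hodd]; simpa using hy) (by omega)).cast (by omega)
    have hcaps : nestCaps P.V (2 * n) (2 * n) = nestCaps P.V (2 * n) 1 ++ nestCaps P.V a a := by
      have := nestCaps_add (V := P.V) (2 * n) 1 a
      rwa [show 1 + a = 2 * n by omega, show 2 * n - 1 = a by omega] at this
    have h2 := h1.trans <|
      (e1.symm.inside (nestCups P.V 0 1 ++ X.map (Step.shift 1) ++ Y.map (Step.shift (2 * n + 1)))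
        (nestCaps P.V 1 1) ((hxs.word _ hys (by omega)).cast (by omega)) hc1 (by simp) rfl).trans <|
      (e2.symm.inside (nestCups P.V 0 1 ++ X.map (Step.shift 1))
        (nestCaps P.V a a ++ nestCaps P.V 1 1) hxs e3.left (by simp) rfl).trans <|
      (e3.inside (rotR 1 X ++ Y.map (Step.shift a)) [] (admissible_append _ _ _ hr1 hYa) rfl
        (by simp [rotR]) rfl).trans <|
      (e4.symm.inside (rotR 1 X) (nestCaps P.V a a) hr1 (admissible_nestCaps_self _ a)
        (by simp) (l' := con (2 * n) (2 * n) (rotR 1 X) (bx 1 y)) (by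
          rw [con, hcaps]; simp))
    rw [← h2.closedVal]
    exact congrArg _ (P.val_eq (P.leftClosure z))
  rw [hl, hr]
  exact (hP.spherical z).symm

theorem IsSubfactor.turnInvariant_one {δ : ℝ} (hP : P.IsSubfactor δ) : P.TurnInvariant 1 where
  trace x := by
    have h1 : P.closedVal false ([ins 0 (box _ x)] ++ nestCaps P.V 1 1) =
        P.scalar false (P.Z (P.rightClosure x)) := congrArg _ (P.val_eq (P.rightClosure x))
    rw [h1, hP.spherical x]
    refine (congrArg _ (P.val_eq (P.leftClosure x))).symm.trans ?_
    have e : P.Eqv true 4 0 (nestCaps P.V 1 1 ++ nestCaps P.V 1 1)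
        (nestCaps P.V 3 1 ++ nestCaps P.V 1 1) :=
      Eqv.caps_caps (by omega) (by omega) (by omega) (by omega) (by omega)
    have h2 := e.inside (nestCups P.V 0 1 ++ [ins 0 (box (Col.ofNat 1) x)].map (Step.shift 1)) []
      ((admissible_nestCups_self true 1).word 1 (by simpa using admissible_box x) (by omega)) rfl
      rfl rfl
    exact (h2.closedVal).trans (by simp [bx, rotL])
  pairing hn x y := closedVal_con_rotR_bx hP hn x y

theorem one_eq_zero_imp (h : P.one s = 0) (x : P.V (Col.zero s)) : x = 0 := by
  have h0 : Admissible s 0 [ins 0 (box (Col.zero s) x)] 0 := by simp [Admissible, Fits, legs]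
  have hT : Admissible s 0 [ins 0 (box (Col.zero s) (P.one s)), ins 0 (box (Col.zero s) x)] 0 := by
    simp [Admissible, Fits, legs]
  have h1 : P.Z (c := Col.zero s) ⟨_, hT⟩ = P.Z (c := Col.zero s) ⟨_, h0⟩ :=
    P.Z_subst [] [ins 0 (box (Col.zero s) x)] 0 (Tangle.empty P.V s) _ _ rfl rfl
  have h2 : P.Z (c := Col.zero s) ⟨_, hT⟩ = (0 : ℂ) • P.Z (c := Col.zero s) ⟨_, hT⟩ :=
    P.Z_smul [] [ins 0 (box (Col.zero s) x)] 0 0 (P.one s) _ _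
      (by rw [h, smul_zero]; rfl) rfl
  rw [zero_smul, h1] at h2
  rw [← P.Z_ident x]
  exact h2

theorem scalar_one_of_ne_zero (h : P.one s ≠ 0) : P.scalar s (P.one s) = 1 := by
  refine Classical.epsilon_spec (p := fun φ : P.V (Col.zero s) →ₗ[ℂ] ℂ => φ (P.one s) = 1) ?_
  by_contra! hc
  refine h ((Module.forall_dual_apply_eq_zero_iff ℂ _).1 fun φ => ?_)
  by_contra hφ
  exact hc ((φ (P.one s))⁻¹ • φ) (by simp [hφ])

namespace IsSubfactor
variable {δ : ℝ} (hP : P.IsSubfactor δ)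
include hP

theorem one_ne_zero (s : Bool) : P.one s ≠ 0 := fun h => by
  have h1 := hP.connected s
  have : Subsingleton (P.V (Col.zero s)) :=
    ⟨fun x y => by rw [one_eq_zero_imp h x, one_eq_zero_imp h y]⟩
  rw [Module.finrank_zero_of_subsingleton] at h1
  exact absurd h1 (by simp)

theorem scalar_one (s : Bool) : P.scalar s (P.one s) = 1 := scalar_one_of_ne_zero (hP.one_ne_zero s)

theorem scalar_smul_one (x : P.V (Col.zero s)) : P.scalar s x • P.one s = x := by
  obtain ⟨a, rfl⟩ := (finrank_eq_one_iff_of_nonzero' _ (hP.one_ne_zero s)).1 (hP.connected s) x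
  rw [map_smul, hP.scalar_one, smul_eq_mul, mul_one]

theorem scalar_st (x : P.V (Col.zero s)) : P.scalar s (P.st _ x) = conj (P.scalar s x) := by
  have h1 : P.st _ (P.one s) = P.one s := by
    rw [one, ← P.Z_adjoint]; rfl
  conv_lhs => rw [← hP.scalar_smul_one x]
  rw [map_smulₛₗ, h1, map_smul, hP.scalar_one, smul_eq_mul, mul_one]

theorem closedVal_mirror (h : Admissible s 0 l 0) :
    P.closedVal s (mirror (fun d x => P.st d x) 0 l) = conj (P.closedVal s l) := by
  rw [closedVal, val_mirror (c := Col.zero s) h, hP.scalar_st]; rfl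

theorem closedVal_nil (s : Bool) : P.closedVal s [] = 1 := by
  rw [← hP.scalar_one s]
  exact congrArg _ (P.val_eq (Tangle.empty P.V s))

theorem val_loop {c : Col} {l₁ l₂ : List (Step P.V)} {w p : ℕ} (h₁ : Admissible c.shaded 0 l₁ w)
    (h₂ : Admissible c.shaded w l₂ (2 * c.size)) (hp : p ≤ w) :
    P.val c (l₁ ++ [ins p arc, cap p] ++ l₂) = (δ : ℂ) • P.val c (l₁ ++ l₂) := by
  have h0 : Admissible c.shaded w ([ins p arc, cap p] : List (Step P.V)) w :=
    ⟨hp, trivial, by simp only [legs]; omega, by simp [Admissible, legs]⟩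
  rw [P.val_of_admissible (admissible_append _ _ _ (admissible_append _ _ _ h₁ h0) h₂),
    P.val_of_admissible (admissible_append _ _ _ h₁ h₂)]
  exact hP.modulus l₁ l₂ p _ _ rfl rfl

theorem closedVal_loops (s : Bool) (k : ℕ) :
    P.closedVal s (nestCups P.V 0 k ++ nestCaps P.V k k) = (δ : ℂ) ^ k := by
  induction k with
  | zero => simpa using hP.closedVal_nil s
  | succ k ih =>
    have h := hP.val_loop (c := Col.zero s) (l₁ := nestCups P.V 0 k) (l₂ := nestCaps P.V k k)
      (w := 2 * k) (p := k) (admissible_nestCups_self _ k) (admissible_nestCaps_self _ k) (by omega)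
    have e : nestCups P.V 0 (k + 1) ++ nestCaps P.V (k + 1) (k + 1) =
        nestCups P.V 0 k ++ [ins k arc, cap k] ++ nestCaps P.V k k := by
      rw [nestCups_add, Nat.add_comm k 1, nestCaps_add]
      simp
    rw [e, closedVal, h, map_smul, ← closedVal, ih, smul_eq_mul, pow_succ']

end IsSubfactor

theorem tau_eq (δ : ℝ) {n : ℕ} (x : P.V (Col.ofNat n)) :
    P.tau δ x = ((δ : ℂ) ^ n)⁻¹ * P.closedVal false ([ins 0 (box _ x)] ++ nestCaps P.V n n) := by
  rw [tau, closedVal, ← P.val_eq]; rfl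

theorem tau_mul_eq (δ : ℝ) {n : ℕ} (x y : P.V (Col.ofNat n)) :
    P.tau δ (P.mul x y) = ((δ : ℂ) ^ n)⁻¹ *
      P.closedVal false (con (2 * n) (2 * n) [ins 0 (box _ x)] [ins 0 (box _ y)]) := by
  rw [tau_eq]
  congr 1
  have h := Eqv.box_Z (P.mulTangle x y)
  rw [Col.size_ofNat, Col.shaded_ofNat] at h
  rw [mul, (h.append_right ((admissible_nestCaps_self _ n))).closedVal]
  congr 1
  simp only [con, mulTangle]
  rw [two_mul, nestCaps_add, Nat.add_sub_cancel]
  simp [Step.shift]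

end StarPlanarAlgebra

/-! ### The algebras `F_k(P)` as systems of contractions -/

theorem toModule_flip_lof_lof {V W : ℕ → Type*} {N : Type*} [∀ d, AddCommGroup (V d)]
    [∀ d, Module ℂ (V d)] [∀ d, AddCommGroup (W d)] [∀ d, Module ℂ (W d)] [AddCommGroup N]
    [Module ℂ N] (f : ∀ d e, V d →ₗ[ℂ] W e →ₗ[ℂ] N) {d e : ℕ} (x : V d) (y : W e) :
    DirectSum.toModule ℂ ℕ ((⨁ e, W e) →ₗ[ℂ] N)
      (fun d => (DirectSum.toModule ℂ ℕ (V d →ₗ[ℂ] N) fun e => (f d e).flip).flip)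
      (DirectSum.lof ℂ ℕ V d x) (DirectSum.lof ℂ ℕ W e y) = f d e x y := by
  rw [DirectSum.toModule_lof, LinearMap.flip_apply, DirectSum.toModule_lof, LinearMap.flip_apply]

namespace StarPlanarAlgebra
namespace GJS
variable (P : StarPlanarAlgebra.{u}) (k : ℕ)

/-- The component of the product of `P_{k + d}` and `P_{k + e}` in which `j` strings at the top are
joined, and zero if there are fewer than `j` strings. -/
def contractHom (d e j : ℕ) : P.V (Col.ofNat (k + d)) →ₗ[ℂ] P.V (Col.ofNat (k + e)) →ₗ[ℂ] P.GJS k :=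
  if hj : j ≤ 2 * min d e then
    LinearMap.mk₂ ℂ
      (fun x y => of P k (d + e - j) (P.Z (mulTangle P k d e j hj x y)))
      (fun x x' y => by
        rw [← map_add]
        exact congrArg _ (P.Z_add [] _ 0 x x' _ _ _ rfl rfl rfl))
      (fun a x y => by
        rw [← map_smul]
        exact congrArg _ (P.Z_smul [] _ 0 a x _ _ rfl rfl))
      (fun x y y' => by
        rw [← map_add]
        exact congrArg _ (P.Z_add [ins 0 (box _ x)] _ _ y y' _ _ _ rfl rfl rfl))
      (fun a x y => by
        rw [← map_smul]
        exact congrArg _ (P.Z_smul [ins 0 (box _ x)] _ _ a y _ _ rfl rfl))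
  else 0

/-- The operation on `F_k(P)` that joins the last `j` strings at the top of the first factor to the
first `j` strings at the top of the second one. -/
def contract (j : ℕ) : P.GJS k →ₗ[ℂ] P.GJS k →ₗ[ℂ] P.GJS k :=
  DirectSum.toModule ℂ ℕ (P.GJS k →ₗ[ℂ] P.GJS k) fun d =>
    (DirectSum.toModule ℂ ℕ (P.V (Col.ofNat (k + d)) →ₗ[ℂ] P.GJS k) fun e =>
      (contractHom P k d e j).flip).flip

theorem tau_zero {P : StarPlanarAlgebra.{u}} (δ : ℝ) {n : ℕ} :
    P.tau δ (0 : P.V (Col.ofNat n)) = 0 := by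
  have h := scalar_trace_smul P (n := n) 0 0
  rw [smul_zero, zero_smul] at h
  rw [tau, h, map_zero, mul_zero]

variable {P k} {d e j : ℕ}

theorem induction_on {p : P.GJS k → Prop} (h : ∀ d x, p (of P k d x))
    (hadd : ∀ a b, p a → p b → p (a + b)) (a : P.GJS k) : p a :=
  DirectSum.induction_on (motive := p) a (by
    have h0 := h 0 0
    rw [map_zero] at h0
    exact h0) h hadd

theorem mul_eq_mulMap (a b : P.GJS k) : a * b = mulMap P k a b := rfl

theorem contract_of_of (x : P.V (Col.ofNat (k + d))) (y : P.V (Col.ofNat (k + e))) :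
    contract P k j (of P k d x) (of P k e y) = contractHom P k d e j x y :=
  toModule_flip_lof_lof (fun d e => contractHom P k d e j) x y

theorem contract_of (hj : j ≤ 2 * min d e) (x : P.V (Col.ofNat (k + d)))
    (y : P.V (Col.ofNat (k + e))) : contract P k j (of P k d x) (of P k e y) =
      of P k (d + e - j) (P.Z (mulTangle P k d e j hj x y)) := by
  rw [contract_of_of, contractHom, dif_pos hj]; rfl

theorem contract_of_eq_zero (hj : 2 * d < j ∨ 2 * e < j) (x : P.V (Col.ofNat (k + d)))
    (y : P.V (Col.ofNat (k + e))) : contract P k j (of P k d x) (of P k e y) = 0 := by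
  rw [contract_of_of, contractHom, dif_neg (by omega)]; rfl

theorem of_mul_of (x : P.V (Col.ofNat (k + d))) (y : P.V (Col.ofNat (k + e))) :
    of P k d x * of P k e y =
      ∑ j ∈ Finset.range (2 * min d e + 1), contract P k j (of P k d x) (of P k e y) := by
  have h : of P k d x * of P k e y = mulHom P k d e x y :=
    toModule_flip_lof_lof (fun d e => mulHom P k d e) x y
  rw [h, mulHom, ← Fin.sum_univ_eq_sum_range
    (fun j => contract P k j (of P k d x) (of P k e y)), LinearMap.sum_apply, LinearMap.sum_apply]
  refine Finset.sum_congr rfl fun j _ => ?_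
  rw [contract_of (Nat.le_of_lt_succ j.2)]; rfl

theorem star_of (x : P.V (Col.ofNat (k + d))) :
    star (of P k d x) = of P k d (P.Z (rotTangle P k d (P.st _ x))) :=
  DFinsupp.mapRange_single

variable (P k) in
/-- The involution as a conjugate-linear map. -/
def starMap : P.GJS k →ₗ⋆[ℂ] P.GJS k where
  toFun a := star a
  map_add' a b := by
    refine DFinsupp.ext fun d => ?_
    change P.Z (rotTangle P k d (P.st _ (component P k d (a + b)))) =
      P.Z (rotTangle P k d (P.st _ (component P k d a))) +
      P.Z (rotTangle P k d (P.st _ (component P k d b)))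
    rw [map_add, map_add]
    exact P.Z_add (nestCups P.V 0 (2 * k)) (nestCaps P.V (2 * k) (2 * k)) (2 * k) _ _ _ _ _
      rfl rfl rfl
  map_smul' z a := by
    refine DFinsupp.ext fun d => ?_
    change P.Z (rotTangle P k d (P.st _ (component P k d (z • a)))) =
      conj z • P.Z (rotTangle P k d (P.st _ (component P k d a)))
    rw [map_smul, map_smulₛₗ]
    exact P.Z_smul (nestCups P.V 0 (2 * k)) (nestCaps P.V (2 * k) (2 * k)) (2 * k) _ _ _ _
      rfl rfl

theorem of_eq_of (h : d = e) {x : P.V (Col.ofNat (k + d))} {y : P.V (Col.ofNat (k + e))}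
    (hxy : P.Eqv k.bodd 0 (2 * (k + d)) (bx k x) (bx k y)) : of P k d x = of P k e y := by
  subst h
  rw [bx_injective (Nat.le_add_right k d) hxy]

theorem bx_star (x : P.V (Col.ofNat (k + d))) :
    P.Eqv k.bodd 0 (2 * (k + d)) (bx k (P.Z (rotTangle P k d (P.st _ x))))
      (mirror (fun d x => P.st d x) 0 (bx k x)) := by
  rw [mirror_bx]; exact bx_rotTangle _

theorem trace_of_same (δ : ℝ) (x : P.V (Col.ofNat (k + 0))) :
    trace P k δ (of P k 0 x) = P.tau δ x := by
  have h : component P k 0 (of P k 0 x) = x := DirectSum.component.lof_self ℂ _ _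
  change P.tau δ (component P k 0 (of P k 0 x)) = _
  rw [h]

theorem trace_of_zero (δ : ℝ) (hd : d = 0) (x : P.V (Col.ofNat (k + d))) :
    trace P k δ (of P k d x) =
      ((δ : ℂ) ^ k)⁻¹ * P.closedVal false ([ins 0 (box _ x)] ++ nestCaps P.V k k) := by
  subst hd
  rw [trace_of_same, tau_eq]; rfl

theorem trace_of (δ : ℝ) (hk : P.TurnInvariant k) (hd : d = 0) (x : P.V (Col.ofNat (k + d))) :
    trace P k δ (of P k d x) =
      ((δ : ℂ) ^ k)⁻¹ * P.closedVal k.bodd (bx k x ++ nestCaps P.V k k) := by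
  rw [trace_of_zero δ hd]
  subst hd
  congr 1
  exact hk.trace x

theorem trace_of_ne (δ : ℝ) (hd : d ≠ 0) (x : P.V (Col.ofNat (k + d))) :
    trace P k δ (of P k d x) = 0 := by
  have h : component P k 0 (of P k d x) = 0 := by
    simp only [component, of]
    erw [DirectSum.component.of, dif_neg hd]
  change P.tau δ (component P k 0 (of P k d x)) = 0
  rw [h]; exact tau_zero δ

/-- The trace of a product pairs all strings of the factors. -/
theorem trace_contract (δ : ℝ) (hk : P.TurnInvariant k) (x y : P.V (Col.ofNat (k + d))) :
    trace P k δ (contract P k (2 * d) (of P k d x) (of P k d y)) = ((δ : ℂ) ^ k)⁻¹ *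
      P.closedVal k.bodd (con (2 * (k + d)) (2 * (k + d)) (bx k x) (bx k y)) := by
  have hj : 2 * d ≤ 2 * min d d := by simp
  rw [contract_of hj, trace_of δ hk (by omega)]
  congr 1
  have h := bx_mulTangle hj x y
  rw [(h.append_right (m := nestCaps P.V k k) (w₀ := 0)
    ((admissible_nestCaps _ _ k k (by omega) (by omega)).cast (by omega))).closedVal]
  congr 1
  have := nestCaps_add (V := P.V) (2 * (k + d)) (k + 2 * d) k
  rw [show k + 2 * d + k = 2 * (k + d) by omega,
    show 2 * (k + d) - (k + 2 * d) = k by omega] at this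
  simp [con, this]

theorem trace_contract_star {δ : ℝ} (hδ : 0 < δ) (hk : P.TurnInvariant k)
    (x y : P.V (Col.ofNat (k + d))) :
    trace P k δ (contract P k (2 * d) (star (of P k d x)) (of P k d y)) =
      (δ : ℂ) ^ d * P.tau δ (P.mul (P.st _ x) y) := by
  have h : P.Eqv k.bodd 0 0 (con (2 * (k + d)) (2 * (k + d))
      (bx k (P.Z (rotTangle P k d (P.st _ x)))) (bx k y))
      (con (2 * (k + d)) (2 * (k + d)) (rotR k [ins 0 (box _ (P.st _ x))]) (bx k y)) :=
    (bx_rotTangle _).con (Eqv.refl (admissible_bx y (by omega))) le_rfl le_rfl (by omega)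
  have hδ' : (δ : ℂ) ≠ 0 := by exact_mod_cast hδ.ne'
  rw [star_of, trace_contract δ hk, h.closedVal, hk.pairing (by omega), tau_mul_eq, pow_add]
  field_simp

variable (P k) in
/-- The contractions of `F_k(P)`. -/
def contractionSystem {δ : ℝ} (hδ : 0 < δ) (hP : P.IsSubfactor δ) (hk : P.TurnInvariant k) :
    ContractionSystem (P.GJS k) (trace P k δ) where
  deg d := LinearMap.range (of P k d)
  op := contract P k
  mulL := mulMap P k
  starL := starMap P k
  iSup_deg := by
    refine eq_top_iff.2 fun a _ => ?_
    induction a using GJS.induction_on with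
    | h d x => exact Submodule.mem_iSup_of_mem d ⟨x, rfl⟩
    | hadd a b ha hb => exact add_mem (ha trivial) (hb trivial)
  finite d := by
    have := hP.finite_dimensional (Col.ofNat (k + d))
    infer_instance
  mul_def a b := rfl
  star_def a := rfl
  op_mem := by
    rintro d e j _ _ ⟨x, rfl⟩ ⟨y, rfl⟩
    by_cases hj : j ≤ 2 * min d e
    · rw [contract_of hj]; exact ⟨_, rfl⟩
    · rw [contract_of_eq_zero (by omega)]; exact zero_mem _
  op_eq_zero := by
    rintro d e j _ _ ⟨x, rfl⟩ ⟨y, rfl⟩ hj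
    exact contract_of_eq_zero hj x y
  mul_eq_sum := by
    rintro d e _ _ ⟨x, rfl⟩ ⟨y, rfl⟩
    exact of_mul_of x y
  assoc_of_le := by
    rintro d e f i j _ _ _ ⟨x, rfl⟩ ⟨y, rfl⟩ ⟨z, rfl⟩ hi hj hij
    rw [contract_of (show i ≤ 2 * min d e by omega), contract_of (show j ≤ 2 * min e f by omega),
      contract_of (by omega), contract_of (by omega)]
    refine of_eq_of (by omega) ?_
    have hx := admissible_bx x (Nat.le_add_right k d)
    have hy := admissible_bx y (Nat.le_add_right k e)
    have hz := admissible_bx z (Nat.le_add_right k f)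
    refine (bx_mulTangle _ _ _).trans ?_
    refine (((bx_mulTangle _ x y).con (Eqv.refl hz) (by omega) (by omega) (by omega)).trans
      (con_con_of_le hx hy hz (by omega) (by omega) (by omega) (by omega) (by omega))).trans ?_
    have h1 := (Eqv.refl hx).con (bx_mulTangle (show j ≤ 2 * min e f by omega) y z) (J := k + i)
      (K := 2 * (k + (d + e - i + f - j))) (by omega) (by omega) (by omega)
    refine h1.symm.trans ?_
    exact (bx_mulTangle (show i ≤ 2 * min d (e + f - j) by omega) x
      (P.Z (mulTangle P k e f j (by omega) y z))).symm.cast (by omega)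
  assoc_of_eq := by
    rintro d e f i j g _ _ _ ⟨x, rfl⟩ ⟨y, rfl⟩ ⟨z, rfl⟩ hi hj hij
    rw [contract_of (show i ≤ 2 * min d e by omega), contract_of (show j ≤ 2 * min e f by omega),
      contract_of (by omega), contract_of (by omega)]
    refine of_eq_of (by omega) ?_
    have hx := admissible_bx x (Nat.le_add_right k d)
    have hy := admissible_bx y (Nat.le_add_right k e)
    have hz := admissible_bx z (Nat.le_add_right k f)
    refine (bx_mulTangle _ _ _).trans ?_
    refine ((bx_mulTangle _ x y).con (Eqv.refl hz) (by omega) (by omega) (by omega)).trans ?_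
    have h0 := con_con_of_eq (P := P) (I := k + i) (J := k + j) (g := g)
      (A := 2 * (k + (d + e - i))) (B := 2 * (k + (d + e - i + f - (j + g)))) hx hy hz
      (by omega) (by omega) (by omega) (by omega) (by omega)
    rw [Nat.add_assoc k j g, Nat.add_assoc k i g] at h0
    refine h0.trans ?_
    have h1 := (Eqv.refl hx).con (bx_mulTangle (show j ≤ 2 * min e f by omega) y z)
      (J := k + (i + g)) (K := 2 * (k + (d + e - i + f - (j + g)))) (by omega) (by omega) (by omega)
    refine h1.symm.trans ?_
    exact (bx_mulTangle (show i + g ≤ 2 * min d (e + f - j) by omega) x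
      (P.Z (mulTangle P k e f j (by omega) y z))).symm.cast (by omega)
  one_mem := ⟨_, rfl⟩
  one_op := by
    rintro d _ ⟨x, rfl⟩
    change contract P k 0 (of P k 0 _) _ = _
    rw [contract_of (Nat.zero_le _)]
    refine of_eq_of (by omega) ((bx_mulTangle _ _ _).trans ?_)
    have hx := admissible_bx x (Nat.le_add_right k d)
    rw [show 0 + d - 0 = d by omega]
    exact ((bx_oneTangle k).con (Eqv.refl hx) (by omega) (by omega) (by omega)).trans
      (cups_con hx (by omega))
  op_one := by
    rintro d _ ⟨x, rfl⟩
    change contract P k 0 _ (of P k 0 _) = _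
    rw [contract_of (Nat.zero_le _)]
    refine of_eq_of (by omega) ((bx_mulTangle _ _ _).trans ?_)
    have hx := admissible_bx x (Nat.le_add_right k d)
    exact ((Eqv.refl hx).con (bx_oneTangle k) (by omega) (by omega) (by omega)).trans
      (con_cups hx (by omega))
  star_mem := by
    rintro d _ ⟨x, rfl⟩
    rw [star_of]; exact ⟨_, rfl⟩
  star_star := by
    rintro d _ ⟨x, rfl⟩
    rw [star_of, star_of]
    refine of_eq_of rfl ((bx_star _).trans (((bx_star x).mirror (by omega)).trans ?_))
    rw [mirror_mirror _ (fun c x => P.st_st c x) (admissible_bx x (by omega))]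
    exact Eqv.refl (admissible_bx x (by omega))
  star_op := by
    rintro d e j _ _ ⟨x, rfl⟩ ⟨y, rfl⟩ hd he
    rw [contract_of (by omega), star_of, star_of, star_of, contract_of (by omega)]
    refine of_eq_of (by omega) ((bx_star _).trans ?_)
    have hx := admissible_bx x (Nat.le_add_right k d)
    have hy := admissible_bx y (Nat.le_add_right k e)
    refine ((bx_mulTangle _ x y).mirror (by omega)).trans ?_
    refine (mirror_con_eqv hx hy (by omega) (by omega) (by omega)).trans ?_
    refine ((bx_star y).symm.con (bx_star x).symm (by omega) (by omega) (by omega)).trans ?_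
    exact (bx_mulTangle (show j ≤ 2 * min e d by omega) (P.Z (rotTangle P k e (P.st _ y)))
      (P.Z (rotTangle P k d (P.st _ x)))).symm.cast (by omega)
  trace_one := by
    change trace P k δ (of P k 0 _) = _
    rw [trace_of δ hk rfl, ((bx_oneTangle k).append_right (admissible_nestCaps_self _ k)).closedVal,
      hP.closedVal_loops, inv_mul_cancel₀]
    exact pow_ne_zero _ (by exact_mod_cast hδ.ne')
  trace_deg := by
    rintro d _ ⟨x, rfl⟩ hd
    exact trace_of_ne δ hd x
  trace_star := by
    rintro _ ⟨x, rfl⟩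
    have hx := admissible_bx x (Nat.le_add_right k 0)
    have hx' : Admissible k.bodd 0 (bx k x ++ nestCaps P.V k k) 0 :=
      admissible_append _ _ _ hx (admissible_nestCaps_self _ k)
    rw [star_of, trace_of δ hk rfl, trace_of δ hk rfl, map_mul, ← hP.closedVal_mirror hx',
      ((bx_star x).append_right (admissible_nestCaps_self _ k)).closedVal,
      mirror_append _ _ hx, mirror_nestCaps _ (by omega) (by omega)]
    congr 1
    · simp
    · congr 3; omega
  trace_op_comm := by
    rintro d _ _ ⟨x, rfl⟩ ⟨y, rfl⟩
    rw [trace_contract δ hk, trace_contract δ hk]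
    congr 1
    exact (con_comm (admissible_bx x (by omega)) (admissible_bx y (by omega))
      (dual_bx y (by omega))).closedVal
  trace_op_pos := by
    rintro d _ ⟨x, rfl⟩ hx
    rw [trace_contract_star hδ hk, ← Complex.ofReal_pow, Complex.re_ofReal_mul]
    refine mul_pos (pow_pos hδ d) (hP.positive _ x fun h => hx ?_)
    rw [h, map_zero]

end GJS
end StarPlanarAlgebra

/-! ### The inclusion of `F_0` into `F_1` and its adjoint -/

namespace StarPlanarAlgebra
variable {P : StarPlanarAlgebra.{u}}

theorem Eqv.box_Z_ofNat {n : ℕ} (T : Tangle P.V (Col.ofNat n)) :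
    P.Eqv false 0 (2 * n) [ins 0 (box _ (P.Z T))] T.word := by
  have h := Eqv.box_Z T
  rwa [Col.size_ofNat, Col.shaded_ofNat] at h

theorem eq_of_box_eqv {n : ℕ} {x y : P.V (Col.ofNat n)}
    (h : P.Eqv false 0 (2 * n) [ins 0 (box _ x)] [ins 0 (box _ y)]) : x = y := by
  rw [← val_box x, ← val_box y, h.val_ofNat]

namespace GJS
variable {d e j : ℕ}

theorem incl_of (x : P.V (Col.ofNat (0 + d))) :
    incl P 0 (of P 0 d x) = of P 1 d (P.Z (inclTangle P 0 d x)) :=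
  DirectSum.toModule_lof ℂ (M := fun d => P.V (Col.ofNat (0 + d))) d x

theorem exp_of (δ : ℝ) (x : P.V (Col.ofNat (1 + d))) :
    exp P 0 δ (of P 1 d x) = (δ : ℂ)⁻¹ • of P 0 d (P.Z (expTangle P 0 d x)) :=
  DirectSum.toModule_lof ℂ (M := fun d => P.V (Col.ofNat (1 + d))) d x

theorem inclTangle_word (x : P.V (Col.ofNat (0 + d))) :
    (inclTangle P 0 d x).word = [ins 0 (box _ x)] ++ nestCups P.V (2 * d) 1 := rfl

theorem expTangle_word (x : P.V (Col.ofNat (1 + d))) :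
    (expTangle P 0 d x).word = [ins 0 (box _ x)] ++ nestCaps P.V (2 * d + 1) 1 := rfl

/-- The string added below the product consists of the strings added below the two factors, joined
between the boxes. -/
theorem incl_contract (hj : j ≤ 2 * min d e) (x : P.V (Col.ofNat (0 + d)))
    (y : P.V (Col.ofNat (0 + e))) : incl P 0 (contract P 0 j (of P 0 d x) (of P 0 e y)) =
      contract P 1 j (incl P 0 (of P 0 d x)) (incl P 0 (of P 0 e y)) := by
  rw [contract_of hj, incl_of, incl_of, incl_of, contract_of hj]
  congr 1
  refine eq_of_box_eqv ((Eqv.box_Z_ofNat _).trans ((Eqv.box_Z_ofNat _).trans ?_).symm)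
  set X : List (Step P.V) := [ins 0 (box _ x)] with hX
  set Y : List (Step P.V) := [ins 0 (box _ y)] with hY
  have hx : Admissible false 0 X (2 * d) := (admissible_box x).cast (by omega)
  have hy : Admissible false 0 Y (2 * e) := (admissible_box y).cast (by omega)
  have hy' : Admissible (Bool.xor false (2 * d).bodd) 0 Y (2 * e) := by simpa using hy
  have hxy : Admissible false 0 (X ++ Y.map (Step.shift (2 * d))) (2 * d + 2 * e) :=
    hx.word _ hy' le_rfl
  -- the boxes of the included elements are opened
  have h1 : P.Eqv false 0 (2 * (1 + (d + e - j)))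
      (mulTangle P 1 d e j hj (P.Z (inclTangle P 0 d x)) (P.Z (inclTangle P 0 e y))).word
      (X ++ nestCups P.V (2 * d) 1 ++ Y.map (Step.shift (2 * d)) ++
        nestCups P.V (2 * d + 2 * e) 1 ++ nestCaps P.V (2 * d) j ++
        nestCaps P.V (2 * d + 2 * e + 2 - 2 * j) 1) := by
    have a1 := Eqv.box_Z_ofNat (inclTangle P 0 d x)
    have a2 := (Eqv.box_Z_ofNat (inclTangle P 0 e y)).shift (s₀ := false) (2 * d) 2 (by simp)
    have a3 : Admissible false (2 * d + 2 * (1 + e) + 2) (nestCaps P.V (2 * d) j ++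
        nestCaps P.V (2 * d + 2 * e + 2 - 2 * j) 1) (2 * (1 + (d + e - j))) :=
      ((admissible_nestCaps false _ (2 * d) j (by omega) (by omega)).caps _ 1 (by omega)
        (by omega)).cast (by omega)
    rw [inclTangle_word] at a1 a2
    have := ((a1.cast (show 2 * (1 + d) = 2 * d + 0 + 2 by omega)).append a2).append_right a3
    simpa [hX, hY, mulTangle, Step.shift, Nat.add_comm] using this
  -- the string below `x` is moved to the right of `y` and straightened
  have e1 : P.Eqv false (2 * d) (2 * d + 2 * e + 2)
      (Y.map (Step.shift (2 * d)) ++ (nestCups P.V 0 1).map (Step.shift (2 * d + 2 * e)))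
      ((nestCups P.V 0 1).map (Step.shift (2 * d)) ++ Y.map (Step.shift (2 * d))) :=
    Eqv.word_word hy' (admissible_nestCups_self _ 1) le_rfl le_rfl rfl (by omega)
  rw [← nestCups_eq_shift, ← nestCups_eq_shift] at e1
  have e2 : P.Eqv false (2 * d + 2 * e + 4) (2 * (1 + (d + e - j)))
      (nestCaps P.V (2 * d) j ++ nestCaps P.V (2 * d + 2 * e + 2 - 2 * j) 1)
      (nestCaps P.V (2 * d + 2 * e + 2) 1 ++ nestCaps P.V (2 * d) j) :=
    Eqv.caps_caps (by omega) (by omega) (by omega) (by omega) (by omega)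
  have e3 : P.Eqv false (2 * d + 2 * e + 2) (2 * d + 2 * e + 2) (nestCups P.V (2 * d + 2 * e) 1 ++
      nestCaps P.V (2 * d + 2 * e + 2) 1) [] := Eqv.zigzag_left (by omega) (by omega)
  have e4 : P.Eqv false (2 * d + 2 * e) (2 * (1 + (d + e - j)))
      (nestCaps P.V (2 * d) j ++ (nestCups P.V 0 1).map (Step.shift (2 * (d + e - j))))
      ((nestCups P.V 0 1).map (Step.shift (2 * d + 2 * e)) ++ nestCaps P.V (2 * d) j) :=
    Eqv.caps_word (admissible_nestCups_self _ 1) (by omega) (by omega) (by omega) (by omega)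
      (by omega)
  rw [← nestCups_eq_shift, ← nestCups_eq_shift] at e4
  have hxyc : Admissible false 0 (X ++ Y.map (Step.shift (2 * d)) ++
      nestCups P.V (2 * d + 2 * e) 1) (2 * d + 2 * e + 2) := hxy.cups _ 1 le_rfl
  have hcap : Admissible false (2 * d + 2 * e + 2) (nestCaps P.V (2 * d) j)
      (2 * (1 + (d + e - j))) :=
    (admissible_nestCaps false _ _ j (by omega) (by omega)).cast (by omega)
  refine h1.trans ?_
  refine (e1.symm.inside X (nestCups P.V (2 * d + 2 * e) 1 ++ (nestCaps P.V (2 * d) j ++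
    nestCaps P.V (2 * d + 2 * e + 2 - 2 * j) 1)) hx (admissible_append _ _ _
    (admissible_nestCups false _ _ 1 (by omega)) e2.left) (by simp) rfl).trans ?_
  refine (e2.inside (X ++ Y.map (Step.shift (2 * d)) ++ nestCups P.V (2 * d + 2 * e) 1 ++
    nestCups P.V (2 * d + 2 * e) 1) [] (hxyc.cups _ 1 (by omega)) rfl (by simp) rfl).trans ?_
  refine (e3.inside (X ++ Y.map (Step.shift (2 * d)) ++ nestCups P.V (2 * d + 2 * e) 1)
    (nestCaps P.V (2 * d) j) hxyc hcap (by simp) rfl).trans ?_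
  refine (e4.symm.inside (X ++ Y.map (Step.shift (2 * d))) [] hxy rfl (by simp) rfl).trans ?_
  have a1 := (Eqv.box_Z_ofNat (mulTangle P 0 d e j hj x y)).append_right
    (m := nestCups P.V (2 * (d + e - j)) 1) (w₀ := 2 * (1 + (d + e - j)))
    ((admissible_nestCups false _ _ 1 (by omega)).cast (by omega))
  refine (Eqv.trans ?_ a1.symm)
  have e5 : (mulTangle P 0 d e j hj x y).word ++ nestCups P.V (2 * (d + e - j)) 1 =
      X ++ Y.map (Step.shift (2 * d)) ++
        (nestCaps P.V (2 * d) j ++ nestCups P.V (2 * (d + e - j)) 1 ++ []) := by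
    simp [hX, hY, mulTangle, Step.shift]
  rw [← e5]
  exact Eqv.refl a1.right

theorem incl_mul (a b : P.GJS 0) : incl P 0 (a * b) = incl P 0 a * incl P 0 b := by
  induction a using GJS.induction_on with
  | hadd a a' h h' =>
    simp only [mul_eq_mulMap, map_add, LinearMap.add_apply] at h h' ⊢
    rw [h, h']
  | h d x =>
    induction b using GJS.induction_on with
    | hadd b b' h h' =>
      simp only [mul_eq_mulMap, map_add] at h h' ⊢
      rw [h, h']
    | h e y =>
      rw [of_mul_of, map_sum, incl_of, incl_of]
      refine Eq.trans ?_ (of_mul_of (k := 1) _ _).symm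
      refine Finset.sum_congr rfl fun j hj => ?_
      rw [incl_contract (by simpa [Nat.lt_succ_iff] using hj), incl_of, incl_of]

theorem incl_one : incl P 0 1 = 1 := by
  change incl P 0 (of P 0 0 _) = of P 1 0 _
  rw [incl_of]
  congr 1
  refine eq_of_box_eqv (((Eqv.box_Z_ofNat _).trans ?_).trans (Eqv.box_Z_ofNat _).symm)
  exact (Eqv.box_Z_ofNat (oneTangle P 0)).append_right
    (m := nestCups P.V 0 1) (admissible_nestCups_self _ 1)

theorem rotTangle_zero (x : P.V (Col.ofNat (0 + d))) : P.Z (rotTangle P 0 d x) = x := by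
  refine eq_of_box_eqv ((Eqv.box_Z_ofNat _).trans ?_)
  exact Eqv.refl (admissible_box x)

theorem incl_star (a : P.GJS 0) : incl P 0 (star a) = star (incl P 0 a) := by
  induction a using GJS.induction_on with
  | hadd a a' h h' =>
    have hs : ∀ k (a : P.GJS k), star a = starMap P k a := fun _ _ => rfl
    simp only [hs, map_add] at h h' ⊢
    rw [h, h']
  | h d x =>
    rw [star_of, rotTangle_zero, incl_of, incl_of]
    refine Eq.trans ?_ (star_of (k := 1) _).symm
    congr 1
    refine eq_of_box_eqv ((Eqv.box_Z_ofNat _).trans ((Eqv.box_Z_ofNat _).trans ?_).symm)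
    set X : List (Step P.V) := [ins 0 (box _ (P.st _ x))] with hX
    have hx : Admissible false 0 X (2 * d) := (admissible_box _).cast (by omega)
    have h0 : P.Eqv false 0 (2 * d + 2) [ins 0 (box _ (P.st _ (P.Z (inclTangle P 0 d x))))]
        (X ++ nestCups P.V 0 1) := by
      have h1 := Eqv.box_Z_ofNat (Tangle.adjoint (fun d x => P.st d x) (inclTangle P 0 d x))
      rw [P.Z_adjoint] at h1
      have e : (Tangle.adjoint (fun d x => P.st d x) (inclTangle P 0 d x)).word =
          X ++ nestCups P.V 0 1 := by
        simp [Tangle.adjoint, inclTangle, mirror, hX, Piece.map, legs]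
      rw [e] at h1
      exact h1.cast (by omega)
    have h1 : P.Eqv false 0 (2 * (1 + d)) (rotTangle P 1 d (P.st _ (P.Z (inclTangle P 0 d x)))).word
        (nestCups P.V 0 2 ++ X.map (Step.shift 2) ++ nestCups P.V 2 1 ++ nestCaps P.V 2 1 ++
          nestCaps P.V 1 1) := by
      refine h0.step 2 2 (nestCups P.V 0 2) (nestCaps P.V 2 2) rfl ?_ rfl
        (admissible_nestCups_self _ 2)
        ((admissible_nestCaps false _ 2 2 (by omega) (by omega)).cast (by omega))
      rw [List.map_append, shift_nestCups, nestCaps_add 2 1 1]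
      simp
    have hx2 : Admissible false 0 (nestCups P.V 0 2 ++ X.map (Step.shift 2)) (2 * d + 4) :=
      ((admissible_nestCups_self false 2).word 2 (by simpa using hx) (by omega)).cast (by omega)
    have e1 : P.Eqv false (2 * d + 4) (2 * d + 4) (nestCups P.V 2 1 ++ nestCaps P.V 2 1) [] :=
      Eqv.zigzag_right (by omega) (by omega)
    have e2 : P.Eqv false 4 (2 * d + 2) (nestCaps P.V 1 1 ++ X.map (Step.shift 0))
        (X.map (Step.shift 2) ++ nestCaps P.V 1 1) :=
      Eqv.caps_word (by simpa using hx) (by omega) (by omega) (by omega) (by omega) (by omega)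
    have e3 : P.Eqv false 2 2 (nestCups P.V 1 1 ++ nestCaps P.V 1 1) [] :=
      Eqv.zigzag_right (by omega) (by omega)
    have e4 : P.Eqv false 0 (2 * d + 2)
        (X.map (Step.shift 0) ++ (nestCups P.V 0 1).map (Step.shift (2 * d)))
        ((nestCups P.V 0 1).map (Step.shift 0) ++ X.map (Step.shift 0)) :=
      Eqv.word_word (by simpa using hx) (admissible_nestCups_self _ 1) le_rfl le_rfl (by omega)
        (by omega)
    refine h1.trans ?_
    refine (e1.inside (nestCups P.V 0 2 ++ X.map (Step.shift 2)) (nestCaps P.V 1 1) hx2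
      ((admissible_nestCaps false _ 1 1 (by omega) (by omega)).cast (by omega)) (by simp)
      rfl).trans ?_
    refine (e2.symm.inside (nestCups P.V 0 2) [] (admissible_nestCups_self _ 2)
      (show 2 * d + 2 = 2 * (1 + d) by omega) (by simp) rfl).trans ?_
    refine (e3.inside (nestCups P.V 0 1) X (admissible_nestCups_self _ 1)
      (by simpa using (hx.add 2).cast (show 2 * d + 2 = 2 * (1 + d) by omega)) (by
        rw [nestCups_add 0 1 1]; simp) (l' := nestCups P.V 0 1 ++ X) (by simp)).trans ?_
    have e5 := e4.symm.cast (w₀ := 2 * (1 + d)) (by omega)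
    rw [map_shift_zero, map_shift_zero, ← nestCups_eq_shift] at e5
    exact e5

variable {δ : ℝ}

theorem exp_incl (hP : P.IsSubfactor δ) (hδ : 0 < δ) (a : P.GJS 0) : exp P 0 δ (incl P 0 a) = a := by
  induction a using GJS.induction_on with
  | hadd a a' h h' => rw [map_add, map_add, h, h']
  | h d x =>
    rw [incl_of, exp_of, ← map_smul]
    congr 1
    have hx : Admissible false 0 [ins 0 (box (Col.ofNat (0 + d)) x)] (2 * d) :=
      (admissible_box x).cast (by omega)
    have h1 : P.Z (expTangle P 0 d (P.Z (inclTangle P 0 d x))) = (δ : ℂ) • x := by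
      have h2 := (Eqv.box_Z_ofNat (inclTangle P 0 d x)).append_right
        (m := nestCaps P.V (2 * d + 1) 1) (w₀ := 2 * (0 + d))
        ((admissible_nestCaps false _ _ 1 (by omega) (by omega)).cast (by omega))
      rw [← P.val_eq, expTangle_word, h2.val_ofNat, inclTangle_word]
      have h3 := hP.val_loop (c := Col.ofNat (0 + d)) (l₁ := [ins 0 (box _ x)]) (l₂ := [])
        (w := 2 * d) (p := 2 * d) (by simpa using hx) (by simp [Admissible]) le_rfl
      rw [List.append_nil, List.append_nil, val_box] at h3
      exact h3
    have hδ' : (δ : ℂ) ≠ 0 := by exact_mod_cast hδ.ne'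
    rw [h1, smul_smul, inv_mul_cancel₀ hδ', one_smul]

/-- Both sides are the diagram in which the strings at the top of `x` and `y` are joined, and the
left string of `y` is joined to its right string below the box. -/
theorem trace_contract_exp (x : P.V (Col.ofNat (0 + d)))
    (y : P.V (Col.ofNat (1 + d))) :
    trace P 0 δ (contract P 0 (2 * d) (of P 0 d x) (exp P 0 δ (of P 1 d y))) =
      trace P 1 δ (contract P 1 (2 * d) (incl P 0 (of P 0 d x)) (of P 1 d y)) := by
  have hj : 2 * d ≤ 2 * min d d := by simp
  rw [exp_of, map_smul, map_smul, contract_of hj, incl_of, contract_of hj]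
  rw [trace_of_zero δ (by omega), trace_of_zero δ (by omega), smul_eq_mul, pow_zero, inv_one,
    one_mul, pow_one]
  congr 1
  set X : List (Step P.V) := [ins 0 (box _ x)] with hX
  set Y : List (Step P.V) := [ins 0 (box _ y)] with hY
  have hx : Admissible false 0 X (2 * d) := (admissible_box x).cast (by omega)
  have hy : Admissible false 0 Y (2 * d + 2) := (admissible_box y).cast (by omega)
  have hy' : Admissible (Bool.xor false (2 * d).bodd) 0 Y (2 * d + 2) := by simpa using hy
  have hxy : Admissible false 0 (X ++ Y.map (Step.shift (2 * d))) (2 * d + (2 * d + 2)) :=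
    hx.word _ hy' le_rfl
  have l1 : P.Eqv false 0 0 ([ins 0 (box _ (P.Z (mulTangle P 0 d d (2 * d) hj x
      (P.Z (expTangle P 0 d y)))))] ++ nestCaps P.V 0 0)
      (X ++ Y.map (Step.shift (2 * d)) ++ nestCaps P.V (4 * d + 1) 1 ++
        nestCaps P.V (2 * d) (2 * d)) := by
    have h1 := (Eqv.box_Z_ofNat (mulTangle P 0 d d (2 * d) hj x (P.Z (expTangle P 0 d y)))).cast
      (w₀ := 0) (by omega)
    refine Eqv.trans (by simpa [nestCaps] using h1) ?_
    refine (Eqv.box_Z_ofNat (expTangle P 0 d y)).step (2 * d) 0 X (nestCaps P.V (2 * d) (2 * d))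
      (s₀ := false) (by simp [mulTangle, nestCaps, hX, Step.shift]) ?_ (by simp)
      (hx.cast (by omega)) ((admissible_nestCaps false _ _ _ (by omega) (by omega)).cast (by omega))
    rw [expTangle_word, List.map_append, shift_nestCaps _ _ _ (by omega),
      show 2 * d + 1 + 2 * d = 4 * d + 1 by omega]
    simp [hX, hY]
  have r1 : P.Eqv false 0 0 ([ins 0 (box _ (P.Z (mulTangle P 1 d d (2 * d) hj
      (P.Z (inclTangle P 0 d x)) y)))] ++ nestCaps P.V 1 1)
      (X ++ nestCups P.V (2 * d) 1 ++ Y.map (Step.shift (2 * d)) ++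
        nestCaps P.V (2 * d) (2 * d) ++ nestCaps P.V 2 1 ++ nestCaps P.V 1 1) := by
    have h1 := ((Eqv.box_Z_ofNat (mulTangle P 1 d d (2 * d) hj (P.Z (inclTangle P 0 d x)) y)).cast
      (w₀ := 2) (by omega)).append_right (m := nestCaps P.V 1 1) (w₀ := 0)
      (admissible_nestCaps_self _ 1)
    refine h1.trans ?_
    refine (Eqv.box_Z_ofNat (inclTangle P 0 d x)).step 0 0 [] (Y.map (Step.shift (2 * d)) ++
        nestCaps P.V (2 * d) (2 * d) ++ nestCaps P.V 2 1 ++ nestCaps P.V 1 1)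
      (s₀ := false) ?_ ?_ (by simp) (show 0 = _ by omega) ?_
    · have e : 2 * d + 2 * d + 2 - 2 * (2 * d) = 2 := by omega
      simp [mulTangle, hY, Step.shift, e]
    · simp [inclTangle_word, hX, Step.shift, nestCups]
    · have a1 : Admissible false (2 * d + 2) (Y.map (Step.shift (2 * d))) (4 * d + 4) := by
        have a0 : Admissible (V := P.V) false (2 * d + 2) [] (2 * d + 2) := rfl
        simpa using (a0.word (2 * d) hy' (by omega)).cast (show _ = 4 * d + 4 by omega)
      have a2 : Admissible false (4 * d + 4) (nestCaps P.V (2 * d) (2 * d)) 4 :=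
        (admissible_nestCaps false _ _ _ (by omega) (by omega)).cast (by omega)
      have a3 : Admissible false 4 (nestCaps P.V 2 1) 2 :=
        admissible_nestCaps false 4 2 1 (by omega) (by omega)
      exact (show 2 * d + 2 = 0 + 2 * (1 + d) + 0 by omega) ▸ admissible_append _ _ _
        (admissible_append _ _ _ (admissible_append _ _ _ a1 a2) a3) (admissible_nestCaps_self _ 1)
  refine (l1.trans (Eqv.trans ?_ r1.symm)).closedVal
  -- the string below `x` is moved to the right of `y`, below the maxima, and straightened
  have e1 : P.Eqv false (2 * d) (4 * d + 4)
      (Y.map (Step.shift (2 * d)) ++ (nestCups P.V 0 1).map (Step.shift (4 * d + 2)))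
      ((nestCups P.V 0 1).map (Step.shift (2 * d)) ++ Y.map (Step.shift (2 * d))) :=
    Eqv.word_word hy' (admissible_nestCups_self _ 1) le_rfl le_rfl (by omega) (by omega)
  have e2 : P.Eqv false (4 * d + 2) 4
      (nestCaps P.V (2 * d) (2 * d) ++ (nestCups P.V 0 1).map (Step.shift 2))
      ((nestCups P.V 0 1).map (Step.shift (4 * d + 2)) ++ nestCaps P.V (2 * d) (2 * d)) :=
    Eqv.caps_word (admissible_nestCups_self _ 1) (by omega) (by omega) (by omega) (by omega)
      (by omega)
  rw [← nestCups_eq_shift, ← nestCups_eq_shift] at e1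
  rw [← nestCups_eq_shift, ← nestCups_eq_shift] at e2
  have e3 : P.Eqv false 2 2 (nestCups P.V 2 1 ++ nestCaps P.V 2 1) [] :=
    Eqv.zigzag_right (by omega) (by omega)
  have e4 : P.Eqv false (4 * d + 2) 0 (nestCaps P.V (2 * d) (2 * d) ++ nestCaps P.V 1 1)
      (nestCaps P.V (4 * d + 1) 1 ++ nestCaps P.V (2 * d) (2 * d)) :=
    Eqv.caps_caps (by omega) (by omega) (by omega) (by omega) (by omega)
  have c1 : Admissible false 4 (nestCaps P.V 2 1) 2 :=
    admissible_nestCaps false 4 2 1 (by omega) (by omega)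
  have c2 : Admissible false 2 (nestCaps P.V 1 1) 0 := admissible_nestCaps_self _ 1
  have c3 : Admissible false (4 * d + 2) (nestCaps P.V (2 * d) (2 * d)) 2 :=
    (admissible_nestCaps false _ _ _ (by omega) (by omega)).cast (by omega)
  have c4 : Admissible false (4 * d + 4) (nestCaps P.V (2 * d) (2 * d)) 4 :=
    (admissible_nestCaps false _ _ _ (by omega) (by omega)).cast (by omega)
  have hxy' := hxy.cast (show 2 * d + (2 * d + 2) = 4 * d + 2 by omega)
  refine Eqv.symm ?_
  refine (e1.symm.inside X (nestCaps P.V (2 * d) (2 * d) ++ nestCaps P.V 2 1 ++ nestCaps P.V 1 1)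
    hx (admissible_append _ _ _ (admissible_append _ _ _ c4 c1) c2) (by simp) rfl).trans ?_
  refine (e2.symm.inside (X ++ Y.map (Step.shift (2 * d))) (nestCaps P.V 2 1 ++ nestCaps P.V 1 1)
    hxy' (admissible_append _ _ _ c1 c2) (by simp) rfl).trans ?_
  refine (e3.inside (X ++ Y.map (Step.shift (2 * d)) ++ nestCaps P.V (2 * d) (2 * d))
    (nestCaps P.V 1 1) (admissible_append _ _ _ hxy' c3) c2 (by simp) rfl).trans ?_
  exact e4.inside (X ++ Y.map (Step.shift (2 * d))) [] hxy' rfl (by simp) (by simp)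

/-- The map `E_0` is adjoint to the inclusion of `F_0` into `F_1`. -/
theorem trace_mul_exp (hP : P.IsSubfactor δ) (hδ : 0 < δ) (a : P.GJS 0) (b : P.GJS 1) :
    trace P 0 δ (a * exp P 0 δ b) = trace P 1 δ (incl P 0 a * b) := by
  let S0 := contractionSystem P 0 hδ hP P.turnInvariant_zero
  let S1 := contractionSystem P 1 hδ hP hP.turnInvariant_one
  induction a using GJS.induction_on with
  | hadd a a' h h' =>
    simp only [mul_eq_mulMap, map_add, LinearMap.add_apply] at h h' ⊢
    rw [h, h']
  | h d x =>
    induction b using GJS.induction_on with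
    | hadd b b' h h' =>
      simp only [mul_eq_mulMap, map_add] at h h' ⊢
      rw [h, h']
    | h e y =>
      have hx : of P 0 d x ∈ S0.deg d := ⟨x, rfl⟩
      have hx1 : incl P 0 (of P 0 d x) ∈ S1.deg d := by rw [incl_of]; exact ⟨_, rfl⟩
      have hy1 : of P 1 e y ∈ S1.deg e := ⟨y, rfl⟩
      have hy : exp P 0 δ (of P 1 e y) ∈ S0.deg e := by
        rw [exp_of, ← map_smul]; exact ⟨_, rfl⟩
      by_cases hde : d = e
      · subst hde
        rw [S0.trace_mul hx hy, S1.trace_mul hx1 hy1]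
        exact trace_contract_exp x y
      · rw [S0.trace_mul_of_ne hx hy hde, S1.trace_mul_of_ne hx1 hy1 hde]

end GJS
end StarPlanarAlgebra

/-! ### Adjoints of inclusions of finite pre-von Neumann algebras -/

section Squares
variable {A : Type u} [AddCommGroup A] [Module ℂ A] [Mul A] [One A] [Star A]
variable {B : Type u} [AddCommGroup B] [Module ℂ B] [Mul B] [One B] [Star B]
variable {tA : A →ₗ[ℂ] ℂ} {tB : B →ₗ[ℂ] ℂ} {i : A →ₗ[ℂ] B} {E : B →ₗ[ℂ] A}

namespace IsFinitePreVN

/-- The trace form is nondegenerate. -/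
theorem eq_of_trace_mul_eq (hA : IsFinitePreVN A tA) {x y : A}
    (h : ∀ c, tA (c * x) = tA (c * y)) : x = y := by
  by_contra hxy
  have hz : x - y ≠ 0 := sub_ne_zero.2 hxy
  have h1 := hA.inner_pos _ hz
  have h2 : star (x - y) * (x - y) = star (x - y) * x + star (x - y) * ((-1 : ℂ) • y) := by
    rw [← hA.mul_add, neg_one_smul, sub_eq_add_neg]
  rw [h2, map_add, hA.mul_smul, map_smul, h, neg_one_smul, add_neg_cancel] at h1
  simp at h1

theorem star_one (hA : IsFinitePreVN A tA) : star (1 : A) = 1 := by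
  have := hA.star_mul (star 1) 1
  rw [hA.mul_one, hA.star_star, hA.mul_one] at this
  exact this.symm

theorem trace_star (hA : IsFinitePreVN A tA) (a : A) : tA (star a) = conj (tA a) := by
  have h := hA.inner_conj 1 a
  rwa [hA.mul_one, hA.star_one, hA.one_mul] at h

end IsFinitePreVN

/-- A map preserving the operations and the trace preserves the inner product, hence is
injective. -/
theorem isCompatiblePair_of_map (hA : IsFinitePreVN A tA) (hB : IsFinitePreVN B tB)
    (map_one : i 1 = 1) (map_mul : ∀ a b, i (a * b) = i a * i b)
    (map_star : ∀ a, i (star a) = star (i a)) (trace : ∀ a, tB (i a) = tA a) :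
    IsCompatiblePair tA tB i where
  preVN_left := hA
  preVN_right := hB
  injective := by
    refine (injective_iff_map_eq_zero i).2 fun a ha => ?_
    by_contra h
    have h1 := hA.inner_pos a h
    rw [← trace, map_mul, ha, ← zero_smul ℂ (0 : B), hB.mul_smul, zero_smul, map_zero] at h1
    simp at h1
  map_one := map_one
  map_mul := map_mul
  map_star := map_star
  trace := trace

/-- The adjoint of an inclusion for the trace forms is a bimodule retraction. -/
theorem IsCompatiblePair.isBimoduleRetraction (h : IsCompatiblePair tA tB i)
    (hE : ∀ a b, tA (a * E b) = tB (i a * b)) : IsBimoduleRetraction tA tB i E where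
  retraction a := h.preVN_left.eq_of_trace_mul_eq fun c => by
    rw [hE, ← h.map_mul, h.trace]
  map_star b := h.preVN_left.eq_of_trace_mul_eq fun c => by
    have hA := h.preVN_left
    have hB := h.preVN_right
    rw [hE, ← hB.star_star (i c), ← hB.star_mul, hB.trace_star, ← h.map_star, hB.trace_mul_comm,
      ← hE, ← hA.trace_star, hA.star_mul, hA.star_star, hA.trace_mul_comm]
  trace b := by
    have := hE 1 b
    rwa [h.preVN_left.one_mul, h.map_one, h.preVN_right.one_mul] at this
  left_mul a b := h.preVN_left.eq_of_trace_mul_eq fun c => by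
    rw [hE, ← h.preVN_right.mul_assoc, ← h.map_mul, ← hE, h.preVN_left.mul_assoc]
  right_mul b a := h.preVN_left.eq_of_trace_mul_eq fun c => by
    have hA := h.preVN_left
    have hB := h.preVN_right
    rw [hE, ← hB.mul_assoc, hB.trace_mul_comm, ← hB.mul_assoc, ← h.map_mul, ← hE,
      hA.mul_assoc, hA.trace_mul_comm, hA.mul_assoc]

theorem IsCompatiblePair.comp {C : Type u} [AddCommGroup C] [Module ℂ C] [Mul C] [One C] [Star C]
    {tC : C →ₗ[ℂ] ℂ} {i' : B →ₗ[ℂ] C} (h' : IsCompatiblePair tB tC i')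
    (h : IsCompatiblePair tA tB i) : IsCompatiblePair tA tC (i' ∘ₗ i) where
  preVN_left := h.preVN_left
  preVN_right := h'.preVN_right
  injective := h'.injective.comp h.injective
  map_one := by rw [LinearMap.comp_apply, h.map_one, h'.map_one]
  map_mul a b := by simp only [LinearMap.comp_apply, h.map_mul, h'.map_mul]
  map_star a := by simp only [LinearMap.comp_apply, h.map_star, h'.map_star]
  trace a := by rw [LinearMap.comp_apply, h'.trace, h.trace]

variable {A00 : Type u} [AddCommGroup A00] [Module ℂ A00] [Mul A00] [One A00] [Star A00]
variable {A01 : Type u} [AddCommGroup A01] [Module ℂ A01] [Mul A01] [One A01] [Star A01]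
variable {A10 : Type u} [AddCommGroup A10] [Module ℂ A10] [Mul A10] [One A10] [Star A10]
variable {A11 : Type u} [AddCommGroup A11] [Module ℂ A11] [Mul A11] [One A11] [Star A11]
variable {t00 : A00 →ₗ[ℂ] ℂ} {t01 : A01 →ₗ[ℂ] ℂ} {t10 : A10 →ₗ[ℂ] ℂ} {t11 : A11 →ₗ[ℂ] ℂ}
  {i : A00 →ₗ[ℂ] A01} {j : A00 →ₗ[ℂ] A10} {i' : A01 →ₗ[ℂ] A11} {j' : A10 →ₗ[ℂ] A11}
  {F : A01 →ₗ[ℂ] A00} {G : A11 →ₗ[ℂ] A01} {F' : A11 →ₗ[ℂ] A10} {G' : A10 →ₗ[ℂ] A00}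

/-- A square of compatible pairs commutes if its four inclusions have adjoints for the trace forms
and the adjoint `F'` of one inclusion into `A11` restricts to the adjoint `F` of the opposite
inclusion. -/
theorem isCommutingSquare_of_adjoint (comm : ∀ a, i' (i a) = j' (j a))
    (hi : IsCompatiblePair t00 t01 i) (hj : IsCompatiblePair t00 t10 j)
    (hi' : IsCompatiblePair t01 t11 i') (hj' : IsCompatiblePair t10 t11 j')
    (hF : ∀ a b, t00 (a * F b) = t01 (i a * b)) (hG : ∀ a b, t01 (a * G b) = t11 (i' a * b))
    (hF' : ∀ a b, t10 (a * F' b) = t11 (j' a * b)) (hG' : ∀ a b, t00 (a * G' b) = t10 (j a * b))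
    (restrict : ∀ a, F' (i' a) = j (F a)) :
    IsCommutingSquare t00 t01 t10 t11 i j i' j' (G' ∘ₗ F') G F' := by
  have h00 := hi.preVN_left
  have h01 := hi.preVN_right
  have h10 := hj.preVN_right
  have h11 := hi'.preVN_right
  have hj'j : i' ∘ₗ i = j' ∘ₗ j := LinearMap.ext comm
  have h1 : ∀ a, F (G a) = G' (F' a) := fun a => h00.eq_of_trace_mul_eq fun c => by
    rw [hF, hG, comm, ← hF', ← hG']
  have h2 : ∀ b, G (j' b) = i (G' b) := fun b => h01.eq_of_trace_mul_eq fun c => by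
    rw [hG, h11.trace_mul_comm, ← hF', restrict, h10.trace_mul_comm, ← hG', h01.trace_mul_comm,
      ← hF, h00.trace_mul_comm]
  exact
    { comm := comm
      pair_00_01 := hi
      pair_00_10 := hj
      pair_01_11 := hi'
      pair_10_11 := hj'
      retraction_00 := (hi'.comp hi).isBimoduleRetraction fun a b => by
        rw [hj'j, LinearMap.comp_apply, LinearMap.comp_apply, ← hF', ← hG']
      retraction_01 := hi'.isBimoduleRetraction hG
      retraction_10 := hj'.isBimoduleRetraction hF'
      exp_10_01 := fun a => by rw [restrict, ← comm, h1]; rfl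
      exp_01_10 := fun a => by rw [h2]; rfl }

end Squares

/-! ### Planar subalgebras of subfactor planar algebras -/

namespace StarPlanarAlgebra

/-- The pairing `x, y ↦ τ(x y)` of `P_n`. -/
def tauPairing (P : StarPlanarAlgebra.{u}) (δ : ℝ) (n : ℕ) :
    P.V (Col.ofNat n) →ₗ[ℂ] P.V (Col.ofNat n) →ₗ[ℂ] ℂ :=
  LinearMap.mk₂ ℂ (fun x y => P.tau δ (P.mul x y))
    (fun x x' y => by
      have h : P.mul (x + x') y = P.mul x y + P.mul x' y :=
        P.Z_add [] _ 0 x x' _ _ _ rfl rfl rfl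
      rw [h]; unfold tau; rw [GJS.scalar_trace_add, map_add, mul_add])
    (fun a x y => by
      have h : P.mul (a • x) y = a • P.mul x y := P.Z_smul [] _ 0 a x _ _ rfl rfl
      rw [h]; unfold tau
      rw [GJS.scalar_trace_smul, map_smul, smul_eq_mul, smul_eq_mul, mul_left_comm])
    (fun x y y' => by
      have h : P.mul x (y + y') = P.mul x y + P.mul x y' :=
        P.Z_add [ins 0 (box _ x)] _ _ y y' _ _ _ rfl rfl rfl
      rw [h]; unfold tau; rw [GJS.scalar_trace_add, map_add, mul_add])
    (fun a x y => by
      have h : P.mul x (a • y) = a • P.mul x y :=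
        P.Z_smul [ins 0 (box _ x)] _ _ a y _ _ rfl rfl
      rw [h]; unfold tau
      rw [GJS.scalar_trace_smul, map_smul, smul_eq_mul, smul_eq_mul, mul_left_comm])

theorem tau_mul_comm (P : StarPlanarAlgebra.{u}) (δ : ℝ) {n : ℕ} (x y : P.V (Col.ofNat n)) :
    P.tau δ (P.mul x y) = P.tau δ (P.mul y x) := by
  rw [tau_mul_eq, tau_mul_eq]
  congr 1
  have h := dual_bx (k := 0) y (Nat.zero_le _)
  have e : bx 0 y = [ins 0 (box _ y)] := by simp [bx, rotL, Step.shift]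
  rw [e] at h
  exact (con_comm (admissible_box x) (admissible_box y) h).closedVal

namespace StarPlanarSubalgebra
variable {P : StarPlanarAlgebra.{u}} (Q : P.StarPlanarSubalgebra) {δ : ℝ}

/-- The inclusion of the spaces of the planar algebra `Q` into those of `P`. This is `Q.incl`, with
the space `Q_c` read as a space of the planar algebra `Q.toStarPlanarAlgebra`. -/
def toP (c : Col) : Q.toStarPlanarAlgebra.V c → P.V c := Q.incl c

theorem coe_Z {c : Col} (T : Tangle Q.toStarPlanarAlgebra.V c) :
    Q.toP c (Q.toStarPlanarAlgebra.Z T) = P.Z (T.map Q.toP) := rfl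

theorem map_mulTangle {n : ℕ} (x y : Q.toStarPlanarAlgebra.V (Col.ofNat n)) :
    (Q.toStarPlanarAlgebra.mulTangle x y).map Q.toP =
      P.mulTangle (Q.toP _ x) (Q.toP _ y) := by
  simp only [mulTangle, Tangle.map, List.map_append, map_nestCaps]; rfl

theorem map_traceTangle {n : ℕ} (x : Q.toStarPlanarAlgebra.V (Col.ofNat n)) :
    (Q.toStarPlanarAlgebra.traceTangle x).map Q.toP = P.traceTangle (Q.toP _ x) := by
  simp only [traceTangle, Tangle.map, List.map_cons, map_nestCaps]; rfl

theorem coe_mul {n : ℕ} (x y : Q.toStarPlanarAlgebra.V (Col.ofNat n)) :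
    Q.toP _ (Q.toStarPlanarAlgebra.mul x y) = P.mul (Q.toP _ x) (Q.toP _ y) := by
  rw [mul, coe_Z, map_mulTangle]; rfl

theorem scalar_eq (hP : P.IsSubfactor δ) {s : Bool}
    (x : Q.toStarPlanarAlgebra.V (Col.zero s)) :
    Q.toStarPlanarAlgebra.scalar s x = P.scalar s (Q.toP _ x) := by
  have h1 : Q.toStarPlanarAlgebra.one s ≠ 0 := fun h =>
    hP.one_ne_zero s (congrArg (Q.toP _) h)
  have hx : P.scalar s (Q.toP _ x) • Q.toStarPlanarAlgebra.one s = x :=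
    Subtype.ext (hP.scalar_smul_one (Q.toP _ x))
  conv_lhs => rw [← hx]
  rw [map_smul, scalar_one_of_ne_zero h1, smul_eq_mul, mul_one]

theorem tau_toP (hP : P.IsSubfactor δ) {n : ℕ} (x : Q.toStarPlanarAlgebra.V (Col.ofNat n)) :
    Q.toStarPlanarAlgebra.tau δ x = P.tau δ (Q.toP _ x) := by
  rw [tau, tau, Q.scalar_eq hP, coe_Z, map_traceTangle]

/-- A planar subalgebra of a subfactor planar algebra is a subfactor planar algebra. -/
theorem isSubfactor (hP : P.IsSubfactor δ) : Q.toStarPlanarAlgebra.IsSubfactor δ where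
  finite_dimensional c := by
    have := hP.finite_dimensional c
    change FiniteDimensional ℂ (Q.carrier c)
    infer_instance
  connected s := by
    have h1 : Q.toStarPlanarAlgebra.one s ≠ 0 := fun h =>
      hP.one_ne_zero s (congrArg (Q.toP _) h)
    exact (finrank_eq_one_iff_of_nonzero' _ h1).2 fun x =>
      ⟨P.scalar s (Q.toP _ x), Subtype.ext (hP.scalar_smul_one (Q.toP _ x))⟩
  modulus l₁ l₂ p T T' h h' := Subtype.ext <|
    hP.modulus (l₁.map (Step.map Q.toP)) (l₂.map (Step.map Q.toP)) p
      (T.map Q.toP) (T'.map Q.toP)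
      (by simp [Tangle.map, h, Step.map, Piece.map]) (by simp [Tangle.map, h'])
  spherical x := by
    rw [Q.scalar_eq hP, Q.scalar_eq hP]
    exact hP.spherical (Q.toP _ x)
  positive n x hx := by
    rw [Q.tau_toP hP, coe_mul]
    exact hP.positive n (Q.toP _ x) fun h => hx (Subtype.ext h)

/-! ### The inclusion of `F_k(Q)` into `F_k(P)` -/

variable {k d e j : ℕ}

theorem gjsIncl_of (x : Q.toStarPlanarAlgebra.V (Col.ofNat (k + d))) :
    Q.gjsIncl k (GJS.of Q.toStarPlanarAlgebra k d x) = GJS.of P k d (Q.toP _ x) :=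
  DirectSum.toModule_lof ℂ (M := fun d => Q.toStarPlanarAlgebra.V (Col.ofNat (k + d))) d x

theorem gjsComponentwise_of (E : ∀ n, P.V (Col.ofNat n) →ₗ[ℂ] Q.carrier (Col.ofNat n))
    (x : P.V (Col.ofNat (k + d))) :
    Q.gjsComponentwise k E (GJS.of P k d x) = GJS.of Q.toStarPlanarAlgebra k d (E (k + d) x) :=
  DirectSum.toModule_lof ℂ (M := fun d => P.V (Col.ofNat (k + d))) d x

theorem map_gjs_mulTangle (hj : j ≤ 2 * min d e)
    (x : Q.toStarPlanarAlgebra.V (Col.ofNat (k + d)))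
    (y : Q.toStarPlanarAlgebra.V (Col.ofNat (k + e))) :
    (GJS.mulTangle Q.toStarPlanarAlgebra k d e j hj x y).map Q.toP =
      GJS.mulTangle P k d e j hj (Q.toP _ x) (Q.toP _ y) := by
  simp only [GJS.mulTangle, Tangle.map, List.map_append, map_nestCaps]; rfl

theorem map_oneTangle : (GJS.oneTangle Q.toStarPlanarAlgebra k).map Q.toP =
    GJS.oneTangle P k := by
  simp only [GJS.oneTangle, Tangle.map, map_nestCups]

theorem map_rotTangle (x : Q.toStarPlanarAlgebra.V (Col.ofNat (k + d))) :
    (GJS.rotTangle Q.toStarPlanarAlgebra k d x).map Q.toP =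
      GJS.rotTangle P k d (Q.toP _ x) := by
  simp only [GJS.rotTangle, Tangle.map, List.map_append, List.map_cons, map_nestCups,
    map_nestCaps]; rfl

theorem gjsIncl_one : Q.gjsIncl k 1 = 1 := by
  change Q.gjsIncl k (GJS.of Q.toStarPlanarAlgebra k 0 _) = GJS.of P k 0 _
  rw [gjsIncl_of, coe_Z, map_oneTangle]

theorem gjsIncl_mul (a b : Q.toStarPlanarAlgebra.GJS k) :
    Q.gjsIncl k (a * b) = Q.gjsIncl k a * Q.gjsIncl k b := by
  induction a using GJS.induction_on with
  | hadd a a' h h' =>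
    simp only [GJS.mul_eq_mulMap, map_add, LinearMap.add_apply] at h h' ⊢
    rw [h, h']
  | h d x =>
    induction b using GJS.induction_on with
    | hadd b b' h h' =>
      simp only [GJS.mul_eq_mulMap, map_add] at h h' ⊢
      rw [h, h']
    | h e y =>
      rw [gjsIncl_of, gjsIncl_of, GJS.of_mul_of, GJS.of_mul_of, map_sum]
      refine Finset.sum_congr rfl fun j hj => ?_
      have hj' : j ≤ 2 * min d e := by simpa [Nat.lt_succ_iff] using hj
      rw [GJS.contract_of hj', GJS.contract_of hj', gjsIncl_of, coe_Z, map_gjs_mulTangle]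

theorem gjsIncl_star (a : Q.toStarPlanarAlgebra.GJS k) :
    Q.gjsIncl k (star a) = star (Q.gjsIncl k a) := by
  induction a using GJS.induction_on with
  | hadd a a' h h' =>
    have hs : ∀ a : Q.toStarPlanarAlgebra.GJS k,
      star a = GJS.starMap Q.toStarPlanarAlgebra k a := fun _ => rfl
    have hs' : ∀ a : P.GJS k, star a = GJS.starMap P k a := fun _ => rfl
    simp only [hs, hs', map_add] at h h' ⊢
    rw [h, h']
  | h d x =>
    rw [GJS.star_of, gjsIncl_of, gjsIncl_of, GJS.star_of, coe_Z, map_rotTangle]; rfl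

theorem trace_gjsIncl (hP : P.IsSubfactor δ) (a : Q.toStarPlanarAlgebra.GJS k) :
    GJS.trace P k δ (Q.gjsIncl k a) = GJS.trace Q.toStarPlanarAlgebra k δ a := by
  induction a using GJS.induction_on with
  | hadd a a' h h' => rw [map_add, map_add, map_add, h, h']
  | h d x =>
    rw [gjsIncl_of]
    by_cases hd : d = 0
    · subst hd
      rw [GJS.trace_of_same, GJS.trace_of_same, Q.tau_toP hP]
    · rw [GJS.trace_of_ne δ hd, GJS.trace_of_ne δ hd]

theorem incl_gjsIncl (a : Q.toStarPlanarAlgebra.GJS 0) :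
    Q.gjsIncl 1 (GJS.incl Q.toStarPlanarAlgebra 0 a) = GJS.incl P 0 (Q.gjsIncl 0 a) := by
  induction a using GJS.induction_on with
  | hadd a a' h h' => simp only [map_add, h, h']
  | h d x => rw [GJS.incl_of, gjsIncl_of, gjsIncl_of, GJS.incl_of]; rfl

theorem exp_gjsIncl (a : Q.toStarPlanarAlgebra.GJS 1) :
    GJS.exp P 0 δ (Q.gjsIncl 1 a) = Q.gjsIncl 0 (GJS.exp Q.toStarPlanarAlgebra 0 δ a) := by
  induction a using GJS.induction_on with
  | hadd a a' h h' => simp only [map_add, h, h']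
  | h d x => rw [GJS.exp_of, map_smul, gjsIncl_of, gjsIncl_of, GJS.exp_of]; rfl

/-! ### Trace-preserving expectations onto a planar subalgebra -/

/-- The expectations exist because `τ` is faithful on `Q_n`: the form `τ(x y)` identifies `Q_n` with
its dual. -/
theorem exists_isTraceExpectation (hP : P.IsSubfactor δ) :
    ∃ E : ∀ n, P.V (Col.ofNat n) →ₗ[ℂ] Q.carrier (Col.ofNat n), Q.IsTraceExpectation δ E := by
  have key : ∀ n, ∃ E : P.V (Col.ofNat n) →ₗ[ℂ] Q.carrier (Col.ofNat n),
      ∀ x (y : Q.carrier (Col.ofNat n)),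
        P.tau δ (P.mul (E x : P.V (Col.ofNat n)) y) = P.tau δ (P.mul x y) := fun n => by
    have := hP.finite_dimensional (Col.ofNat n)
    let S := Q.carrier (Col.ofNat n)
    -- the functionals on `Q_n` given by elements of `P_n`
    let B : P.V (Col.ofNat n) →ₗ[ℂ] Module.Dual ℂ S :=
      (LinearMap.lcomp ℂ ℂ S.subtype) ∘ₗ P.tauPairing δ n
    have hB : ∀ x y, B x y = P.tau δ (P.mul x y) := fun _ _ => rfl
    have inj : Function.Injective (B ∘ₗ S.subtype) := by
      refine (injective_iff_map_eq_zero _).2 fun y hy => ?_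
      by_contra hne
      have h1 := hP.positive n (P.st _ y) fun h => hne <| Subtype.ext <| by
        have h' := congrArg (P.st _) h
        rwa [P.st_st, map_zero] at h'
      rw [P.st_st] at h1
      have h2 : B y ⟨P.st _ y, Q.st_mem _ _ y.2⟩ = 0 := DFunLike.congr_fun hy _
      rw [hB] at h2
      rw [h2] at h1
      simp at h1
    let e : S ≃ₗ[ℂ] Module.Dual ℂ S :=
      LinearEquiv.ofInjectiveOfFinrankEq (B ∘ₗ S.subtype) inj
        (Subspace.dual_finrank_eq).symm
    refine ⟨e.symm.toLinearMap ∘ₗ B, fun x y => ?_⟩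
    have h1 : e (e.symm (B x)) = B x := e.apply_symm_apply _
    exact DFunLike.congr_fun h1 y
  choose E hE using key
  exact ⟨E, hE⟩

end StarPlanarSubalgebra
end StarPlanarAlgebra

/-! ### Adjointness of the componentwise expectations -/

namespace StarPlanarAlgebra
namespace StarPlanarSubalgebra
variable {P : StarPlanarAlgebra.{u}} (Q : P.StarPlanarSubalgebra) {δ : ℝ}

/-- The componentwise expectation is adjoint to the inclusion of `F_k(Q)` into `F_k(P)`. -/
theorem trace_mul_gjsComponentwise {k : ℕ} (hδ : 0 < δ) (hP : P.IsSubfactor δ)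
    (hk : P.TurnInvariant k) (hk' : Q.toStarPlanarAlgebra.TurnInvariant k)
    {E : ∀ n, P.V (Col.ofNat n) →ₗ[ℂ] Q.carrier (Col.ofNat n)} (hE : Q.IsTraceExpectation δ E)
    (a : Q.toStarPlanarAlgebra.GJS k) (b : P.GJS k) :
    GJS.trace Q.toStarPlanarAlgebra k δ (a * Q.gjsComponentwise k E b) =
      GJS.trace P k δ (Q.gjsIncl k a * b) := by
  let S := GJS.contractionSystem P k hδ hP hk
  let S' := GJS.contractionSystem Q.toStarPlanarAlgebra k hδ (Q.isSubfactor hP) hk'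
  induction a using GJS.induction_on with
  | hadd a a' h h' =>
    simp only [GJS.mul_eq_mulMap, map_add, LinearMap.add_apply] at h h' ⊢
    rw [h, h']
  | h d x =>
    induction b using GJS.induction_on with
    | hadd b b' h h' =>
      simp only [GJS.mul_eq_mulMap, map_add] at h h' ⊢
      rw [h, h']
    | h e z =>
      obtain ⟨w, hw⟩ : ∃ w, GJS.of Q.toStarPlanarAlgebra k d x =
          star (GJS.of Q.toStarPlanarAlgebra k d w) := by
        rw [← S'.isFinitePreVN.star_star (GJS.of Q.toStarPlanarAlgebra k d x), GJS.star_of]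
        exact ⟨_, rfl⟩
      rw [hw, gjsIncl_star, gjsIncl_of, gjsComponentwise_of]
      have h1 : star (GJS.of Q.toStarPlanarAlgebra k d w) ∈ S'.deg d := by
        rw [GJS.star_of]; exact ⟨_, rfl⟩
      have h2 : GJS.of Q.toStarPlanarAlgebra k e (E (k + e) z) ∈ S'.deg e := ⟨_, rfl⟩
      have h3 : star (GJS.of P k d (Q.toP _ w)) ∈ S.deg d := by
        rw [GJS.star_of]; exact ⟨_, rfl⟩
      have h4 : GJS.of P k e z ∈ S.deg e := ⟨_, rfl⟩
      by_cases hde : d = e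
      · subst hde
        rw [S'.trace_mul h1 h2, S.trace_mul h3 h4]
        refine (GJS.trace_contract_star hδ hk' w (E (k + d) z)).trans
          (Eq.trans ?_ (GJS.trace_contract_star hδ hk (Q.toP _ w) z).symm)
        refine congrArg _ ((Q.tau_toP hP _).trans ?_)
        refine (congrArg _ (Q.coe_mul _ (E (k + d) z))).trans ?_
        rw [tau_mul_comm, tau_mul_comm P δ _ z]
        exact hE (k + d) z ⟨P.st _ (Q.toP _ w), Q.st_mem _ _ w.2⟩
      · rw [S'.trace_mul_of_ne h1 h2 hde, S.trace_mul_of_ne h3 h4 hde]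

end StarPlanarSubalgebra

theorem GJS.isCompatiblePair_incl {P : StarPlanarAlgebra.{u}} {δ : ℝ} (hδ : 0 < δ)
    (hP : P.IsSubfactor δ) :
    IsCompatiblePair (GJS.trace P 0 δ) (GJS.trace P 1 δ) (GJS.incl P 0) := by
  have h0 := (GJS.contractionSystem P 0 hδ hP P.turnInvariant_zero).isFinitePreVN
  have h1 := (GJS.contractionSystem P 1 hδ hP hP.turnInvariant_one).isFinitePreVN
  have hexp : ∀ b, GJS.trace P 0 δ (GJS.exp P 0 δ b) = GJS.trace P 1 δ b := fun b => by
    have := GJS.trace_mul_exp hP hδ 1 b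
    rwa [h0.one_mul, GJS.incl_one, h1.one_mul] at this
  exact isCompatiblePair_of_map h0 h1 GJS.incl_one GJS.incl_mul GJS.incl_star fun a => by
    rw [← hexp, GJS.exp_incl hP hδ]

end StarPlanarAlgebra

theorem mainTheorem5 (P : StarPlanarAlgebra.{u}) (δ : ℝ) (hδ : 1 < δ) (hP : P.IsSubfactor δ)
    (Q : P.StarPlanarSubalgebra) :
    ∃ E : ∀ n, P.V (Col.ofNat n) →ₗ[ℂ] Q.carrier (Col.ofNat n),
      Q.IsTraceExpectation δ E ∧
      IsCommutingSquare
        (StarPlanarAlgebra.GJS.trace Q.toStarPlanarAlgebra 0 δ)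
        (StarPlanarAlgebra.GJS.trace Q.toStarPlanarAlgebra 1 δ)
        (StarPlanarAlgebra.GJS.trace P 0 δ)
        (StarPlanarAlgebra.GJS.trace P 1 δ)
        (StarPlanarAlgebra.GJS.incl Q.toStarPlanarAlgebra 0)
        (Q.gjsIncl 0)
        (Q.gjsIncl 1)
        (StarPlanarAlgebra.GJS.incl P 0)
        (Q.gjsComponentwise 0 E ∘ₗ StarPlanarAlgebra.GJS.exp P 0 δ)
        (Q.gjsComponentwise 1 E)
        (StarPlanarAlgebra.GJS.exp P 0 δ) := by
  have hδ' : 0 < δ := one_pos.trans hδ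
  have hQ := Q.isSubfactor hP
  obtain ⟨E, hE⟩ := Q.exists_isTraceExpectation hP
  have hi := StarPlanarAlgebra.GJS.isCompatiblePair_incl hδ' hQ
  have hj' := StarPlanarAlgebra.GJS.isCompatiblePair_incl hδ' hP
  have hj := isCompatiblePair_of_map hi.preVN_left hj'.preVN_left Q.gjsIncl_one Q.gjsIncl_mul
    Q.gjsIncl_star (Q.trace_gjsIncl hP)
  have hi' := isCompatiblePair_of_map hi.preVN_right hj'.preVN_right Q.gjsIncl_one Q.gjsIncl_mul
    Q.gjsIncl_star (Q.trace_gjsIncl hP)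
  exact ⟨E, hE, isCommutingSquare_of_adjoint Q.incl_gjsIncl hi hj hi' hj'
    (StarPlanarAlgebra.GJS.trace_mul_exp hQ hδ')
    (Q.trace_mul_gjsComponentwise hδ' hP hP.turnInvariant_one hQ.turnInvariant_one hE)
    (StarPlanarAlgebra.GJS.trace_mul_exp hP hδ')
    (Q.trace_mul_gjsComponentwise hδ' hP P.turnInvariant_zero
      Q.toStarPlanarAlgebra.turnInvariant_zero hE)
    Q.exp_gjsIncl⟩

end
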